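/- Call the elements of Cantor space $2^{\omega}$ *reals*, and identify $n\in\mathbb N$ with the real consisting of $n$ ones followed by zeros. An *infinite time Turing machine* has three one-way infinite tapes (input, scratch, output) with cells holding $0$ or $1$, one head that reads and writes the three cells in its column, and a finite program with finitely many states, among them distinct *start*, *limit* and *halt* states. The computation on a real $x$ begins in the start state with the head on the left-most cell, $x$ on the input tape, and the other tapes filled with zeros. Successor steps are those of a classical Turing machine (a move to the left from the left-most cell leaves the head in place). At a limit ordinal stage the head is on the left-most cell, the state is the limit state, and each cell holds the $\limsup$ of its earlier values. When the halt state is first reached, the output is the content of the output tape. A set $A\subseteq 2^{\omega}$ is *infinite time decidable* if there is a program that on every input $x\in A$ halts with output $1$, and on every input $x\in 2^{\omega}\setminus A$ halts with output $0$. A real $x$ codes the relation $\vartriangleleft$ on $\mathbb N$ given by $i\vartriangleleft j\iff x(\langle i,j\rangle)=1$, where $\langle\cdot,\cdot\rangle$ is the Gödel pairing function. Let $\mathrm{WO}$ be the set of reals $x$ such that the relation coded by $x$ is a strict well-order of its field $\{i:\exists j\,(i\vartriangleleft j\text{ or }j\vartriangleleft i)\}\subseteq\mathbb N$. A set $A\subseteq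 2^{\omega}$ is $\Sigma^1_1$ (respectively $\Pi^1_1$) if it is defined, without real parameters, by a formula $\exists Y_1\cdots\exists Y_n\,\varphi(x,Y_1,\dots,Y_n)$ (respectively $\forall Y_1\cdots\forall Y_n\,\varphi(x,Y_1,\dots,Y_n)$), where $Y_1,\dots,Y_n$ range over $2^{\omega}$ (that is, over sets of natural numbers) and $\varphi$ is a formula of second order arithmetic all of whose quantifiers range over $\mathbb N$. **Theorem.** The set $\mathrm{WO}$ is infinite time decidable. Moreover, every $\Pi^1_1$ set $A\subseteq 2^{\omega}$ and every $\Sigma^1_1$ set $A\subseteq 2^{\omega}$ is infinite time decidable. -/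

import Mathlib

/-! ## Reals, and natural numbers as reals -/

/-- Cantor space: a "real" is an infinite binary sequence. -/
abbrev CantorReal : Type := ℕ → Bool

/-- The natural number `n` as a real: `n` ones followed by zeros. -/
def natToReal (n : ℕ) : CantorReal := fun i => decide (i < n)

/-! ## Infinite time Turing machines -/

namespace ITTM

/-- The three tapes of a machine. -/
inductive TapeName : Type
  | input
  | scratch
  | output

/-- The movements of the head: one cell to the left, one cell to the right, or not at all. -/
inductive Move : Type
  | left
  | right
  | stay

/-- A program: a finite set of states, three distinct special states, and a transition table. The
single head reads, and overwrites, the three cells (one on each tape) on which it rests. -/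
structure Program where
  State : Type
  finite_state : Finite State
  start : State
  limit : State
  halt : State
  start_ne_limit : start ≠ limit
  start_ne_halt : start ≠ halt
  limit_ne_halt : limit ≠ halt
  trans : State → (TapeName → Bool) → State × (TapeName → Bool) × Move

/-- A complete machine configuration, for the state set `Q`. The tapes are infinite to the right. -/
structure Config (Q : Type) where
  state : Q
  head : ℕ
  tape : TapeName → CantorReal

/-- The new position of the head. On the left-most cell a move to the left leaves it in place. -/
def Move.apply : Move → ℕ → ℕ
  | .left, n => n - 1
  | .right, n => n + 1
  | .stay, n => n

/-- The starting configuration: the input is on the input tape, the other tapes are blank. -/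
def Program.init (p : Program) (x : CantorReal) : Config p.State where
  state := p.start
  head := 0
  tape
    | .input => x
    | .scratch => fun _ => false
    | .output => fun _ => false

/-- One classical step of computation. -/
def Program.step (p : Program) (c : Config p.State) : Config p.State :=
  let r := p.trans c.state (fun t => c.tape t c.head)
  { state := r.1
    head := r.2.2.apply c.head
    tape := fun t => Function.update (c.tape t) c.head (r.2.1 t) }

open Classical in
/-- The configuration at a limit stage `l`, given the earlier ones: the head is on the left-most
cell, the machine is in the limit state, and each cell holds the limsup of its earlier values, that
is, `1` exactly if it held `1` at unboundedly many stages below `l`. -/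
noncomputable def Program.limitConfig (p : Program) (l : Ordinal.{0})
    (c : ∀ b < l, Config p.State) : Config p.State where
  state := p.limit
  head := 0
  tape := fun t i =>
    decide (∀ a < l, ∃ b, ∃ hb : b < l, a ≤ b ∧ (c b hb).tape t i = true)

/-- The configuration of program `p` on input `x` at the ordinal stage `a`. Only the stages up to
the first one in the halt state are relevant. -/
noncomputable def Program.run (p : Program) (x : CantorReal) (a : Ordinal.{0}) : Config p.State :=
  Ordinal.limitRecOn (motive := fun _ => Config p.State) a (p.init x) (fun _ c => p.step c)
    (fun l _ c => p.limitConfig l c)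

/-- The computation of `p` on `x` reaches the halt state, and the output tape then holds `y`. -/
def Program.Outputs (p : Program) (x y : CantorReal) : Prop :=
  ∃ a : Ordinal.{0}, (p.run x a).state = p.halt ∧ (∀ b < a, (p.run x b).state ≠ p.halt) ∧
    (p.run x a).tape .output = y

/-- Infinite time computability of a partial function on the reals. -/
def InfiniteTimeComputable (f : CantorReal →. CantorReal) : Prop :=
  ∃ p : Program, ∀ x y, y ∈ f x ↔ p.Outputs x y

open Classical in
/-- The characteristic function of a set of reals, with values `1` and `0`, as reals. -/
noncomputable def charFun (A : Set CantorReal) (x : CantorReal) : CantorReal :=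
  if x ∈ A then natToReal 1 else natToReal 0

/-- Infinite time decidability of a set of reals. -/
def InfiniteTimeDecidable (A : Set CantorReal) : Prop :=
  InfiniteTimeComputable (charFun A : CantorReal →. CantorReal)

end ITTM

/-! ## Reals that code well-orders -/

/-- The relation on `ℕ` coded by `x`. Here `Nat.pair` is the Gödel pairing function: it enumerates
the pairs by their maximum, and then lexicographically. -/
def codedRel (x : CantorReal) (i j : ℕ) : Prop := x (Nat.pair i j) = true

/-- The field of the relation coded by `x`. -/
def codedField (x : CantorReal) : Set ℕ := {i | ∃ j, codedRel x i j ∨ codedRel x j i}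

/-- The set of reals coding a (strict) well-order of a subset of `ℕ`. -/
def WO : Set CantorReal :=
  {x | IsWellOrder (codedField x) (fun i j => codedRel x i j)}

/-! ## The classes `Σ¹₁` and `Π¹₁` of second order arithmetic -/

namespace SecondOrderArith

/-- Terms of arithmetic, with number variables indexed by `ℕ`. -/
inductive Term : Type
  | var (i : ℕ)
  | zero
  | one
  | add (s t : Term)
  | mul (s t : Term)

/-- Arithmetical formulas, with number variables indexed by `ℕ` and `n` free set variables: all
their quantifiers range over natural numbers. `all i φ` binds the number variable `i`. The other
connectives and the existential quantifier are definable. -/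
inductive Formula (n : ℕ) : Type
  | eq (s t : Term)
  | lt (s t : Term)
  | mem (t : Term) (k : Fin n)
  | neg (φ : Formula n)
  | and (φ ψ : Formula n)
  | all (i : ℕ) (φ : Formula n)

/-- The value of a term in the standard model. -/
def Term.val (v : ℕ → ℕ) : Term → ℕ
  | .var i => v i
  | .zero => 0
  | .one => 1
  | .add s t => s.val v + t.val v
  | .mul s t => s.val v * t.val v

/-- Truth of an arithmetical formula in the standard model, where the set variable `k` denotes the
set of natural numbers whose characteristic function is `S k`. -/
def Formula.Holds {n : ℕ} (S : Fin n → CantorReal) : Formula n → (ℕ → ℕ) → Prop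
  | .eq s t, v => s.val v = t.val v
  | .lt s t, v => s.val v < t.val v
  | .mem t k, v => S k (t.val v) = true
  | .neg φ, v => ¬ φ.Holds S v
  | .and φ ψ, v => φ.Holds S v ∧ ψ.Holds S v
  | .all i φ, v => ∀ m : ℕ, φ.Holds S (Function.update v i m)

/-- `A` is (lightface) `Σ¹₁`: it is defined, without real parameters, by a formula
`∃ Y₁ ⋯ ∃ Yₙ φ(x, Y₁, …, Yₙ)` with `φ` arithmetical. A number variable that is free in `φ` stands
for `0`, so that it adds nothing. -/
def IsSigma11 (A : Set CantorReal) : Prop :=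
  ∃ (n : ℕ) (φ : Formula (n + 1)), ∀ x, x ∈ A ↔
    ∃ Y : Fin n → CantorReal, φ.Holds (Fin.cons x Y : Fin (n + 1) → CantorReal) (fun _ => 0)

/-- `A` is (lightface) `Π¹₁`: it is defined, without real parameters, by a formula
`∀ Y₁ ⋯ ∀ Yₙ φ(x, Y₁, …, Yₙ)` with `φ` arithmetical. -/
def IsPi11 (A : Set CantorReal) : Prop :=
  ∃ (n : ℕ) (φ : Formula (n + 1)), ∀ x, x ∈ A ↔
    ∀ Y : Fin n → CantorReal, φ.Holds (Fin.cons x Y : Fin (n + 1) → CantorReal) (fun _ => 0)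

end SecondOrderArith

namespace ITTM

/-! ## Runs of a program -/

/-! A `Σ¹₁` set is the projection of a tree: there is a primitive recursive test such that `x ∈ A`
holds iff some `f : ℕ → ℕ` has all its initial segments, taken together with those of `x`, passing
the test (`IsSigma11.exists_primrec`). So `x ∈ A` iff the tree of passing finite sequences has an
infinite branch, that is, iff the empty sequence is not accessible for `Extends`
(`not_acc_extends_iff`). It remains to let a machine decide whether such a tree is well-founded.
Exchanging its two answers decides the complement, which gives all `Π¹₁` sets, and `WO` is one of
them.

The machine searches the tree depth first. The current sequence is written as a string of zeros
separated by ones. A passing sequence is extended by `0`; a failing one has its last entry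
increased, by moving the last `1` one cell to the right. If all the extensions of `s` have been
searched in vain, this `1` has drifted off to infinity, so at the limit stage the tape shows `s`
again and `s` itself can be left. To resume there, the machine finds the last `1` of the string by a
walk through all the cells that drags along a mark at the last `1` seen so far; at the next limit
stage this mark has settled, if there is a last `1`.

If the empty sequence is accessible, then induction on accessibility shows that the search leaves it
(`exists_run_leaves`), which is noticed at cell `0`. Otherwise the search follows a path of
inaccessible sequences without ever returning from it (`exists_run_child_of_not_acc`). The strings
converge to one with infinitely many ones, the walk leaves no mark, and the absence of a mark is
noticed (`answers_of_not_acc`).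

Two reductions keep the programming small. The search is written for a pair machine, which rewrites
two adjacent cells at a time, and `outputs_of_answers` simulates such machines: while one step is
simulated, each scratch cell holds its old or its new value, so the limsups agree. The test is run
by the stack machine that Mathlib attaches to a code for a partial recursive function, with the
stacks laid out along the cells (`iterVia_test`). -/

theorem Program.run_zero (p : Program) (x : CantorReal) : p.run x 0 = p.init x :=
  Ordinal.limitRecOn_zero ..

theorem Program.run_add_one (p : Program) (x : CantorReal) (a : Ordinal.{0}) :
    p.run x (a + 1) = p.step (p.run x a) :=
  Ordinal.limitRecOn_add_one ..

theorem Program.run_limit (p : Program) (x : CantorReal) {l : Ordinal.{0}}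
    (hl : Order.IsSuccLimit l) :
    p.run x l = p.limitConfig l (fun b _ => p.run x b) :=
  Ordinal.limitRecOn_limit _ _ _ _ hl

theorem Program.Outputs.unique {p : Program} {x y z : CantorReal}
    (hy : p.Outputs x y) (hz : p.Outputs x z) : y = z := by
  obtain ⟨a, ha, ha', rfl⟩ := hy
  obtain ⟨b, hb, hb', rfl⟩ := hz
  rcases lt_trichotomy a b with h | rfl | h
  · exact absurd ha (hb' a h)
  · rfl
  · exact absurd hb (ha' b h)

theorem infiniteTimeDecidable_of_outputs {A : Set CantorReal} (p : Program)
    (h : ∀ x, p.Outputs x (charFun A x)) : InfiniteTimeDecidable A := by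
  refine ⟨p, fun x y => ?_⟩
  simp only [PFun.coe_val, Part.mem_some_iff]
  exact ⟨fun e => e ▸ h x, fun e => e.unique (h x)⟩

/-! ## Pair machines -/

/-- A machine working on a sequence of cells, each consisting of finitely many bits indexed by `ι`.
In one step it looks for the first pair of adjacent cells to which the rule of its state applies,
and rewrites this pair. If there is none, the next state is `limit`. The rule may depend on the
block of the input at the left cell. -/
structure PairMachine (ι Q : Type) where
  initial : Q
  limit : Q
  answer : Q → Option Bool
  rule : Q → (ι → Bool) → (ι → Bool) → (ι → Bool) → Option (Q × (ι → Bool) × (ι → Bool))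
  -- The simulating program consults the answer only after a rule has been applied, so the two
  -- states that can arise otherwise must not carry one.
  answer_initial : answer initial = none
  answer_limit : answer limit = none

namespace PairMachine

/-- A configuration of a pair machine. -/
structure Conf (ι Q : Type) where
  state : Q
  cell : ℕ → ι → Bool

variable {ι Q : Type}

/-- The rule applied at the cells `i` and `i + 1`. -/
def ruleAt (M : PairMachine ι Q) (X : ℕ → ι → Bool) (c : Conf ι Q) (i : ℕ) :
    Option (Q × (ι → Bool) × (ι → Bool)) :=
  M.rule c.state (X i) (c.cell i) (c.cell (i + 1))

open Classical in
/-- One step of a pair machine. -/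
noncomputable def step (M : PairMachine ι Q) (X : ℕ → ι → Bool) (c : Conf ι Q) : Conf ι Q :=
  if h : ∃ p : ℕ × (Q × (ι → Bool) × (ι → Bool)),
      M.ruleAt X c p.1 = some p.2 ∧ ∀ j < p.1, M.ruleAt X c j = none then
    ⟨h.choose.2.1, Function.update (Function.update c.cell h.choose.1 h.choose.2.2.1)
      (h.choose.1 + 1) h.choose.2.2.2⟩
  else ⟨M.limit, c.cell⟩

theorem step_of_ruleAt (M : PairMachine ι Q) {X : ℕ → ι → Bool} {c : Conf ι Q} {i : ℕ}
    {r : Q × (ι → Bool) × (ι → Bool)} (hi : M.ruleAt X c i = some r)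
    (hlt : ∀ j < i, M.ruleAt X c j = none) :
    M.step X c = ⟨r.1, Function.update (Function.update c.cell i r.2.1) (i + 1) r.2.2⟩ := by
  have h : ∃ p : ℕ × (Q × (ι → Bool) × (ι → Bool)),
      M.ruleAt X c p.1 = some p.2 ∧ ∀ j < p.1, M.ruleAt X c j = none := ⟨(i, r), hi, hlt⟩
  obtain ⟨h1, h2⟩ := h.choose_spec
  have e1 : h.choose.1 = i := by
    rcases lt_trichotomy h.choose.1 i with hl | he | hl
    · simp [hlt _ hl] at h1
    · exact he
    · simp [h2 _ hl] at hi
  have e2 : h.choose.2 = r := by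
    rw [e1, hi] at h1
    exact (Option.some.inj h1).symm
  rw [step, dif_pos h, e1, e2]

theorem step_of_forall_none (M : PairMachine ι Q) {X : ℕ → ι → Bool} {c : Conf ι Q}
    (h : ∀ j, M.ruleAt X c j = none) : M.step X c = ⟨M.limit, c.cell⟩ := by
  rw [step, dif_neg]
  simp [h]

open Classical in
/-- The configuration of a pair machine at a stage. -/
noncomputable def run (M : PairMachine ι Q) (X : ℕ → ι → Bool) (a : Ordinal.{0}) : Conf ι Q :=
  Ordinal.limitRecOn (motive := fun _ => Conf ι Q) a ⟨M.initial, fun _ _ => false⟩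
    (fun _ c => M.step X c)
    (fun l _ c => ⟨M.limit, fun i t =>
      decide (∀ a < l, ∃ b, ∃ hb : b < l, a ≤ b ∧ (c b hb).cell i t = true)⟩)

theorem run_zero (M : PairMachine ι Q) (X : ℕ → ι → Bool) :
    M.run X 0 = ⟨M.initial, fun _ _ => false⟩ :=
  Ordinal.limitRecOn_zero ..

theorem run_add_one (M : PairMachine ι Q) (X : ℕ → ι → Bool) (a : Ordinal.{0}) :
    M.run X (a + 1) = M.step X (M.run X a) :=
  Ordinal.limitRecOn_add_one ..

open Classical in
theorem run_limit (M : PairMachine ι Q) (X : ℕ → ι → Bool) {l : Ordinal.{0}}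
    (hl : Order.IsSuccLimit l) :
    M.run X l = ⟨M.limit, fun i t =>
      decide (∀ a < l, ∃ b, ∃ _ : b < l, a ≤ b ∧ (M.run X b).cell i t = true)⟩ :=
  Ordinal.limitRecOn_limit _ _ _ _ hl

theorem exists_first_ruleAt_or (M : PairMachine ι Q) (X : ℕ → ι → Bool)
    (c : Conf ι Q) :
    (∃ i r, M.ruleAt X c i = some r ∧ (∀ j < i, M.ruleAt X c j = none)) ∨
      ∀ j, M.ruleAt X c j = none := by
  classical
  by_cases h : ∃ i, ∃ r, M.ruleAt X c i = some r
  · obtain ⟨r, hr⟩ := Nat.find_spec h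
    refine Or.inl ⟨Nat.find h, r, hr, fun j hj => ?_⟩
    have := Nat.find_min h hj
    rw [Option.eq_none_iff_forall_ne_some]
    exact fun r hr => this ⟨r, hr⟩
  · right
    intro j
    rw [Option.eq_none_iff_forall_ne_some]
    exact fun r hr => h ⟨j, r, hr⟩

/-- The input of a pair machine: a real, read in blocks. -/
def inputBlocks {K : ℕ} (e : ι ≃ Fin K) (x : CantorReal) (i : ℕ) (t : ι) : Bool :=
  x (i * K + e t)

/-- A pair machine halts with an answer. -/
def Answers (M : PairMachine ι Q) (X : ℕ → ι → Bool) (b : Bool) : Prop :=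
  ∃ a : Ordinal.{0}, M.answer (M.run X a).state = some b ∧
    ∀ a' < a, M.answer (M.run X a').state = none

end PairMachine

end ITTM

/-! ## Iterating a function -/

/-- `b` is an iterate of `a` under `f`, and `P` holds at all the earlier iterates. -/
def IterVia {α : Type*} (f : α → α) (P : α → Prop) (a b : α) : Prop :=
  ∃ n : ℕ, f^[n] a = b ∧ ∀ m < n, P (f^[m] a)

namespace IterVia

variable {α : Type*} {f : α → α} {P : α → Prop} {a b c : α}

theorem refl (a : α) : IterVia f P a a := ⟨0, rfl, fun _ h => absurd h (Nat.not_lt_zero _)⟩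

theorem head (hP : P a) (h : IterVia f P (f a) b) : IterVia f P a b := by
  obtain ⟨n, hn, hlt⟩ := h
  refine ⟨n + 1, hn, fun m hm => ?_⟩
  cases m with
  | zero => exact hP
  | succ m => exact hlt m (by omega)

theorem trans (h : IterVia f P a b) (h' : IterVia f P b c) : IterVia f P a c := by
  obtain ⟨n, rfl, hlt⟩ := h
  obtain ⟨n', rfl, hlt'⟩ := h'
  refine ⟨n' + n, Function.iterate_add_apply .., fun m hm => ?_⟩
  by_cases h : m < n
  · exact hlt m h
  · obtain ⟨k, rfl⟩ := Nat.exists_eq_add_of_le (not_lt.1 h)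
    rw [Nat.add_comm, Function.iterate_add_apply]
    exact hlt' k (by omega)

theorem single (hP : P a) (h : f a = b) : IterVia f P a b := head hP (h ▸ refl _)

end IterVia

/-! ### The program that simulates a pair machine. -/

namespace ITTM

/-- The content of the three tapes. -/
def tapes (a b c : CantorReal) : TapeName → CantorReal
  | .input => a
  | .scratch => b
  | .output => c

/-- Three bits, one for each tape. -/
def bits (a b c : Bool) : TapeName → Bool
  | .input => a
  | .scratch => b
  | .output => c

theorem update_tapes (a b c : CantorReal) (n : ℕ) (u v w : Bool) :
    (fun t => Function.update (tapes a b c t) n (bits u v w t)) =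
      tapes (Function.update a n u) (Function.update b n v) (Function.update c n w) := by
  funext t
  cases t <;> rfl

theorem tapes_apply (a b c : CantorReal) (n : ℕ) :
    (fun t => tapes a b c t n) = bits (a n) (b n) (c n) := by
  funext t
  cases t <;> rfl

theorem Program.run_add_nat (p : Program) (x : CantorReal) (a : Ordinal.{0}) (n : ℕ) :
    p.run x (a + n) = p.step^[n] (p.run x a) := by
  induction n with
  | zero => simp
  | succ n ih =>
    rw [Function.iterate_succ_apply', ← ih, ← p.run_add_one]
    push_cast
    rw [add_assoc]

namespace PairMachine

variable {ι Q : Type} {K : ℕ}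

/-- The states of the program that simulates a pair machine. The scratch tape is divided into
blocks of length `K`, each of which holds a cell of the pair machine. -/
inductive CState (ι Q : Type) (K : ℕ) : Type
  | start
  | halt
  | scan (q : Q) (prev : Option (ι → Bool × Bool)) (j : Fin K) (buf : ι → Bool × Bool)
  | back (q : Q) (l r : ι → Bool) (j : Fin (2 * K))
  | home (q : Q)

instance [Finite ι] [Finite Q] : Finite (CState ι Q K) := by
  let f : CState ι Q K → Option (Option ((Q × Option (ι → Bool × Bool) × Fin K × (ι → Bool × Bool)) ⊕
      (Q × (ι → Bool) × (ι → Bool) × Fin (2 * K)) ⊕ Q)) := fun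
    | .start => none
    | .halt => some none
    | .scan q p j b => some (some (.inl (q, p, j, b)))
    | .back q l r j => some (some (.inr (.inl (q, l, r, j))))
    | .home q => some (some (.inr (.inr q)))
  refine Finite.of_injective f fun s t h => ?_
  cases s <;> cases t <;> simp [f] at h <;> simp_all

variable [NeZero K]

/-- The bit at the place `j` of two adjacent blocks. -/
def pairBit (e : ι ≃ Fin K) (l r : ι → Bool) (j : ℕ) : Bool :=
  if j < K then l (e.symm (Fin.ofNat K j)) else r (e.symm (Fin.ofNat K (j - K)))

/-- The state after a block has been read. -/
def afterBlock (M : PairMachine ι Q) (q : Q) (prev : Option (ι → Bool × Bool))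
    (buf : ι → Bool × Bool) : CState ι Q K × Move :=
  match prev with
  | none => (.scan q (some buf) 0 fun _ => (false, false), .right)
  | some b =>
    match M.rule q (fun t => (b t).1) (fun t => (b t).2) (fun t => (buf t).2) with
    | none => (.scan q (some buf) 0 fun _ => (false, false), .right)
    -- Rewriting starts at the last of the `2 * K` bits of the pair, where the head already rests.
    | some o => (.back o.1 o.2.1 o.2.2 (Fin.ofNat _ (2 * K - 1)), .stay)

open Classical in
/-- The transitions of the program that simulates a pair machine. -/
noncomputable def compileTrans (M : PairMachine ι Q) (e : ι ≃ Fin K) :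
    CState ι Q K → (TapeName → Bool) → CState ι Q K × (TapeName → Bool) × Move
  -- The `1` written on the output tape marks the left end for later returns; in the end the answer
  -- replaces it.
  | .start, r => (.scan M.initial none 0 fun _ => (false, false),
      bits (r .input) (r .scratch) true, .stay)
  | .halt, r => (.halt, bits (r .input) (r .scratch) (r .output), .stay)
  | .scan q prev j buf, r =>
    let buf' := fun t => if e t = j then (r .input, r .scratch) else buf t
    if h : j.1 + 1 < K then
      (.scan q prev ⟨j + 1, h⟩ buf', bits (r .input) (r .scratch) (r .output), .right)
    else
      ((M.afterBlock q prev buf').1, bits (r .input) (r .scratch) (r .output),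
        (M.afterBlock (K := K) q prev buf').2)
  | .back q l r' j, r =>
    (if j.1 = 0 then .home q else .back q l r' (Fin.ofNat _ (j.1 - 1)),
      bits (r .input) (pairBit e l r' j) (r .output), .left)
  | .home q, r =>
    match r .output with
    | false => (.home q, bits (r .input) (r .scratch) (r .output), .left)
    | true =>
      match M.answer q with
      | some b => (.halt, bits (r .input) (r .scratch) b, .stay)
      | none => (.scan q none 0 fun _ => (false, false),
          bits (r .input) (r .scratch) (r .output), .stay)

/-- One step of the program that simulates a pair machine. -/
noncomputable def simStep (M : PairMachine ι Q) (e : ι ≃ Fin K) (c : Config (CState ι Q K)) :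
    Config (CState ι Q K) :=
  let r := M.compileTrans e c.state (fun t => c.tape t c.head)
  { state := r.1
    head := r.2.2.apply c.head
    tape := fun t => Function.update (c.tape t) c.head (r.2.1 t) }

/-- The scratch tape that represents the cells of a pair machine. -/
def encode (e : ι ≃ Fin K) (c : ℕ → ι → Bool) : CantorReal :=
  fun n => c (n / K) (e.symm (Fin.ofNat K n))

theorem encode_mul_add (e : ι ≃ Fin K) (c : ℕ → ι → Bool) (i : ℕ) (j : Fin K) :
    encode e c (i * K + j) = c i (e.symm j) := by
  have hK : 0 < K := Nat.pos_of_neZero K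
  have h1 : (i * K + j) / K = i := by
    rw [mul_comm, Nat.mul_add_div hK, Nat.div_eq_of_lt j.2, add_zero]
  have h2 : Fin.ofNat K (i * K + j) = j := by
    ext
    simp [Fin.ofNat, Nat.mod_eq_of_lt j.2]
  rw [encode, h1, h2]

/-- The simulating program has marked the left end on the output tape, and holds the given state,
head position, and scratch tape. -/
def conf (x : CantorReal) (s : CState ι Q K) (n : ℕ) (scr : CantorReal) : Config (CState ι Q K) where
  state := s
  head := n
  tape := tapes x scr (natToReal 1)

variable (M : PairMachine ι Q) (e : ι ≃ Fin K)

theorem simStep_conf (x scr : CantorReal) (s : CState ι Q K) (n : ℕ) {s' : CState ι Q K}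
    {u v w : Bool} {m : Move}
    (h : M.compileTrans e s (bits (x n) (scr n) (natToReal 1 n)) = (s', bits u v w, m)) :
    M.simStep e (conf x s n scr) = ⟨s', m.apply n,
      tapes (Function.update x n u) (Function.update scr n v)
        (Function.update (natToReal 1) n w)⟩ := by
  rw [← update_tapes]
  simp only [simStep, conf, tapes_apply, h]

/-- The state of the simulating program when it has read the first `i` blocks and the first `j`
bits of the next one. -/
noncomputable def scanState (x : CantorReal) (c : Conf ι Q) (i : ℕ) (j : Fin K) :
    CState ι Q K :=
  .scan c.state
    (if i = 0 then none else
      some fun t => (inputBlocks e x (i - 1) t, c.cell (i - 1) t)) j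
    (fun t => if e t < j then (inputBlocks e x i t, c.cell i t) else (false, false))

/-- The simulating program while it looks for a pair to which a rule applies. -/
noncomputable def scanConf (x : CantorReal) (c : Conf ι Q) (i : ℕ) (j : Fin K) :
    Config (CState ι Q K) :=
  conf x (scanState e x c i j) (i * K + j) (encode e c.cell)

theorem scan_buf (x : CantorReal) (c : Conf ι Q) (i : ℕ) (j : Fin K) :
    (fun t => if e t = j then (x (i * K + j), encode e c.cell (i * K + j)) else
      if e t < j then (inputBlocks e x i t, c.cell i t) else (false, false)) =
    fun t => if (e t).1 < j.1 + 1 then (inputBlocks e x i t, c.cell i t) else (false, false) := by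
  funext t
  rw [encode_mul_add]
  by_cases h : e t = j
  · subst h
    simp [inputBlocks]
  · have h' : (e t).1 ≠ j.1 := fun h' => h (Fin.ext h')
    simp only [h, if_false, Fin.lt_def]
    congr 1
    rw [eq_iff_iff]
    omega

theorem step_scanConf_of_lt (x : CantorReal) (c : Conf ι Q) (i : ℕ) (j : Fin K)
    (h : j.1 + 1 < K) :
    M.simStep e (scanConf e x c i j) = scanConf e x c i ⟨j + 1, h⟩ := by
  refine (M.simStep_conf (m := .right) e _ _ _ _ (by
    simp only [scanState, compileTrans, bits, h, dite_true]; rfl)).trans ?_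
  simp only [Function.update_eq_self, scan_buf]
  simp only [scanConf, scanState, conf, Move.apply, Fin.lt_def, add_assoc]

theorem step_scanConf_of_eq (x : CantorReal) (c : Conf ι Q) (i : ℕ) (j : Fin K)
    (h : j.1 + 1 = K) :
    M.simStep e (scanConf e x c i j) =
      let o := M.afterBlock (K := K) c.state (if i = 0 then none else
        some fun t => (inputBlocks e x (i - 1) t, c.cell (i - 1) t))
        (fun t => (inputBlocks e x i t, c.cell i t))
      conf x o.1 (o.2.apply (i * K + j)) (encode e c.cell) := by
  have h' : ¬ j.1 + 1 < K := by omega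
  refine (M.simStep_conf e _ _ _ _ (by
    simp only [scanState, compileTrans, bits, h', dite_false]; rfl)).trans ?_
  simp only [Function.update_eq_self, scan_buf]
  have hb : (fun t => if (e t).1 < j.1 + 1 then (inputBlocks e x i t, c.cell i t)
      else (false, false)) = fun t => (inputBlocks e x i t, c.cell i t) := by
    funext t
    rw [if_pos (by have := (e t).2; omega)]
  simp only [hb]
  rfl

theorem scanConf_zero (x : CantorReal) (c : Conf ι Q) :
    scanConf e x c 0 0 =
      conf x (.scan c.state none 0 fun _ => (false, false)) 0 (encode e c.cell) := by
  simp [scanConf, scanState]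

/-- Once block `i` has been read, the rule consulted is the one for the pair `i - 1`, `i`; for `i =
0` there is no pair yet. -/
theorem afterBlock_scan (x : CantorReal) (c : Conf ι Q) (i : ℕ) 
    (h : ∀ j, j + 1 = i → M.ruleAt (inputBlocks e x) c j = none) :
    M.afterBlock (K := K) c.state (if i = 0 then none else
        some fun t => (inputBlocks e x (i - 1) t, c.cell (i - 1) t))
        (fun t => (inputBlocks e x i t, c.cell i t)) = (scanState e x c (i + 1) 0, .right) := by
  cases i with
  | zero => simp [afterBlock, scanState]
  | succ i =>
    have := h i rfl
    simp only [ruleAt] at this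
    simp [afterBlock, scanState, this]

theorem afterBlock_back (x : CantorReal) (c : Conf ι Q) (i : ℕ) {o : Q × (ι → Bool) × (ι → Bool)}
    (h : M.ruleAt (inputBlocks e x) c i = some o) :
    M.afterBlock (K := K) c.state (if i + 1 = 0 then none else
        some fun t => (inputBlocks e x (i + 1 - 1) t, c.cell (i + 1 - 1) t))
        (fun t => (inputBlocks e x (i + 1) t, c.cell (i + 1) t)) =
      (.back o.1 o.2.1 o.2.2 (Fin.ofNat _ (2 * K - 1)), .stay) := by
  simp only [ruleAt] at h
  simp [afterBlock, h]

/-- The pair at `j` is complete only after `(j + 2) * K` bits, so a scan of `n` steps is stopped by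
no other pairs than those in the hypothesis. -/
theorem iterate_step_scanConf (x : CantorReal) (c : Conf ι Q) (n : ℕ)
    (h : ∀ j, (j + 2) * K ≤ n → M.ruleAt (inputBlocks e x) c j = none) :
    (M.simStep e)^[n] (scanConf e x c 0 0) = scanConf e x c (n / K) (Fin.ofNat K n) := by
  have hK : 0 < K := Nat.pos_of_neZero K
  induction n with
  | zero => simp
  | succ n ih =>
    rw [Function.iterate_succ_apply', ih fun j hj => h j (by omega)]
    have hmod : (Fin.ofNat K n).1 = n % K := rfl
    have hdm := Nat.div_add_mod n K
    have hlt := Nat.mod_lt n hK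
    by_cases hn : n % K + 1 < K
    · rw [step_scanConf_of_lt M e x c _ _ (by rwa [hmod])]
      have h1 : (n + 1) / K = n / K := by
        rw [Nat.div_eq_iff hK]
        constructor
        · nlinarith
        · have := mul_comm (n / K) K
          omega
      have h2 : (n + 1) % K = n % K + 1 := by
        have := Nat.div_add_mod (n + 1) K
        rw [h1] at this
        omega
      rw [h1]
      congr 1
      ext
      simp only [hmod]
      exact h2.symm
    · have hn' : n % K + 1 = K := by omega
      have hKn : n + 1 = (n / K + 1) * K := by
        rw [add_mul, mul_comm]
        omega
      rw [step_scanConf_of_eq M e x c _ _ (by rwa [hmod]), M.afterBlock_scan e x c]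
      · have h1 : (n + 1) / K = n / K + 1 := by
          rw [hKn, Nat.mul_div_cancel _ hK]
        have h2 : Fin.ofNat K (n + 1) = 0 := by
          ext
          simp [Fin.ofNat, hKn]
        rw [h1, h2]
        simp only [scanConf, Move.apply]
        congr 1
        simp only [hmod, add_mul]
        simp
        omega
      · intro j hj
        refine h j ?_
        rw [hKn, ← hj]

end PairMachine

end ITTM

/-! ### Simulation of a single step. -/

namespace ITTM

namespace PairMachine

variable {ι Q : Type} {K : ℕ} [NeZero K] (M : PairMachine ι Q) (e : ι ≃ Fin K)

/-- A configuration of the simulating program in between the representations of two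
configurations of the pair machine. -/
def Between (x : CantorReal) (c c' : Conf ι Q) (C : Config (CState ι Q K)) : Prop :=
  C.state ≠ .halt ∧ C.tape .input = x ∧ C.tape .output = natToReal 1 ∧
    ∀ n, C.tape .scratch n = encode e c.cell n ∨ C.tape .scratch n = encode e c'.cell n

theorem between_conf {x : CantorReal} {c c' : Conf ι Q} {s : CState ι Q K} {n : ℕ}
    {scr : CantorReal} (hs : s ≠ .halt)
    (h : ∀ n, scr n = encode e c.cell n ∨ scr n = encode e c'.cell n) :
    Between e x c c' (conf x s n scr) :=
  ⟨hs, rfl, rfl, h⟩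

/-- The output tape has its only `1` at cell `0`, so the head keeps moving left until it gets there.
-/
theorem iterVia_home (x : CantorReal) (c c' : Conf ι Q) (n : ℕ) :
    IterVia (M.simStep e) (Between e x c c') (conf x (.home c'.state) n (encode e c'.cell))
      (conf x (.home c'.state) 0 (encode e c'.cell)) := by
  induction n with
  | zero => exact IterVia.refl _
  | succ n ih =>
    refine IterVia.head (between_conf e (by simp) fun _ => Or.inr rfl) ?_
    have h : M.simStep e (conf x (.home c'.state) (n + 1) (encode e c'.cell)) =
        conf x (.home c'.state) n (encode e c'.cell) := by
      refine (M.simStep_conf (m := .left) e _ _ _ _ (by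
        simp only [compileTrans, bits, natToReal]
        simp only [show decide (n + 1 < 1) = false by simp]; rfl)).trans ?_
      have : Function.update (natToReal 1) (n + 1) false = natToReal 1 := by
        rw [Function.update_eq_self_iff]
        simp [natToReal]
      rw [this]
      simp only [Function.update_eq_self]
      rfl
    rw [h]
    exact ih

theorem encode_step_eq (c : Conf ι Q) (i j : ℕ) (hj : j < 2 * K) (l r : ι → Bool) :
    encode e (Function.update (Function.update c.cell i l) (i + 1) r) (i * K + j) =
      pairBit e l r j := by
  by_cases h : j < K
  · rw [encode_mul_add e _ i ⟨j, h⟩, pairBit, if_pos h]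
    have : Fin.ofNat K j = ⟨j, h⟩ := by
      ext
      simp [Fin.ofNat, Nat.mod_eq_of_lt h]
    rw [this]
    simp
  · have hj' : j - K < K := by omega
    have h1 : i * K + j = (i + 1) * K + (⟨j - K, hj'⟩ : Fin K) := by
      rw [add_mul]
      simp
      omega
    rw [h1, encode_mul_add, pairBit, if_neg h]
    have : Fin.ofNat K (j - K) = ⟨j - K, hj'⟩ := by
      ext
      simp [Fin.ofNat, Nat.mod_eq_of_lt hj']
    rw [this]
    simp

theorem encode_step_of_lt (c : Conf ι Q) (i n : ℕ) (hn : n < i * K) (l r : ι → Bool) :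
    encode e (Function.update (Function.update c.cell i l) (i + 1) r) n = encode e c.cell n := by
  have h : n / K < i := Nat.div_lt_of_lt_mul (by rwa [mul_comm])
  rw [encode, encode, Function.update_of_ne (by omega), Function.update_of_ne (by omega)]

theorem encode_step_of_ge (c : Conf ι Q) (i n : ℕ) (hn : i * K + 2 * K ≤ n) (l r : ι → Bool) :
    encode e (Function.update (Function.update c.cell i l) (i + 1) r) n = encode e c.cell n := by
  have h : i + 2 ≤ n / K := (Nat.le_div_iff_mul_le (Nat.pos_of_neZero K)).2 (by rw [add_mul]; omega)
  rw [encode, encode, Function.update_of_ne (by omega), Function.update_of_ne (by omega)]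

/-- Bits are rewritten from right to left: up to the head the tape is old and beyond it new, so each
cell always agrees with one of the two encodings. -/
theorem iterVia_back (x : CantorReal) (c c' : Conf ι Q) (i : ℕ) (l r : ι → Bool)
    (hc' : c'.cell = Function.update (Function.update c.cell i l) (i + 1) r)
    (j : ℕ) (hj : j < 2 * K) :
    IterVia (M.simStep e) (Between e x c c')
      (conf x (.back c'.state l r (Fin.ofNat _ j)) (i * K + j) (fun n =>
        if n < i * K + j + 1 then encode e c.cell n else encode e c'.cell n))
      (conf x (.home c'.state) 0 (encode e c'.cell)) := by
  have hval : ∀ j, j < 2 * K → (Fin.ofNat (2 * K) j).1 = j := fun j hj => Nat.mod_eq_of_lt hj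
  have hstep : ∀ j, j < 2 * K → M.simStep e (conf x (.back c'.state l r (Fin.ofNat _ j)) (i * K + j)
      (fun n => if n < i * K + j + 1 then encode e c.cell n else encode e c'.cell n)) =
      conf x (if j = 0 then .home c'.state else .back c'.state l r (Fin.ofNat _ (j - 1)))
        (i * K + j - 1) (fun n => if n < i * K + j then encode e c.cell n else
          encode e c'.cell n) := by
    intro j hj
    refine (M.simStep_conf (m := .left) e _ _ _ _ (by
      simp only [compileTrans, bits, hval j hj]; rfl)).trans ?_
    simp only [Function.update_eq_self]
    have : Function.update (fun n => if n < i * K + j + 1 then encode e c.cell n else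
        encode e c'.cell n) (i * K + j) (pairBit e l r j) =
        fun n => if n < i * K + j then encode e c.cell n else encode e c'.cell n := by
      funext n
      by_cases h : n = i * K + j
      · subst h
        simp [hc', encode_step_eq e c i j hj]
      · rw [Function.update_of_ne h]
        have : n < i * K + j + 1 ↔ n < i * K + j := by omega
        simp only [this]
    rw [this]
    rfl
  induction j with
  | zero =>
    refine IterVia.head (between_conf e (by simp) fun n => by
      split_ifs <;> simp) ?_
    rw [hstep 0 hj]
    have : (fun n => if n < i * K + 0 then encode e c.cell n else encode e c'.cell n) =
        encode e c'.cell := by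
      funext n
      split_ifs with h
      · rw [hc', encode_step_of_lt e c i n h]
      · rfl
    rw [this, if_pos rfl]
    exact M.iterVia_home e x c c' _
  | succ j ih =>
    refine IterVia.head (between_conf e (by simp) fun n => by
      split_ifs <;> simp) ?_
    rw [hstep _ hj]
    exact ih (by omega)

theorem iterVia_step (x : CantorReal) (c : Conf ι Q) {i : ℕ} {o : Q × (ι → Bool) × (ι → Bool)}
    (hi : M.ruleAt (inputBlocks e x) c i = some o)
    (hlt : ∀ j < i, M.ruleAt (inputBlocks e x) c j = none) :
    IterVia (M.simStep e) (Between e x c (M.step (inputBlocks e x) c)) (scanConf e x c 0 0)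
      (conf x (.home (M.step (inputBlocks e x) c).state) 0
        (encode e (M.step (inputBlocks e x) c).cell)) := by
  have hK : 0 < K := Nat.pos_of_neZero K
  have hs := M.step_of_ruleAt hi hlt
  set c' := M.step (inputBlocks e x) c
  have hn : (i + 1) * K + (K - 1) = i * K + (2 * K - 1) := by
    rw [add_mul]
    omega
  have hscan : ∀ n ≤ (i + 1) * K + (K - 1),
      (M.simStep e)^[n] (scanConf e x c 0 0) = scanConf e x c (n / K) (Fin.ofNat K n) :=
    fun n hn' => M.iterate_step_scanConf e x c n fun j hj => hlt j (by
      by_contra! h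
      have h1 : (i + 2) * K ≤ (j + 2) * K := Nat.mul_le_mul_right K (by omega)
      have h2 : (i + 2) * K = (i + 1) * K + K := by ring
      omega)
  refine IterVia.trans (b := scanConf e x c (i + 1) ⟨K - 1, by omega⟩)
    ⟨(i + 1) * K + (K - 1), ?_, fun m hm => ?_⟩ ?_
  · rw [hscan _ le_rfl]
    have h1 : ((i + 1) * K + (K - 1)) / K = i + 1 := by
      rw [mul_comm, Nat.mul_add_div hK, Nat.div_eq_of_lt (by omega), add_zero]
    have h2 : Fin.ofNat K ((i + 1) * K + (K - 1)) = ⟨K - 1, by omega⟩ := by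
      ext
      simp only [Fin.ofNat, Nat.mul_add_mod_self_right]
      exact Nat.mod_eq_of_lt (by omega)
    rw [h1, h2]
  · rw [hscan m hm.le]
    exact between_conf e (by simp [scanState]) fun _ => Or.inl rfl
  · refine IterVia.head (between_conf e (by simp [scanState]) fun _ => Or.inl rfl) ?_
    rw [M.step_scanConf_of_eq e x c _ _ (by simp only; omega), M.afterBlock_back e x c i hi]
    -- At the right end of the pair nothing has been rewritten yet, and beyond it the old and the
    -- new tape coincide.
    have h3 : encode e c.cell = fun n => if n < i * K + (2 * K - 1) + 1 then encode e c.cell n else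
        encode e c'.cell n := by
      funext n
      split_ifs with h
      · rfl
      · rw [hs, encode_step_of_ge e c i n (by omega)]
    simp only [Move.apply]
    rw [h3]
    have h4 := M.iterVia_back e x c c' i o.2.1 o.2.2 (by rw [hs]) (2 * K - 1) (by omega)
    rw [hn]
    have h5 : c'.state = o.1 := by rw [hs]
    rw [h5] at h4 ⊢
    exact h4

theorem step_home (x : CantorReal) (c : Conf ι Q) :
    M.simStep e (conf x (.home c.state) 0 (encode e c.cell)) =
      match M.answer c.state with
      | none => scanConf e x c 0 0
      | some b => ⟨.halt, 0, tapes x (encode e c.cell) (natToReal (cond b 1 0))⟩ := by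
  have h0 : natToReal 1 0 = true := rfl
  split
  next h =>
    refine (M.simStep_conf (m := .stay) e _ _ _ _ (by
      simp only [compileTrans, bits, h0, h]; rfl)).trans ?_
    rw [scanConf_zero]
    have : Function.update (natToReal 1) 0 true = natToReal 1 := Function.update_eq_self 0 _
    simp only [this, Function.update_eq_self]
    rfl
  next b h =>
    refine (M.simStep_conf (m := .stay) e _ _ _ _ (by
      simp only [compileTrans, bits, h0, h]; rfl)).trans ?_
    have : Function.update (natToReal 1) 0 b = natToReal (cond b 1 0) := by
      funext n
      cases n <;> cases b <;> simp [natToReal]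
    simp only [this, Function.update_eq_self]
    rfl

end PairMachine

end ITTM

/-! ## Compiling pair machines -/

open Order in
-- To be used with `d a b` the time that the simulation of step `a` takes when it begins at stage
-- `b`. Normality sends limit stages to limit stages.
theorem Ordinal.exists_isNormal (s : Ordinal.{0}) (d : Ordinal.{0} → Ordinal.{0} → Ordinal.{0})
    (hd : ∀ a b, 0 < d a b) :
    ∃ g : Ordinal.{0} → Ordinal.{0}, IsNormal g ∧ g 0 = s ∧ ∀ a, g (a + 1) = g a + d a (g a) := by
  let g : Ordinal.{0} → Ordinal.{0} := fun a => Ordinal.limitRecOn (motive := fun _ => Ordinal.{0}) a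
    s (fun a b => b + d a b) (fun l _ f => ⨆ b : Set.Iio l, f b.1 b.2)
  have hsucc : ∀ a, g (a + 1) = g a + d a (g a) := fun a => Ordinal.limitRecOn_add_one ..
  refine ⟨g, IsNormal.of_succ_lt (fun a => ?_) (fun {l} hl => ?_), Ordinal.limitRecOn_zero .., hsucc⟩
  · rw [Order.succ_eq_add_one, hsucc]
    exact lt_add_of_pos_right _ (hd _ _)
  · have : g l = ⨆ b : Set.Iio l, g b.1 := Ordinal.limitRecOn_limit _ _ _ _ hl
    rw [this, Set.image_eq_range]
    have : Nonempty (Set.Iio l) := ⟨⟨0, hl.bot_lt⟩⟩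
    exact isLUB_ciSup Ordinal.bddAbove_of_small

namespace ITTM

namespace PairMachine

variable {ι Q : Type} {K : ℕ} [NeZero K]

/-- The program that simulates a pair machine. -/
noncomputable def compile [Finite ι] [Finite Q] (M : PairMachine ι Q) (e : ι ≃ Fin K) :
    Program where
  State := CState ι Q K
  finite_state := inferInstance
  start := .start
  limit := .scan M.limit none 0 fun _ => (false, false)
  halt := .halt
  start_ne_limit := by simp
  start_ne_halt := by simp
  limit_ne_halt := by simp
  trans := M.compileTrans e

variable [Finite ι] [Finite Q] (M : PairMachine ι Q) (e : ι ≃ Fin K)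

/-- The run of the simulating program. -/
noncomputable def simRun (x : CantorReal) (a : Ordinal.{0}) : Config (CState ι Q K) :=
  (M.compile e).run x a

theorem simRun_add_nat (x : CantorReal) (a : Ordinal.{0}) (n : ℕ) :
    M.simRun e x (a + n) = (M.simStep e)^[n] (M.simRun e x a) :=
  (M.compile e).run_add_nat x a n

theorem simRun_add_one (x : CantorReal) (a : Ordinal.{0}) :
    M.simRun e x (a + 1) = M.simStep e (M.simRun e x a) :=
  (M.compile e).run_add_one x a

open Classical in
theorem simRun_limit (x : CantorReal) {l : Ordinal.{0}} (hl : Order.IsSuccLimit l) :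
    M.simRun e x l = ⟨.scan M.limit none 0 fun _ => (false, false), 0, fun t i =>
      decide (∀ a < l, ∃ b, ∃ _ : b < l, a ≤ b ∧ (M.simRun e x b).tape t i = true)⟩ :=
  (M.compile e).run_limit x hl

theorem simRun_zero (x : CantorReal) :
    M.simRun e x 0 = ⟨.start, 0, tapes x (fun _ => false) (fun _ => false)⟩ := by
  refine ((M.compile e).run_zero x).trans ?_
  simp only [Program.init]
  rfl

theorem simRun_one (x : CantorReal) :
    M.simRun e x 1 = scanConf e x (M.run (inputBlocks e x) 0) 0 0 := by
  rw [← zero_add 1, simRun_add_one, simRun_zero, scanConf_zero, M.run_zero]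
  have : Function.update (fun _ : ℕ => false) 0 true = natToReal 1 := by
    funext n
    cases n <;> simp [natToReal]
  simp only [simStep, compileTrans, update_tapes, conf]
  rw [this]
  simp only [Function.update_eq_self, tapes]
  rfl

/-- The simulating program after the simulation of a step with result `c`. -/
noncomputable def simulated (x : CantorReal) (c : Conf ι Q) : Config (CState ι Q K) :=
  match M.answer c.state with
  | none => scanConf e x c 0 0
  | some b => ⟨.halt, 0, tapes x (encode e c.cell) (natToReal (cond b 1 0))⟩

/-- If some rule applies, the duration `d` is finite. If none does, the scan runs on for `ω` steps
without changing a tape, and the limit stage itself performs the transition to `M.limit`. -/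
theorem exists_simRun_eq_simulated (x : CantorReal) {c : Conf ι Q} {a : Ordinal.{0}}
    (h : M.simRun e x a = scanConf e x c 0 0) :
    ∃ d, 0 < d ∧ M.simRun e x (a + d) = M.simulated e x (M.step (inputBlocks e x) c) ∧
      ∀ d' < d, Between e x c (M.step (inputBlocks e x) c) (M.simRun e x (a + d')) := by
  classical
  rcases M.exists_first_ruleAt_or (inputBlocks e x) c with ⟨i, o, hi, hlt⟩ | hnone
  · obtain ⟨n, hn, hn'⟩ := M.iterVia_step e x c hi hlt
    -- After `n` steps the head is back home; one more step consults the answer.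
    refine ⟨(n + 1 : ℕ), by exact_mod_cast Nat.succ_pos n, ?_, fun d' hd' => ?_⟩
    · rw [simRun_add_nat, h, Function.iterate_succ_apply', hn, step_home]
      rfl
    · obtain ⟨m, rfl⟩ := Ordinal.lt_omega0.1 (hd'.trans (Ordinal.natCast_lt_omega0 _))
      rw [simRun_add_nat, h]
      rcases (Nat.lt_succ_iff_lt_or_eq.1 (Nat.cast_lt.1 hd')) with hm | rfl
      · exact hn' m hm
      · rw [hn]
        exact between_conf e (by simp) fun _ => Or.inr rfl
  · rw [M.step_of_forall_none hnone]
    have hfin : ∀ n : ℕ, M.simRun e x (a + n) = scanConf e x c (n / K) (Fin.ofNat K n) := by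
      intro n
      rw [simRun_add_nat, h, iterate_step_scanConf]
      exact fun j _ => hnone j
    have htape : ∀ b, a ≤ b → b < a + Ordinal.omega0 →
        (M.simRun e x b).tape = tapes x (encode e c.cell) (natToReal 1) := by
      intro b hab hb
      obtain ⟨d, rfl⟩ := exists_add_of_le hab
      obtain ⟨n, rfl⟩ := Ordinal.lt_omega0.1 ((add_lt_add_iff_left a).1 hb)
      rw [hfin]
      rfl
    refine ⟨Ordinal.omega0, Ordinal.omega0_pos, ?_, fun d' hd' => ?_⟩
    · have hl : Order.IsSuccLimit (a + Ordinal.omega0) :=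
        Ordinal.isSuccLimit_add a Ordinal.isSuccLimit_omega0
      rw [simRun_limit M e x hl, simulated]
      simp only [M.answer_limit]
      rw [scanConf_zero, conf]
      congr 1
      funext t i
      rw [← htape a le_rfl (lt_add_of_pos_right a Ordinal.omega0_pos), ← Bool.coe_iff_coe, decide_eq_true_iff]
      · constructor
        · intro hall
          obtain ⟨b, hb, hab, hbt⟩ := hall a (lt_add_of_pos_right a Ordinal.omega0_pos)
          rwa [htape b hab hb, ← htape a le_rfl (lt_add_of_pos_right a Ordinal.omega0_pos)] at hbt
        · intro ht a' ha'
          refine ⟨max a a', max_lt (lt_add_of_pos_right a Ordinal.omega0_pos) ha', le_max_right _ _, ?_⟩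
          rwa [htape _ (le_max_left _ _) (max_lt (lt_add_of_pos_right a Ordinal.omega0_pos) ha'),
            ← htape a le_rfl (lt_add_of_pos_right a Ordinal.omega0_pos)]
    · obtain ⟨n, rfl⟩ := Ordinal.lt_omega0.1 hd'
      rw [hfin]
      exact between_conf e (by simp [scanState]) fun _ => Or.inl rfl

/-- A normal function `g` sends each stage of the pair machine to the stage of the program that
represents it. The input and output tapes are constant along the simulation, and the scratch tape is
controlled at limits by `Between`. -/
theorem outputs_of_answers (x : CantorReal) {b : Bool} (h : M.Answers (inputBlocks e x) b) :
    (M.compile e).Outputs x (natToReal (cond b 1 0)) := by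
  classical
  set X := inputBlocks e x
  let P : Ordinal.{0} → Ordinal.{0} → Ordinal.{0} → Prop := fun a s d =>
    0 < d ∧ M.simRun e x (s + d) = M.simulated e x (M.run X (a + 1)) ∧
      ∀ d' < d, Between e x (M.run X a) (M.run X (a + 1)) (M.simRun e x (s + d'))
  let D : Ordinal.{0} → Ordinal.{0} → Ordinal.{0} := fun a s =>
    -- The default `1` only serves to keep `D` positive.
    if h : ∃ d, P a s d then h.choose else 1
  have hD : ∀ a s, 0 < D a s := by
    intro a s
    simp only [D]
    split_ifs with h
    · exact h.choose_spec.1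
    · exact one_pos
  -- The simulation starts at stage `1`, after the left end has been marked.
  obtain ⟨g, hg, hg0, hgs⟩ := Ordinal.exists_isNormal 1 D hD
  have hstep : ∀ a, M.simRun e x (g a) = scanConf e x (M.run X a) 0 0 → P a (g a) (D a (g a)) := by
    intro a ha
    have : ∃ d, P a (g a) d := by
      obtain ⟨d, h1, h2, h3⟩ := M.exists_simRun_eq_simulated e x ha
      rw [← M.run_add_one] at h2 h3
      exact ⟨d, h1, h2, h3⟩
    simp only [D]
    rw [dif_pos this]
    exact this.choose_spec
  obtain ⟨A, hA, hA'⟩ := h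
  have hbetween : ∀ a, (∀ a' < a, M.simRun e x (g a') = scanConf e x (M.run X a') 0 0) →
      ∀ s, g 0 ≤ s → s < g a → ∃ a' < a, g a' ≤ s ∧ s < g (a' + 1) ∧
        Between e x (M.run X a') (M.run X (a' + 1)) (M.simRun e x s) := by
    intro a ha s hs hsa
    obtain ⟨a', h1, h2⟩ := hg.exists_map_le_lt_map_succ (x := s) hs
    rw [Order.succ_eq_add_one] at h2
    have h3 : a' < a := hg.strictMono.lt_iff_lt.1 (h1.trans_lt hsa)
    refine ⟨a', h3, h1, h2, ?_⟩
    obtain ⟨d, rfl⟩ := exists_add_of_le h1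
    rw [hgs, add_lt_add_iff_left] at h2
    exact (hstep a' (ha a' h3)).2.2 d h2
  have hready : ∀ a < A, M.simRun e x (g a) = scanConf e x (M.run X a) 0 0 := by
    intro a
    induction a using WellFoundedLT.induction with | ind a ih => ?_
    intro haA
    have ih' : ∀ a' < a, M.simRun e x (g a') = scanConf e x (M.run X a') 0 0 :=
      fun a' h => ih a' h (h.trans haA)
    rcases Ordinal.zero_or_succ_or_isSuccLimit a with rfl | ⟨a, rfl⟩ | hl
    · rw [hg0, simRun_one]
    · rw [Order.succ_eq_add_one] at *
      have := (hstep a (ih' a (lt_add_one a))).2.1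
      rw [← hgs, simulated] at this
      rw [this]
      simp [hA' _ haA]
    · have hgl := hg.map_isSuccLimit hl
      have hcof : ∀ s < g a, ∃ a' < a, s < g a' := fun s hs => (hg.lt_iff_exists_lt hl).1 hs
      have hval : ∀ a' < a, (M.simRun e x (g a')).tape =
          tapes x (encode e (M.run X a').cell) (natToReal 1) := by
        intro a' h
        rw [ih' a' h]
        rfl
      rw [simRun_limit M e x hgl, M.run_limit X hl, scanConf_zero, conf]
      congr 1
      funext t i
      have key : ∀ v : Bool, (∀ a' < a, (M.simRun e x (g a')).tape t i = v) →
          (∀ s, g 0 ≤ s → s < g a → (M.simRun e x s).tape t i = v) →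
          decide (∀ s < g a, ∃ s', ∃ _ : s' < g a, s ≤ s' ∧ (M.simRun e x s').tape t i = true)
            = v := by
        intro v h1 h2
        cases v with
        | true =>
          rw [decide_eq_true_iff]
          intro s hs
          obtain ⟨a', ha', h⟩ := hcof s hs
          exact ⟨g a', hg.strictMono ha', h.le, h1 a' ha'⟩
        | false =>
          rw [decide_eq_false_iff_not]
          intro hall
          obtain ⟨s', hs', hs, h⟩ := hall (g 0) (hg.strictMono hl.bot_lt)
          rw [h2 s' hs hs'] at h
          exact Bool.false_ne_true h
      cases t with
      | input =>
        refine key _ (fun a' h => by rw [hval a' h]; rfl) (fun s hs hsa => ?_)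
        obtain ⟨a', -, -, -, hb⟩ := hbetween a ih' s hs hsa
        rw [hb.2.1]
        rfl
      | output =>
        refine key _ (fun a' h => by rw [hval a' h]; rfl) (fun s hs hsa => ?_)
        obtain ⟨a', -, -, -, hb⟩ := hbetween a ih' s hs hsa
        rw [hb.2.2.1]
        rfl
      | scratch =>
        simp only [tapes, encode]
        rw [decide_eq_decide]
        constructor
        · intro hall a0 ha0
          obtain ⟨s, hs, hle, ht⟩ := hall (g a0) (hg.strictMono ha0)
          have h0 : g 0 ≤ g a0 := hg.monotone zero_le
          obtain ⟨a', ha', h1, h2, hb⟩ := hbetween a ih' s (h0.trans hle) hs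
          have h3 : a0 ≤ a' := by
            have := hg.strictMono.lt_iff_lt.1 (hle.trans_lt h2)
            exact Order.lt_add_one_iff.1 this
          -- A `1` seen between two represented stages is already present at one of these two, and
          -- both lie below the limit.
          rcases hb.2.2.2 i with h | h
          · exact ⟨a', ha', h3, by rw [ht] at h; exact h.symm⟩
          · exact ⟨a' + 1, hl.add_one_lt ha', h3.trans (le_add_of_nonneg_right zero_le_one),
              by rw [ht] at h; exact h.symm⟩
        · intro hall s hs
          obtain ⟨a0, ha0, hlt⟩ := hcof s hs
          obtain ⟨a', ha', hle, ht⟩ := hall a0 ha0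
          refine ⟨g a', hg.strictMono ha', hlt.le.trans (hg.monotone hle), ?_⟩
          rw [hval a' ha']
          exact ht
  -- Neither the initial nor the limit state has an answer, so the answer first appears after a
  -- step.
  have hAsucc : ∃ a, A = a + 1 := by
    rcases Ordinal.zero_or_succ_or_isSuccLimit A with rfl | ⟨a, rfl⟩ | hl
    · rw [M.run_zero, M.answer_initial] at hA
      simp at hA
    · exact ⟨a, rfl⟩
    · rw [M.run_limit X hl, M.answer_limit] at hA
      simp at hA
  obtain ⟨a, rfl⟩ := hAsucc
  have hfinal : M.simRun e x (g (a + 1)) =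
      ⟨.halt, 0, tapes x (encode e (M.run X (a + 1)).cell) (natToReal (cond b 1 0))⟩ := by
    rw [hgs, (hstep a (hready a (lt_add_one a))).2.1, simulated]
    simp [hA]
  refine ⟨g (a + 1), ?_, fun s hs => ?_, ?_⟩
  · exact congrArg Config.state hfinal
  · change (M.simRun e x s).state ≠ .halt
    by_cases h0 : g 0 ≤ s
    · obtain ⟨a', -, -, -, hb⟩ := hbetween _ hready s h0 hs
      exact hb.1
    · rw [hg0, not_le, Order.lt_one_iff] at h0
      rw [h0, simRun_zero]
      simp
  · exact congrArg (fun c => c.tape .output) hfinal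

end PairMachine

end ITTM

/-! ### Restriction to finitely many states. -/

namespace ITTM

namespace PairMachine

variable {ι Q : Type}

theorem run_add_nat (M : PairMachine ι Q) (X : ℕ → ι → Bool) (a : Ordinal.{0}) (n : ℕ) :
    M.run X (a + n) = (M.step X)^[n] (M.run X a) := by
  induction n with
  | zero => simp
  | succ n ih =>
    rw [Function.iterate_succ_apply', ← ih, ← M.run_add_one]
    push_cast
    rw [add_assoc]

/-- The restriction of a pair machine to a set of states that is closed under its rules. -/
def restrict (M : PairMachine ι Q) (F : Set Q) (h₀ : M.initial ∈ F) (hl : M.limit ∈ F)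
    (hF : ∀ q ∈ F, ∀ x l r o, M.rule q x l r = some o → o.1 ∈ F) : PairMachine ι F where
  initial := ⟨M.initial, h₀⟩
  limit := ⟨M.limit, hl⟩
  answer := fun q => M.answer q
  rule := fun q x l r => (M.rule q x l r).pmap (fun o ho => (⟨o.1, ho⟩, o.2)) (hF q q.2 x l r)
  answer_initial := M.answer_initial
  answer_limit := M.answer_limit

section restrict

variable (M : PairMachine ι Q) {F : Set Q} (h₀ : M.initial ∈ F) (hl : M.limit ∈ F)
  (hF : ∀ q ∈ F, ∀ x l r o, M.rule q x l r = some o → o.1 ∈ F)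

theorem step_restrict (X : ℕ → ι → Bool) (c : Conf ι F) :
    M.step X ⟨c.state.1, c.cell⟩ = ⟨((M.restrict F h₀ hl hF).step X c).state.1,
      ((M.restrict F h₀ hl hF).step X c).cell⟩ := by
  have hrule : ∀ j, M.ruleAt X ⟨c.state.1, c.cell⟩ j =
      ((M.restrict F h₀ hl hF).ruleAt X c j).map fun o => (o.1.1, o.2) := by
    intro j
    simp only [ruleAt, restrict, Option.map_pmap]
    rw [Option.pmap_eq_map, Option.map_id']
  rcases (M.restrict F h₀ hl hF).exists_first_ruleAt_or X c with ⟨i, o, hi, hlt⟩ | hnone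
  · rw [step_of_ruleAt _ hi hlt, step_of_ruleAt M (i := i) (r := (o.1.1, o.2))]
    · rw [hrule, hi]
      rfl
    · intro j hj
      rw [hrule, hlt j hj]
      rfl
  · rw [step_of_forall_none _ hnone, step_of_forall_none M]
    · rfl
    · intro j
      rw [hrule, hnone j]
      rfl

theorem run_restrict (X : ℕ → ι → Bool) (a : Ordinal.{0}) :
    M.run X a = ⟨((M.restrict F h₀ hl hF).run X a).state.1,
      ((M.restrict F h₀ hl hF).run X a).cell⟩ := by
  induction a using Ordinal.limitRecOn with
  | zero =>
    rw [run_zero, run_zero]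
    rfl
  | add_one a ih => rw [run_add_one, run_add_one, ih, step_restrict M h₀ hl hF]
  | limit l hlim ih =>
    rw [run_limit _ _ hlim, run_limit _ _ hlim]
    congr 1
    funext i t
    rw [decide_eq_decide]
    refine forall₂_congr fun a _ => exists_congr fun b => exists_congr fun hb => ?_
    rw [ih b hb]

/-- The states of the search machine form an infinite type, while a program has finitely many; it is
enough that a finite set of them is closed under the rules. -/
theorem answers_restrict {X : ℕ → ι → Bool} {b : Bool} (h : M.Answers X b) :
    (M.restrict F h₀ hl hF).Answers X b := by
  obtain ⟨a, ha, ha'⟩ := h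
  have key : ∀ a, M.answer (M.run X a).state =
      (M.restrict F h₀ hl hF).answer ((M.restrict F h₀ hl hF).run X a).state := by
    intro a
    rw [M.run_restrict h₀ hl hF]
    rfl
  exact ⟨a, by rw [← key, ha], fun a' h => by rw [← key, ha' a' h]⟩

end restrict

end PairMachine

/-! ## The search machine -/

namespace Search

open Turing Turing.PartrecToTM2

/-- The tracks of the search machine: the current string, the mark at its last `1`, two flags at
the first cell that tell the phase, the walking mark and the mark at the last `1` of the walk, the
reading mark, and the stacks. -/
inductive Track : Type
  | str
  | last
  | searching
  | walking
  | walker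
  | found
  | reader
  | top (k : K')
  | sym (k : K') (a : Γ')

noncomputable instance : DecidableEq Track := Classical.decEq _

instance : Nonempty Track := ⟨.str⟩

instance : Finite K' :=
  Finite.of_injective (fun k : K' => (match k with
    | .main => 0
    | .rev => 1
    | .aux => 2
    | .stack => 3 : Fin 4)) fun a b h => by cases a <;> cases b <;> simp_all

instance : Finite Track := by
  let f : Track → Fin 7 ⊕ K' ⊕ (K' × Γ') := fun
    | .str => .inl 0
    | .last => .inl 1
    | .searching => .inl 2
    | .walking => .inl 3
    | .walker => .inl 4
    | .found => .inl 5
    | .reader => .inl 6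
    | .top k => .inr (.inl k)
    | .sym k a => .inr (.inr (k, a))
  exact Finite.of_injective f fun a b h => by cases a <;> cases b <;> simp_all [f]

/-- The statements of the stack machine. -/
abbrev Statement : Type := TM2.Stmt (fun _ : K' => Γ') Λ' (Option Γ')

/-- The program of the stack machine. -/
def program (l : Λ') : Statement := tr l

/-- The states of the search machine. -/
inductive State : Type
  | start
  | check
  | load (w : List Γ') (b : Bool)
  | exec (s : Statement) (v : Option Γ')
  | result
  | extend
  | prune
  | limit
  | walk
  | unmark
  | mark
  | look
  | resume
  | accept
  | reject

/-- A cell of the search machine. -/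
abbrev Cell : Type := Track → Bool

/-- The binary digit as a symbol of the stack machine. -/
def digit (b : Bool) : Γ' := cond b .bit1 .bit0

open Classical in
/-- The symbol of the stack `k` in a cell. -/
noncomputable def symbol (k : K') (r : Cell) : Γ' :=
  if h : ∃ a, r (.sym k a) = true then h.choose else default

/-- Store a symbol of the stack `k` in a cell. -/
noncomputable def store (k : K') (a : Γ') (r : Cell) : Cell
  | .top k' => if k' = k then true else r (.top k')
  | .sym k' a' => if k' = k then decide (a' = a) else r (.sym k' a')
  | t => r t

/-- Push a symbol on a stack. The top of the stack `k` is the first cell marked on `top k`. -/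
noncomputable def pushRule (k : K') (a : Γ') (q : State) (l r : Cell) :
    Option (State × Cell × Cell) :=
  if l (.top k) then some (q, Function.update l (.top k) false, store k a r) else none

/-- Inspect the top of a stack. -/
noncomputable def peekRule (k : K') (q : Option Γ' → State) (l r : Cell) :
    Option (State × Cell × Cell) :=
  if l (.top k) then some (q none, l, r)
  else if r (.top k) then some (q (some (symbol k r)), l, r) else none

/-- Remove the top of a stack. -/
noncomputable def popRule (k : K') (q : Option Γ' → State) (l r : Cell) :
    Option (State × Cell × Cell) :=
  if l (.top k) then some (q none, l, r)
  else if r (.top k) then some (q (some (symbol k r)), Function.update l (.top k) true,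
    Function.update r (.top k) false) else none

/-- The rules for the statements of the stack machine. -/
noncomputable def execRule (l r : Cell) : Statement → Option Γ' → Option (State × Cell × Cell)
  | .push k f s, v => pushRule k (f v) (.exec s v) l r
  | .peek k f s, v => peekRule k (fun a => .exec s (f v a)) l r
  | .pop k f s, v => popRule k (fun a => .exec s (f v a)) l r
  | .load f s, v => some (.exec s (f v), l, r)
  | .branch f s₁ s₂, v => some (.exec (cond (f v) s₁ s₂) v, l, r)
  | .goto f, v => some (.exec (program (f v)) v, l, r)
  | .halt, _ => some (.result, l, r)

/-- Put the stack machine and the reading mark into the initial position. -/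
def initCell (l : Cell) : Cell
  | .top _ => true
  | .reader => true
  | t => l t

/-- The digits that represent a block of the input and a bit of the current string. -/
def blockDigits {K : ℕ} (e : Track ≃ Fin K) (x : Cell) (b : Bool) : List Bool :=
  List.ofFn (fun j => x (e.symm j)) ++ [b]

/-- The rules of the search machine. -/
noncomputable def rule {K : ℕ} (e : Track ≃ Fin K) (c : ToPartrec.Code) (x l r : Cell) :
    State → Option (State × Cell × Cell)
  | .start => some (.check, fun t => t = .str ∨ t = .last ∨ t = .searching, r)
  -- The separator and a leading digit `1` go to the bottom of the stack. The leading digit protects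
  -- the zeros that follow it.
  | .check => some (.load [.cons, .bit1] false, initCell l, r)
  | .load (a :: w) b => pushRule .main a (.load w b) l r
  | .load [] true => some (.exec (program (trNormal c .halt)) none, l, r)
  -- The reading mark advances by one cell per block. The flag copied from `last` tells that this
  -- block is the final one, after which the test is run.
  | .load [] false =>
    if l .reader then some (.load ((blockDigits e x (l .str)).map digit) (l .last),
      Function.update l .reader false, Function.update r .reader true) else none
  | .exec s v => execRule l r s v
  | .result => peekRule .main (fun a => if a = some .bit1 then .extend else .prune) l r
  | .extend =>
    if l .last then some (.check, Function.update l .last false,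
      Function.update (Function.update r .last true) .str true) else none
  | .prune =>
    if l .last then
      -- This flag is set at cell `0` only, so it is met here exactly when the sequence to be left
      -- is the empty one.
      if l .searching then some (.reject, l, r)
      else some (.check, Function.update (Function.update l .last false) .str false,
        Function.update (Function.update r .last true) .str true)
    else none
  -- Three ways to enter the limit state are told apart by the flags at cell `0`: a limit of the
  -- search, a limit of the walk, and a failure of `.look` to find a mark, in which no rule applies.
  | .limit =>
    if l .searching then some (.walk,
      Function.update (Function.update (Function.update (Function.update l
        .searching false) .walking true) .found true) .walker false,
      Function.update r .walker true)
    else if l .walking then some (.look, Function.update l .walking false, r)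
    else some (.accept, l, r)
  | .walk =>
    if l .walker then
      if l .str then some (.unmark, l, r)
      else some (.walk, Function.update (Function.update l .walker false) .found false,
        Function.update r .walker true)
    else none
  | .unmark => if l .found then some (.mark, Function.update l .found false, r) else none
  | .mark =>
    if l .walker then some (.walk, Function.update (Function.update l .walker false) .found true,
      Function.update r .walker true) else none
  | .look => if l .found then some (.resume, Function.update l .last true, r) else none
  | .resume => some (.prune, Function.update l .searching true, r)
  | .accept => none
  | .reject => none

/-- The search machine looks for an infinite sequence of natural numbers all of whose initial
segments pass the test `c`. It answers `b` if there is one, and `!b` otherwise. -/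
noncomputable def machine {K : ℕ} (e : Track ≃ Fin K) (c : ToPartrec.Code) (b : Bool) :
    PairMachine Track State where
  initial := .start
  limit := .limit
  answer
    | .accept => some b
    | .reject => some (!b)
    | _ => none
  rule := fun q x l r => rule e c x l r q
  answer_initial := rfl
  answer_limit := rfl

/-- The states that the search machine uses. -/
def states (K : ℕ) (c : ToPartrec.Code) : Set State :=
  {q | match q with
    -- A block gives `K + 1` digits, and the list loaded at first has two symbols.
    | .load w _ => w.length ≤ K + 2
    | .exec s _ => some s ∈ TM2.stmts program (codeSupp c .halt)
    | _ => True}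

theorem load_mem_states {K : ℕ} {c : ToPartrec.Code} {w : List Γ'} {b : Bool} :
    .load w b ∈ states K c ↔ w.length ≤ K + 2 := Iff.rfl

/-- The statements that count are substatements of the programs of the finitely many labels in the
support of the code. -/
theorem finite_states (K : ℕ) (c : ToPartrec.Code) : (states K c).Finite := by
  have h1 : (Set.image2 State.load {w | w.length ≤ K + 2} Set.univ).Finite :=
    Set.Finite.image2 _ (List.finite_length_le _ _) Set.finite_univ
  have h2 : (Set.image2 State.exec {s | some s ∈ TM2.stmts program (codeSupp c .halt)}
      Set.univ).Finite := by
    refine Set.Finite.image2 _ ?_ Set.finite_univ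
    exact (Finset.finite_toSet (TM2.stmts program (codeSupp c .halt))).preimage
      (Option.some_injective _).injOn
  have h3 : ({.start, .check, .result, .extend, .prune, .limit, .walk, .unmark, .mark, .look,
      .resume, .accept, .reject} : Set State).Finite := Set.toFinite _
  refine ((h1.union h2).union h3).subset fun q hq => ?_
  cases q with
  | load w b => exact Or.inl (Or.inl ⟨w, hq, b, trivial, rfl⟩)
  | exec s v => exact Or.inl (Or.inr ⟨s, hq, v, trivial, rfl⟩)
  | _ => right; simp

theorem program_mem_stmts {c : ToPartrec.Code} {l : Λ'} (h : l ∈ codeSupp c .halt) :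
    some (program l) ∈ TM2.stmts program (codeSupp c .halt) := by
  simp only [TM2.stmts, Finset.mem_insertNone, Finset.mem_biUnion, Option.mem_def,
    Option.some.injEq, forall_eq']
  exact ⟨l, h, TM2.stmts₁_self⟩

theorem program_supports (c : ToPartrec.Code) :
    @TM2.Supports _ _ _ _ ⟨trNormal c .halt⟩ program (codeSupp c .halt) :=
  tr_supports c .halt

theorem execRule_mem {K : ℕ} {c : ToPartrec.Code} {s : Statement} {v : Option Γ'} {l r : Cell}
    {o : State × Cell × Cell} (hs : some s ∈ TM2.stmts program (codeSupp c .halt))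
    (ho : execRule l r s v = some o) : o.1 ∈ states K c := by
  have hsupp : TM2.SupportsStmt (codeSupp c .halt) s :=
    @TM2.stmts_supportsStmt _ _ _ _ ⟨trNormal c .halt⟩ _ _ _ (program_supports c) hs
  cases s with
  | push k f s =>
    simp only [execRule, pushRule] at ho
    split_ifs at ho
    cases ho
    exact TM2.stmts_trans (by simp [TM2.stmts₁, TM2.stmts₁_self]) hs
  | peek k f s =>
    simp only [execRule, peekRule] at ho
    split_ifs at ho <;> cases ho <;>
      exact TM2.stmts_trans (by simp [TM2.stmts₁, TM2.stmts₁_self]) hs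
  | pop k f s =>
    simp only [execRule, popRule] at ho
    split_ifs at ho <;> cases ho <;>
      exact TM2.stmts_trans (by simp [TM2.stmts₁, TM2.stmts₁_self]) hs
  | load f s =>
    cases ho
    exact TM2.stmts_trans (by simp [TM2.stmts₁, TM2.stmts₁_self]) hs
  | branch f s₁ s₂ =>
    cases ho
    refine TM2.stmts_trans ?_ hs
    cases f v <;> simp [TM2.stmts₁, TM2.stmts₁_self]
  | goto f =>
    cases ho
    exact program_mem_stmts (hsupp v)
  | halt =>
    cases ho
    trivial

theorem rule_mem {K : ℕ} (e : Track ≃ Fin K) (c : ToPartrec.Code) (b : Bool) :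
    ∀ q ∈ states K c, ∀ x l r o, (machine e c b).rule q x l r = some o → o.1 ∈ states K c := by
  intro q hq x l r o ho
  simp only [machine] at ho
  cases q with
  | exec s v => exact execRule_mem hq ho
  | load w b' =>
    cases w with
    | nil =>
      cases b' with
      | true =>
        cases ho
        exact program_mem_stmts (codeSupp_self _ _ (trStmts₁_self _))
      | false =>
        simp only [rule] at ho
        split_ifs at ho
        cases ho
        simp [load_mem_states, blockDigits]
    | cons a w =>
      simp only [rule, pushRule] at ho
      split_ifs at ho
      cases ho
      have : w.length + 1 ≤ K + 2 := hq
      exact Nat.le_of_succ_le this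
  | check =>
    cases ho
    simp [load_mem_states]
  | result =>
    simp only [rule, peekRule] at ho
    split_ifs at ho <;> cases ho <;> trivial
  | _ =>
    simp only [rule] at ho
    try split_ifs at ho
    all_goals first
      | cases ho; trivial
      | cases ho

end Search

end ITTM

/-! ## Moving the contents of stacks -/

namespace ITTM

namespace Search

open Turing Turing.PartrecToTM2 PairMachine

section update₂

variable {α β : Type*} (f : ℕ → α → β) (i : ℕ) (l r : α → β)

theorem update₂_left : Function.update (Function.update f i l) (i + 1) r i = l := by
  simp

theorem update₂_right : Function.update (Function.update f i l) (i + 1) r (i + 1) = r := by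
  simp

theorem update₂_of_ne {j : ℕ} (h : j ≠ i) (h' : j ≠ i + 1) :
    Function.update (Function.update f i l) (i + 1) r j = f j := by
  simp [h, h']

variable {f i l r}

theorem update₂_apply {t : α} (hl : l t = f i t) (hr : r t = f (i + 1) t) (j : ℕ) :
    Function.update (Function.update f i l) (i + 1) r j t = f j t := by
  by_cases h' : j = i + 1
  · subst h'
    rw [update₂_right, hr]
  · by_cases h : j = i
    · subst h
      rw [update₂_left, hl]
    · rw [update₂_of_ne _ _ _ _ h h']

end update₂

/-- The tracks that are used by the stack machine only. -/
def Track.IsStack : Track → Prop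
  | .top _ => True
  | .sym _ _ => True
  | _ => False

/-- The tracks that are only used for the test of the current string. -/
def Track.IsWork : Track → Prop
  | .reader => True
  | t => t.IsStack

theorem Track.IsStack.isWork {t : Track} (h : t.IsStack) : t.IsWork := by
  cases t <;> trivial

/-- The cells hold the list `L` on the stack `k`. -/
structure Stack (f : ℕ → Cell) (k : K') (L : List Γ') : Prop where
  -- The symbols lie from bottom to top in the cells `1`, `2`, and so on; a mark at cell `0` means
  -- that the stack is empty. Stale marks beyond the top do no harm, as rules apply at the first
  -- place possible.
  lt : ∀ j < L.length, f j (.top k) = false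
  eq : f L.length (.top k) = true
  sym : ∀ j a, L.reverse[j]? = some a → ∀ a', f (j + 1) (.sym k a') = decide (a' = a)

theorem Stack.congr {f g : ℕ → Cell} {k : K'} {L : List Γ'} (h : Stack f k L)
    (htop : ∀ j, g j (.top k) = f j (.top k)) (hsym : ∀ j a, g j (.sym k a) = f j (.sym k a)) :
    Stack g k L :=
  ⟨fun j hj => by rw [htop, h.lt j hj], by rw [htop, h.eq],
    fun j a ha a' => by rw [hsym, h.sym j a ha]⟩

theorem symbol_eq {k : K'} {r : Cell} {a : Γ'} (h : ∀ a', r (.sym k a') = decide (a' = a)) :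
    symbol k r = a := by
  have h' : ∃ a, r (.sym k a) = true := ⟨a, by simp [h]⟩
  rw [symbol, dif_pos h']
  have := h'.choose_spec
  rwa [h, decide_eq_true_iff] at this

theorem Stack.symbol_eq {f : ℕ → Cell} {k : K'} {a : Γ'} {L : List Γ'} (h : Stack f k (a :: L)) :
    symbol k (f (L.length + 1)) = a :=
  Search.symbol_eq (h.sym L.length a (by simp))

variable {K : ℕ} (e : Track ≃ Fin K) (code : ToPartrec.Code) (ans : Bool) (X : ℕ → Cell)

theorem step_machine {c : Conf Track State} (i : ℕ) (q : State) (l r : Cell)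
    (hi : rule e code (X i) (c.cell i) (c.cell (i + 1)) c.state = some (q, l, r))
    (hlt : ∀ j < i, rule e code (X j) (c.cell j) (c.cell (j + 1)) c.state = none) :
    (machine e code ans).step X c =
      ⟨q, Function.update (Function.update c.cell i l) (i + 1) r⟩ :=
  (machine e code ans).step_of_ruleAt (r := (q, l, r)) hi hlt

section StackRules

variable {c : Conf Track State} {S : K' → List Γ'} (hS : ∀ k, Stack c.cell k (S k))
include hS

theorem step_of_pushRule {k : K'} {a : Γ'} {q : State}
    (hr : ∀ x l r, rule e code x l r c.state = pushRule k a q l r) :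
    ((machine e code ans).step X c).state = q ∧
      (∀ k', Stack ((machine e code ans).step X c).cell k' (Function.update S k (a :: S k) k')) ∧
      ∀ i t, ¬ t.IsStack → ((machine e code ans).step X c).cell i t = c.cell i t := by
  have hk := hS k
  rw [step_machine e code ans X (S k).length q
    (Function.update (c.cell (S k).length) (.top k) false)
    (store k a (c.cell ((S k).length + 1)))
    (by rw [hr, pushRule, if_pos hk.eq])
    (fun j hj => by rw [hr, pushRule, hk.lt j hj]; simp)]
  refine ⟨rfl, fun k' => ?_, fun i t ht => ?_⟩
  · by_cases hkk : k' = k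
    · subst hkk
      rw [Function.update_self]
      refine ⟨fun j hj => ?_, ?_, fun j b hb a' => ?_⟩
      · simp only [List.length_cons] at hj
        by_cases h : j = (S k').length
        · subst h
          simp only [update₂_left, Function.update_self]
        · simp only [update₂_of_ne _ _ _ _ h (by omega : j ≠ (S k').length + 1)]
          exact hk.lt j (by omega)
      · simp only [List.length_cons, update₂_right, store, if_true]
      · rw [List.reverse_cons, List.getElem?_append] at hb
        split_ifs at hb with hj
        · rw [← hk.sym j b hb a']
          rw [List.length_reverse] at hj
          by_cases h : j + 1 = (S k').length
          · rw [h]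
            simp only [update₂_left]
            simp
          · simp only [update₂_of_ne _ _ _ _ h (by omega : j + 1 ≠ (S k').length + 1)]
        · rw [List.length_reverse] at hj hb
          have hj' : j = (S k').length := by
            by_contra hne
            rw [List.getElem?_eq_none (by simp; omega)] at hb
            simp at hb
          subst hj'
          simp only [Nat.sub_self, List.getElem?_cons_zero, Option.some.injEq] at hb
          simp [store, hb]
    · rw [Function.update_of_ne hkk]
      refine (hS k').congr (fun j => update₂_apply ?_ ?_ j) (fun j a => update₂_apply ?_ ?_ j)
      · simp [hkk]
      · simp [store, hkk]
      · simp
      · simp [store, hkk]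
  · refine update₂_apply ?_ ?_ i
    · rw [Function.update_of_ne]
      rintro rfl
      exact ht trivial
    · cases t <;> first | rfl | exact absurd trivial ht

theorem step_of_peekRule {k : K'} {q : Option Γ' → State}
    (hr : ∀ x l r, rule e code x l r c.state = peekRule k q l r) :
    (machine e code ans).step X c = ⟨q (S k).head?, c.cell⟩ := by
  have hk := hS k
  have key : ∀ i, rule e code (X i) (c.cell i) (c.cell (i + 1)) c.state =
      some (q (S k).head?, c.cell i, c.cell (i + 1)) →
      (∀ j < i, rule e code (X j) (c.cell j) (c.cell (j + 1)) c.state = none) →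
      (machine e code ans).step X c = ⟨q (S k).head?, c.cell⟩ := by
    intro i hi hlt
    rw [step_machine e code ans X i _ _ _ hi hlt]
    simp
  cases hL : S k with
  | nil =>
    rw [hL] at hk key
    have : c.cell 0 (.top k) = true := hk.eq
    refine key 0 ?_ (by simp)
    rw [hr, peekRule, if_pos this]
    rfl
  | cons a L =>
    rw [hL] at hk key
    -- For a nonempty stack, the first pair to which the rule applies is the one whose right cell is
    -- the top.
    refine key L.length ?_ fun j hj => ?_
    · rw [hr, peekRule, hk.lt _ (by simp), show c.cell (L.length + 1) (.top k) = true from hk.eq, hk.symbol_eq]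
      simp
    · rw [hr, peekRule, hk.lt _ (by simp; omega),
        hk.lt _ (by simp; omega)]
      simp

theorem step_of_popRule {k : K'} {q : Option Γ' → State}
    (hr : ∀ x l r, rule e code x l r c.state = popRule k q l r) :
    ((machine e code ans).step X c).state = q (S k).head? ∧
      (∀ k', Stack ((machine e code ans).step X c).cell k' (Function.update S k (S k).tail k')) ∧
      ∀ i t, ¬ t.IsStack → ((machine e code ans).step X c).cell i t = c.cell i t := by
  have hk := hS k
  cases hL : S k with
  | nil =>
    rw [hL] at hk
    have h0 : c.cell 0 (.top k) = true := hk.eq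
    rw [step_machine e code ans X 0 (q none) (c.cell 0) (c.cell 1)
      (by rw [hr, popRule, if_pos h0]) (by simp)]
    refine ⟨rfl, fun k' => ?_, fun i t _ => ?_⟩
    · have : Function.update S k [] = S := by
        rw [← hL, Function.update_eq_self]
      simpa [this] using hS k'
    · simp
  | cons a L =>
    rw [hL] at hk
    have h1 : c.cell L.length (.top k) = false := hk.lt _ (by simp)
    have h2 : c.cell (L.length + 1) (.top k) = true := hk.eq
    rw [step_machine e code ans X L.length (q (some a))
      (Function.update (c.cell L.length) (.top k) true)
      (Function.update (c.cell (L.length + 1)) (.top k) false)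
      (by rw [hr, popRule, h1, h2, hk.symbol_eq]; simp)
      (fun j hj => by
        rw [hr, popRule, hk.lt _ (by simp; omega), hk.lt _ (by simp; omega)]
        simp)]
    refine ⟨rfl, fun k' => ?_, fun i t ht => ?_⟩
    · by_cases hkk : k' = k
      · subst hkk
        rw [Function.update_self]
        refine ⟨fun j hj => ?_, ?_, fun j b hb a' => ?_⟩
        · simp only [List.tail_cons] at hj
          simp only [update₂_of_ne _ _ _ _ (by omega : j ≠ L.length)
            (by omega : j ≠ L.length + 1)]
          exact hk.lt j (by simp; omega)
        · simp
        · simp only [List.tail_cons] at hb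
          refine (update₂_apply (by simp) (by simp) _).trans (hk.sym j b ?_ a')
          rw [List.reverse_cons, List.getElem?_append_left, hb]
          exact (List.getElem?_eq_some_iff.1 hb).1
      · rw [Function.update_of_ne hkk]
        refine (hS k').congr (fun j => update₂_apply ?_ ?_ j) (fun j a => update₂_apply ?_ ?_ j)
          <;> simp [hkk]
    · refine update₂_apply ?_ ?_ i <;>
      · rw [Function.update_of_ne]
        rintro rfl
        exact ht trivial

end StackRules

end Search

end ITTM

/-! ## Testing a number with a code -/

namespace ITTM

namespace Search

open Turing Turing.PartrecToTM2 PairMachine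

/-- The machine has not halted, and outside of the work tracks the cells are as given. -/
def Keeps (f : ℕ → Cell) (c : Conf Track State) : Prop :=
  (c.state ≠ .accept ∧ c.state ≠ .reject) ∧ ∀ i t, ¬ t.IsWork → c.cell i t = f i t

/-- The state that corresponds to a label of the stack machine. -/
def labelState : Option Λ' → Option Γ' → State
  | some l, v => .exec (program l) v
  | none, _ => .result

theorem Keeps.of_isStack {f : ℕ → Cell} {c c' : Conf Track State} {q : State} (hc : Keeps f c)
    (hq : c'.state = q) (hne : q ≠ .accept ∧ q ≠ .reject)
    (hcell : ∀ i t, ¬ t.IsStack → c'.cell i t = c.cell i t) : Keeps f c' :=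
  ⟨by rwa [hq], fun i t ht => by rw [hcell i t (fun h => ht h.isWork), hc.2 i t ht]⟩

variable {K : ℕ} (e : Track ≃ Fin K) (code : ToPartrec.Code) (ans : Bool) (X : ℕ → Cell)

theorem step_of_forall_rule {c : Conf Track State} (q : State)
    (hq : ∀ x l r, rule e code x l r c.state = some (q, l, r)) :
    (machine e code ans).step X c = ⟨q, c.cell⟩ := by
  rw [step_machine e code ans X 0 q _ _ (hq _ _ _) (by simp)]
  simp

/-- One step of the stack machine executes a whole statement; the search machine spends a step on
each of its instructions. -/
theorem iterVia_exec {f : ℕ → Cell} (s : Statement) (v : Option Γ') (S : K' → List Γ')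
    (c : Conf Track State) (hc : Keeps f c) (hs : c.state = .exec s v)
    (hS : ∀ k, Stack c.cell k (S k)) :
    ∃ c', IterVia ((machine e code ans).step X) (Keeps f) c c' ∧ Keeps f c' ∧
      c'.state = labelState (TM2.stepAux s v S).l (TM2.stepAux s v S).var ∧
      (∀ k, Stack c'.cell k ((TM2.stepAux s v S).stk k)) := by
  induction s generalizing v S c with
  | push k g s ih =>
    obtain ⟨h1, h2, h3⟩ := step_of_pushRule e code ans X hS (k := k) (a := g v)
      (q := .exec s v) (fun x l r => by rw [hs]; rfl)
    obtain ⟨c', h4, h5⟩ := ih _ _ _ (hc.of_isStack h1 (by simp) h3) h1 h2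
    exact ⟨c', h4.head hc, h5⟩
  | peek k g s ih =>
    have h1 := step_of_peekRule e code ans X hS (k := k) (q := fun a => .exec s (g v a))
      (fun x l r => by rw [hs]; rfl)
    obtain ⟨c', h4, h5⟩ := ih (g v (S k).head?) S ⟨.exec s (g v (S k).head?), c.cell⟩
      (hc.of_isStack rfl (by simp) (by simp)) rfl hS
    exact ⟨c', IterVia.head hc (by rw [h1]; exact h4), h5⟩
  | pop k g s ih =>
    obtain ⟨h1, h2, h3⟩ := step_of_popRule e code ans X hS (k := k)
      (q := fun a => .exec s (g v a)) (fun x l r => by rw [hs]; rfl)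
    obtain ⟨c', h4, h5⟩ := ih _ _ _ (hc.of_isStack h1 (by simp) h3) h1 h2
    exact ⟨c', h4.head hc, h5⟩
  | load g s ih =>
    have h1 := step_of_forall_rule e code ans X (c := c) (.exec s (g v))
      (fun x l r => by rw [hs]; rfl)
    obtain ⟨c', h4, h5⟩ := ih (g v) S ⟨.exec s (g v), c.cell⟩
      (hc.of_isStack rfl (by simp) (by simp)) rfl hS
    exact ⟨c', (h1 ▸ h4).head hc, h5⟩
  | branch g s₁ s₂ ih₁ ih₂ =>
    have h1 := step_of_forall_rule e code ans X (c := c) (.exec (cond (g v) s₁ s₂) v)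
      (fun x l r => by rw [hs]; rfl)
    rw [TM2.stepAux]
    cases hg : g v with
    | true =>
      rw [hg] at h1
      obtain ⟨c', h4, h5⟩ := ih₁ v S ⟨.exec s₁ v, c.cell⟩
        (hc.of_isStack rfl (by simp) (by simp)) rfl hS
      exact ⟨c', IterVia.head hc (by rw [h1]; exact h4), h5⟩
    | false =>
      rw [hg] at h1
      obtain ⟨c', h4, h5⟩ := ih₂ v S ⟨.exec s₂ v, c.cell⟩
        (hc.of_isStack rfl (by simp) (by simp)) rfl hS
      exact ⟨c', IterVia.head hc (by rw [h1]; exact h4), h5⟩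
  | goto g =>
    have h1 := step_of_forall_rule e code ans X (c := c) (.exec (program (g v)) v)
      (fun x l r => by rw [hs]; rfl)
    exact ⟨_, .single hc h1, ⟨by simp, hc.2⟩, rfl, hS⟩
  | halt =>
    have h1 := step_of_forall_rule e code ans X (c := c) .result
      (fun x l r => by rw [hs]; rfl)
    exact ⟨_, .single hc h1, ⟨by simp, hc.2⟩, rfl, hS⟩

/-- The type of configurations of the stack machine. -/
abbrev StackConf : Type := TM2.Cfg (fun _ : K' => Γ') Λ' (Option Γ')

theorem iterVia_reaches {f : ℕ → Cell} {d d' : StackConf}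
    (h : TM2.Reaches program d d') (c : Conf Track State) (hc : Keeps f c)
    (hs : c.state = labelState d.l d.var) (hS : ∀ k, Stack c.cell k (d.stk k)) :
    ∃ c', IterVia ((machine e code ans).step X) (Keeps f) c c' ∧ Keeps f c' ∧
      c'.state = labelState d'.l d'.var ∧ (∀ k, Stack c'.cell k (d'.stk k)) := by
  induction h using Relation.ReflTransGen.head_induction_on generalizing c with
  | refl => exact ⟨c, .refl c, hc, hs, hS⟩
  | head h _ ih =>
    rename_i d d₁ _
    obtain ⟨l, v, S⟩ := d
    cases l with
    | none => simp [TM2.step] at h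
    | some l =>
      simp only [TM2.step, Option.mem_def, Option.some.injEq] at h
      subst h
      obtain ⟨c₁, h1, h2, h3, h4⟩ := iterVia_exec e code ans X (program l) v S c hc hs hS
      obtain ⟨c', h5, h6⟩ := ih c₁ h2 h3 h4
      exact ⟨c', h1.trans h5, h6⟩

theorem iterVia_load {f : ℕ → Cell} {b : Bool} (w : List Γ') (S : K' → List Γ')
    (c : Conf Track State) (hc : Keeps f c) (hs : c.state = .load w b)
    (hS : ∀ k, Stack c.cell k (S k)) :
    ∃ c', IterVia ((machine e code ans).step X) (Keeps f) c c' ∧ Keeps f c' ∧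
      c'.state = .load [] b ∧
      (∀ k, Stack c'.cell k (Function.update S .main (w.reverse ++ S .main) k)) ∧
      ∀ i, c'.cell i .reader = c.cell i .reader := by
  induction w generalizing S c with
  | nil => exact ⟨c, .refl c, hc, hs, by simpa using hS, fun _ => rfl⟩
  | cons a w ih =>
    obtain ⟨h1, h2, h3⟩ := step_of_pushRule e code ans X hS (k := .main) (a := a)
      (q := .load w b) (fun x l r => by rw [hs]; rfl)
    obtain ⟨c', h4, h5, h6, h7, h8⟩ := ih _ _ (hc.of_isStack h1 (by simp) h3) h1 h2
    refine ⟨c', h4.head hc, h5, h6, ?_, fun i => by rw [h8, h3 i _ (by simp [Track.IsStack])]⟩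
    simpa using h7

/-- The digits of the blocks of the input and the bits of the current string at the cells below
`n`. -/
def digits (y : CantorReal) (n : ℕ) : List Bool :=
  (List.range n).flatMap fun i => blockDigits e (X i) (y i)

theorem digits_succ (y : CantorReal) (n : ℕ) :
    digits e X y (n + 1) = digits e X y n ++ blockDigits e (X n) (y n) := by
  simp [digits, List.range_succ]

theorem digits_congr {y y' : CantorReal} {n : ℕ} (h : ∀ i < n, y i = y' i) :
    digits e X y n = digits e X y' n := by
  induction n with
  | zero => rfl
  | succ n ih =>
    rw [digits_succ, digits_succ, ih fun i hi => h i (by omega), h n (by omega)]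

/-- The stacks while the digits below the cell `n` have been pushed. -/
def loaded (y : CantorReal) (n : ℕ) : K' → List Γ' :=
  K'.elim (((digits e X y n).map digit).reverse ++ [.bit1, .cons]) [] [] []

/-- Only cell `0` is reset: as just the first mark on a track counts, remnants of earlier tests
further right are harmless. -/
theorem iterVia_check {f : ℕ → Cell} (c : Conf Track State) (hc : Keeps f c)
    (hs : c.state = .check) :
    ∃ c', IterVia ((machine e code ans).step X) (Keeps f) c c' ∧ Keeps f c' ∧
      c'.state = .load [] false ∧ (∀ k, Stack c'.cell k (loaded e X (fun i => f i .str) 0 k)) ∧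
      c'.cell 0 .reader = true := by
  have h1 : (machine e code ans).step X c = ⟨.load [.cons, .bit1] false,
      Function.update (Function.update c.cell 0 (initCell (c.cell 0))) (0 + 1) (c.cell 1)⟩ :=
    step_machine e code ans X 0 _ _ _ (by rw [hs]; rfl) (by simp)
  obtain ⟨c', h2, h3, h4, h5, h6⟩ := iterVia_load e code ans X (f := f) (b := false)
    [.cons, .bit1] (fun _ => [])
    ((machine e code ans).step X c) (by
      rw [h1]
      refine ⟨by simp, fun i t ht => ?_⟩
      refine (update₂_apply ?_ rfl i).trans (hc.2 i t ht)
      cases t <;> first | rfl | exact absurd trivial ht)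
    (by rw [h1]) (fun k => by
      rw [h1]
      refine ⟨by simp, ?_, by simp⟩
      simp [initCell])
  refine ⟨c', h2.head hc, h3, h4, fun k => ?_, ?_⟩
  · have := h5 k
    cases k <;> simpa [loaded, digits] using this
  · rw [h6, h1]
    simp [initCell]

theorem iterVia_read {f : ℕ → Cell} (c : Conf Track State) (hc : Keeps f c)
    (hs : c.state = .load [] false) (i : ℕ) (hr : c.cell i .reader = true)
    (hlt : ∀ j < i, c.cell j .reader = false)
    (hS : ∀ k, Stack c.cell k (loaded e X (fun i => f i .str) i k)) :
    ∃ c', IterVia ((machine e code ans).step X) (Keeps f) c c' ∧ Keeps f c' ∧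
      c'.state = .load [] (f i .last) ∧
      (∀ k, Stack c'.cell k (loaded e X (fun i => f i .str) (i + 1) k)) ∧
      c'.cell (i + 1) .reader = true ∧ ∀ j < i + 1, c'.cell j .reader = false := by
  have h1 := step_machine e code ans X (c := c) i
    (.load ((blockDigits e (X i) (c.cell i .str)).map digit) (c.cell i .last))
    (Function.update (c.cell i) .reader false) (Function.update (c.cell (i + 1)) .reader true)
    (by rw [hs, rule, if_pos hr]) (fun j hj => by rw [hs, rule, hlt j hj]; simp)
  have hwork : ∀ t : Track, ¬ t.IsWork → t ≠ .reader := by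
    rintro t ht rfl
    exact ht trivial
  have hkeep : Keeps f ((machine e code ans).step X c) := by
    rw [h1]
    refine ⟨by simp, fun j t ht => ?_⟩
    exact (update₂_apply (Function.update_of_ne (hwork t ht) _ _)
      (Function.update_of_ne (hwork t ht) _ _) j).trans (hc.2 j t ht)
  obtain ⟨c', h2, h3, h4, h5, h6⟩ := iterVia_load e code ans X (f := f)
    (b := c.cell i .last) _ _ _ hkeep (by rw [h1])
    (fun k => (hS k).congr (fun j => by
        rw [h1]
        exact update₂_apply (by simp) (by simp) j) (fun j a => by
        rw [h1]
        exact update₂_apply (by simp) (by simp) j))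
  refine ⟨c', h2.head hc, h3, by rw [h4, hc.2 _ _ (by simp [Track.IsWork, Track.IsStack])],
    fun k => ?_, ?_, fun j hj => ?_⟩
  · have := h5 k
    rw [hc.2 _ _ (by simp [Track.IsWork, Track.IsStack])] at this
    rw [loaded, digits_succ]
    cases k <;> simpa [loaded] using this
  · rw [h6, h1]
    simp
  · rw [h6, h1]
    by_cases h : j = i
    · subst h
      simp only [update₂_left, Function.update_self]
    · simp only [update₂_of_ne _ _ _ _ h (by omega : j ≠ i + 1)]
      exact hlt j (by omega)

/-- The number whose binary representation is a digit `1` followed by the given digits. -/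
def number (w : List Bool) : ℕ :=
  w.foldl (fun n b => 2 * n + b.toNat) 1

/-- `trNat` lists the binary digits with the lowest one first. The number `0` is excluded because
its list is empty and cannot be extended by a digit `0`. -/
theorem trNat_two_mul_add (n : ℕ) (hn : n ≠ 0) (b : Bool) :
    trNat (2 * n + b.toNat) = digit b :: trNat n := by
  obtain ⟨m, hm⟩ : ∃ m : PosNum, (n : Num) = .pos m := by
    cases h : (n : Num) with
    | zero =>
      exfalso
      apply hn
      have := congrArg (fun a : Num => (a : ℕ)) h
      simpa using this
    | pos m => exact ⟨m, rfl⟩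
  have h0 : ((2 * n + b.toNat : ℕ) : Num) = cond b (.pos m.bit1) (.pos m.bit0) := by
    apply Num.to_nat_inj.1
    have hm' : (m : ℕ) = n := by
      have := congrArg (fun a : Num => (a : ℕ)) hm
      simpa using this.symm
    rw [Num.to_of_nat]
    cases b <;> simp [hm'] <;> omega
  rw [trNat, trNat, h0, hm]
  cases b <;> rfl

theorem number_ne_zero (w : List Bool) : number w ≠ 0 := by
  induction w using List.reverseRecOn with
  | nil => simp [number]
  | append_singleton w b ih =>
    simp only [number, List.foldl_append, List.foldl_cons, List.foldl_nil] at ih ⊢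
    omega

/-- Pushing reverses the order of the digits, and thus produces the very representation that the
stack machine expects. -/
theorem trNat_number (w : List Bool) :
    trNat (number w) = (w.map digit).reverse ++ [.bit1] := by
  induction w using List.reverseRecOn with
  | nil => rfl
  | append_singleton w b ih =>
    have : number (w ++ [b]) = 2 * number w + b.toNat := by simp [number]
    rw [this, trNat_two_mul_add _ (number_ne_zero w), ih]
    simp

theorem iterVia_test {f : ℕ → Cell} (c : Conf Track State) (hc : Keeps f c)
    (hs : c.state = .check) {p : ℕ} (hp : f p .last = true) (hlt : ∀ j < p, f j .last = false)
    {v : Bool} (hv : code.eval [number (digits e X (fun i => f i .str) (p + 1))] =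
      pure [v.toNat]) :
    ∃ c', IterVia ((machine e code ans).step X) (Keeps f) c c' ∧ Keeps f c' ∧
      c'.state = if v then .extend else .prune := by
  have hload : ∀ i ≤ p, ∃ c', IterVia ((machine e code ans).step X) (Keeps f) c c' ∧ Keeps f c' ∧
      c'.state = .load [] false ∧ (∀ k, Stack c'.cell k (loaded e X (fun i => f i .str) i k)) ∧
      c'.cell i .reader = true ∧ ∀ j < i, c'.cell j .reader = false := by
    intro i
    induction i with
    | zero =>
      intro _
      obtain ⟨c', h1, h2, h3, h4, h5⟩ := iterVia_check e code ans X c hc hs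
      exact ⟨c', h1, h2, h3, h4, h5, by simp⟩
    | succ i ih =>
      intro hi
      obtain ⟨c₁, h1, h2, h3, h4, h5, h6⟩ := ih (by omega)
      obtain ⟨c', g1, g2, g3, g4⟩ := iterVia_read e code ans X c₁ h2 h3 i h5 h6 h4
      rw [hlt i (by omega)] at g3
      exact ⟨c', h1.trans g1, g2, g3, g4⟩
  obtain ⟨c₁, h1, h2, h3, h4, h5, h6⟩ := hload p le_rfl
  obtain ⟨c₂, g1, g2, g3, g4, -⟩ := iterVia_read e code ans X c₁ h2 h3 p h5 h6 h4
  rw [hp] at g3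
  have k1 := step_of_forall_rule e code ans X (c := c₂) (.exec (program (trNormal code .halt)) none)
    (fun x l r => by rw [g3]; rfl)
  have heval : halt [v.toNat] ∈ StateTransition.eval (TM2.step tr)
      (PartrecToTM2.init code [number (digits e X (fun i => f i .str) (p + 1))]) := by
    rw [tr_eval, hv]
    exact Part.mem_map _ (Part.mem_some _)
  have hreach := (StateTransition.mem_eval.1 heval).1
  obtain ⟨c₃, k2, k3, k4, k5⟩ := iterVia_reaches e code ans X (f := f)
    (d := PartrecToTM2.init code [number (digits e X (fun i => f i .str) (p + 1))])
    (d' := halt [v.toNat]) hreach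
    ⟨.exec (program (trNormal code .halt)) none, c₂.cell⟩ ⟨by simp, g2.2⟩ rfl
    (fun k => by
      have := g4 k
      simpa [loaded, PartrecToTM2.init, trNat_number] using this)
  have k6 := step_of_peekRule e code ans X k5 (k := .main)
    (q := fun a => if a = some .bit1 then .extend else .prune) (fun x l r => by rw [k4]; rfl)
  refine ⟨_, ((h1.trans g1).trans (IterVia.head g2 (by rw [k1]; exact k2))).trans (.single k3 k6),
    ⟨?_, k3.2⟩, ?_⟩
  · split_ifs <;> simp
  -- The result `0` is represented by no digit, so that the separator is on top of the stack, and
  -- the result `1` by the digit `bit1`.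
  · cases v
    · simp [PartrecToTM2.halt]
    · have : trNat 1 = [.bit1] := rfl
      simp [PartrecToTM2.halt, this]

end Search

end ITTM

/-! ## Limit stages -/

open Order in
-- The supremum is taken. Every stage below it and not before `a N` lies in one of the intervals
-- from the `N`-th on, so what holds throughout these intervals holds eventually below the limit.
theorem Ordinal.exists_limit_of_strictMono (a : ℕ → Ordinal.{0}) (ha : StrictMono a) :
    ∃ l : Ordinal.{0}, IsSuccLimit l ∧ (∀ n, a n < l) ∧
      ∀ N d, a N ≤ d → d < l → ∃ n ≥ N, a n ≤ d ∧ d < a (n + 1) := by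
  have hbdd : BddAbove (Set.range a) := Ordinal.bddAbove_of_small
  have hlt : ∀ n, a n < ⨆ n, a n := fun n =>
    (ha (Nat.lt_succ_self n)).trans_le (le_ciSup hbdd (n + 1))
  refine ⟨⨆ n, a n, ?_, hlt, fun N d hN hd => ?_⟩
  · rw [Ordinal.isSuccLimit_iff, isSuccPrelimit_iff_succ_lt]
    refine ⟨fun h => ?_, fun b hb => ?_⟩
    · have := hlt 0
      rw [h] at this
      exact absurd this not_lt_zero
    · obtain ⟨n, hn⟩ := exists_lt_of_lt_ciSup hb
      exact (succ_le_of_lt hn).trans_lt (hlt n)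
  · have hex : ∃ n, d < a n := exists_lt_of_lt_ciSup hd
    classical
    have h1 := Nat.find_spec hex
    have h2 : N < Nat.find hex := by
      by_contra! h
      exact absurd (h1.trans_le (ha.monotone h)) (not_lt.2 hN)
    refine ⟨Nat.find hex - 1, by omega, not_lt.1 (Nat.find_min hex (by omega)), ?_⟩
    rwa [Nat.sub_add_cancel (by omega)]

namespace ITTM

namespace PairMachine

variable {ι Q : Type} (M : PairMachine ι Q) (X : ℕ → ι → Bool)

theorem exists_run_of_iterVia {P : Conf ι Q → Prop} {a : Ordinal.{0}} {c : Conf ι Q}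
    (h : IterVia (M.step X) P (M.run X a) c) :
    ∃ n : ℕ, M.run X (a + n) = c ∧ ∀ d, a ≤ d → d < a + n → P (M.run X d) := by
  obtain ⟨n, hn, hlt⟩ := h
  refine ⟨n, by rw [M.run_add_nat, hn], fun d hd hd' => ?_⟩
  obtain ⟨d, rfl⟩ := exists_add_of_le hd
  rw [add_lt_add_iff_left] at hd'
  obtain ⟨m, rfl⟩ := Ordinal.lt_omega0.1 (hd'.trans (Ordinal.natCast_lt_omega0 _))
  rw [M.run_add_nat]
  exact hlt m (Nat.cast_lt.1 hd')

theorem run_limit_state {l : Ordinal.{0}} (hl : Order.IsSuccLimit l) :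
    (M.run X l).state = M.limit := by
  rw [M.run_limit X hl]

theorem run_limit_cell_of_eventually {l : Ordinal.{0}} (hl : Order.IsSuccLimit l) {i : ℕ} {t : ι}
    {v : Bool} {a : Ordinal.{0}} (ha : a < l)
    (h : ∀ d, a ≤ d → d < l → (M.run X d).cell i t = v) : (M.run X l).cell i t = v := by
  classical
  rw [M.run_limit X hl]
  cases v with
  | true =>
    simp only [decide_eq_true_eq]
    exact fun b hb => ⟨max a b, max_lt ha hb, le_max_right _ _, h _ (le_max_left _ _) (max_lt ha hb)⟩
  | false =>
    simp only [decide_eq_false_iff_not]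
    intro hall
    obtain ⟨d, hd, had, ht⟩ := hall a ha
    rw [h d had hd] at ht
    exact Bool.false_ne_true ht

theorem run_limit_cell_of_frequently {l : Ordinal.{0}} (hl : Order.IsSuccLimit l) {i : ℕ} {t : ι}
    (h : ∀ a < l, ∃ d, d < l ∧ a ≤ d ∧ (M.run X d).cell i t = true) :
    (M.run X l).cell i t = true := by
  rw [M.run_limit X hl]
  simp only [decide_eq_true_eq]
  intro a ha
  obtain ⟨d, h1, h2, h3⟩ := h a ha
  exact ⟨d, h1, h2, h3⟩

end PairMachine

/-! ### The walk that looks for the last `1` of the string. -/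

namespace Search

open Turing Turing.PartrecToTM2 PairMachine

variable {K : ℕ} (e : Track ≃ Fin K) (code : ToPartrec.Code) (ans : Bool) (X : ℕ → Cell)

/-- The machine has not halted. -/
def Running (c : Conf Track State) : Prop := c.state ≠ .accept ∧ c.state ≠ .reject

/-- `i` is the last place below `j` where the sequence `y` has the value `1`. -/
def IsLastBelow (y : CantorReal) (j i : ℕ) : Prop :=
  i < j ∧ y i = true ∧ ∀ i', i < i' → i' < j → y i' = false

theorem isLastBelow_unique {y : CantorReal} {j i i' : ℕ} (h : IsLastBelow y j i)
    (h' : IsLastBelow y j i') : i = i' := by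
  rcases lt_trichotomy i i' with hlt | rfl | hlt
  · have := h.2.2 i' hlt h'.1
    simp [h'.2.1] at this
  · rfl
  · have := h'.2.2 i hlt h.1
    simp [h.2.1] at this

theorem isLastBelow_succ_of_true {y : CantorReal} {j i : ℕ} (h : y j = true) :
    IsLastBelow y (j + 1) i ↔ i = j := by
  constructor
  · rintro ⟨h1, h2, h3⟩
    by_contra hne
    have := h3 j (by omega) (by omega)
    simp [h] at this
  · rintro rfl
    exact ⟨by omega, h, fun i' h1 h2 => by omega⟩

theorem isLastBelow_succ_of_false {y : CantorReal} {j i : ℕ} (h : y j = false) :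
    IsLastBelow y (j + 1) i ↔ IsLastBelow y j i := by
  constructor
  · rintro ⟨h1, h2, h3⟩
    have : i ≠ j := by
      rintro rfl
      simp [h] at h2
    exact ⟨by omega, h2, fun i' h4 h5 => h3 i' h4 (by omega)⟩
  · rintro ⟨h1, h2, h3⟩
    refine ⟨by omega, h2, fun i' h4 h5 => ?_⟩
    by_cases h6 : i' = j
    · rw [h6, h]
    · exact h3 i' h4 (by omega)

theorem exists_isLastBelow {y : CantorReal} (h0 : y 0 = true) {j : ℕ} (hj : 1 ≤ j) :
    ∃ i, IsLastBelow y j i := by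
  induction j, hj using Nat.le_induction with
  | base => exact ⟨0, by omega, h0, fun i' _ _ => by omega⟩
  | succ j _ ih =>
    cases hy : y j with
    | true => exact ⟨j, (isLastBelow_succ_of_true hy).2 rfl⟩
    | false =>
      obtain ⟨i, hi⟩ := ih
      exact ⟨i, (isLastBelow_succ_of_false hy).2 hi⟩

/-- The tracks that are not changed while the last `1` of the string is searched. -/
structure WalkFrame (y : CantorReal) (f : ℕ → Cell) (c : Conf Track State) : Prop where
  running : Running c
  str : ∀ i, c.cell i .str = y i
  last : ∀ i, c.cell i .last = f i .last
  searching : ∀ i, c.cell i .searching = false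
  walking : c.cell 0 .walking = true

theorem WalkFrame.step {y : CantorReal} {f : ℕ → Cell} {c : Conf Track State}
    (h : WalkFrame y f c) {q : State} {i : ℕ} {l r : Cell} (hq : q ≠ .accept ∧ q ≠ .reject)
    (hl : ∀ t, t ≠ .walker → t ≠ .found → l t = c.cell i t)
    (hr : ∀ t, t ≠ .walker → t ≠ .found → r t = c.cell (i + 1) t) :
    WalkFrame y f ⟨q, Function.update (Function.update c.cell i l) (i + 1) r⟩ := by
  have key : ∀ t, t ≠ .walker → t ≠ .found → ∀ j,
      Function.update (Function.update c.cell i l) (i + 1) r j t = c.cell j t :=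
    fun t h1 h2 j => update₂_apply (hl t h1 h2) (hr t h1 h2) j
  exact ⟨hq, fun j => (key _ (by simp) (by simp) j).trans (h.str j),
    fun j => (key _ (by simp) (by simp) j).trans (h.last j),
    fun j => (key _ (by simp) (by simp) j).trans (h.searching j),
    (key _ (by simp) (by simp) 0).trans h.walking⟩

open Classical in
/-- The walking mark is at the cell `j`. -/
structure WalkAt (y : CantorReal) (f : ℕ → Cell) (j : ℕ) (c : Conf Track State) : Prop where
  frame : WalkFrame y f c
  state : c.state = .walk
  walker : c.cell j .walker = true
  walker_lt : ∀ i < j, c.cell i .walker = false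
  found : ∀ i < j, c.cell i .found = decide (IsLastBelow y j i)

open Classical in
/-- The configurations while the walking mark moves from the cell `j` to the next one. -/
def Walking (y : CantorReal) (f : ℕ → Cell) (j : ℕ) (c : Conf Track State) : Prop :=
  WalkFrame y f c ∧ ∀ i < j, c.cell i .found = decide (IsLastBelow y j i) ∨
    c.cell i .found = decide (IsLastBelow y (j + 1) i)

theorem WalkAt.walking {y : CantorReal} {f : ℕ → Cell} {j : ℕ} {c : Conf Track State}
    (h : WalkAt y f j c) : Walking y f j c :=
  ⟨h.frame, fun i hi => Or.inl (h.found i hi)⟩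

/-- At a `0` the walking mark just moves on. At a `1` the mark `found` is first erased at its old
place and then set at `j`; meanwhile it is missing, but each cell below `j` holds the value due
before or the value due afterwards, which suffices at the limit. -/
theorem iterVia_walk {y : CantorReal} (h0 : y 0 = true) {f : ℕ → Cell} {j : ℕ} (hj : 1 ≤ j)
    {c : Conf Track State} (hc : WalkAt y f j c) :
    ∃ c', IterVia ((machine e code ans).step X) (Walking y f j) ((machine e code ans).step X c) c' ∧
      WalkAt y f (j + 1) c' := by
  classical
  cases hy : y j with
  | false =>
    rw [step_machine e code ans X j .walk
      (Function.update (Function.update (c.cell j) .walker false) .found false)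
      (Function.update (c.cell (j + 1)) .walker true)
      (by rw [hc.state, rule, if_pos hc.walker, hc.frame.str, hy]; simp)
      (fun i hi => by rw [hc.state, rule, hc.walker_lt i hi]; simp)]
    refine ⟨_, .refl _, hc.frame.step (by simp) ?_ ?_, rfl, ?_, fun i hi => ?_, fun i hi => ?_⟩
    · intro t h1 h2
      simp [h1, h2]
    · intro t h1 h2
      simp [h1]
    · simp
    · by_cases h : i = j
      · subst h
        simp
      · simp only [update₂_of_ne _ _ _ _ h (by omega : i ≠ j + 1)]
        exact hc.walker_lt i (by omega)
    · by_cases h : i = j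
      · subst h
        simp only [update₂_left, Function.update_self]
        symm
        rw [decide_eq_false_iff_not]
        rintro ⟨-, h, -⟩
        simp [hy] at h
      · simp only [update₂_of_ne _ _ _ _ h (by omega : i ≠ j + 1)]
        rw [hc.found i (by omega), decide_eq_decide, isLastBelow_succ_of_false hy]
  | true =>
    rw [step_machine e code ans X j .unmark (c.cell j) (c.cell (j + 1))
      (by rw [hc.state, rule, if_pos hc.walker, hc.frame.str, hy]; simp)
      (fun i hi => by rw [hc.state, rule, hc.walker_lt i hi]; simp)]
    -- As `y 0` is `1`, there is always an old mark to erase, and `.unmark` does not get stuck.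
    obtain ⟨i₀, hi₀⟩ := exists_isLastBelow h0 hj
    have e1 : Function.update (Function.update c.cell j (c.cell j)) (j + 1) (c.cell (j + 1)) =
        c.cell := by simp
    rw [e1]
    have w1 : Walking y f j ⟨.unmark, c.cell⟩ := by
      refine ⟨?_, fun i hi => Or.inl (hc.found i hi)⟩
      have := hc.frame.step (q := .unmark) (i := j) (l := c.cell j) (r := c.cell (j + 1))
        (by simp) (fun _ _ _ => rfl) (fun _ _ _ => rfl)
      rwa [e1] at this
    have s1 := step_machine e code ans X (c := ⟨.unmark, c.cell⟩) i₀ .mark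
      (Function.update (c.cell i₀) .found false) (c.cell (i₀ + 1))
      (by
        have : c.cell i₀ .found = true := by
          rw [hc.found i₀ hi₀.1, decide_eq_true_iff]
          exact hi₀
        simp only [rule, if_pos this])
      (fun i hi => by
        have : c.cell i .found = false := by
          rw [hc.found i (hi.trans hi₀.1), decide_eq_false_iff_not]
          exact fun h => hi.ne (isLastBelow_unique h hi₀)
        simp only [rule, this]
        simp)
    set c₂ : Conf Track State := ⟨.mark, Function.update (Function.update c.cell i₀
      (Function.update (c.cell i₀) .found false)) (i₀ + 1) (c.cell (i₀ + 1))⟩ with hc₂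
    have f2 : WalkFrame y f c₂ := w1.1.step (by simp)
      (fun t h1 h2 => by simp [h2]) (fun _ _ _ => rfl)
    have found2 : ∀ i < j, c₂.cell i .found = false := by
      intro i hi
      by_cases h : i = i₀
      · subst h
        simp only [hc₂, update₂_left, Function.update_self]
      · have : c₂.cell i .found = c.cell i .found := by
          by_cases h' : i = i₀ + 1
          · subst h'
            simp only [hc₂, update₂_right]
          · simp only [hc₂, update₂_of_ne _ _ _ _ h h']
        rw [this, hc.found i hi, decide_eq_false_iff_not]
        exact fun h' => h (isLastBelow_unique h' hi₀)
    have walker2 : ∀ i, c₂.cell i .walker = c.cell i .walker :=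
      fun i => update₂_apply (by simp) rfl i
    have hnot : ∀ i < j, decide (IsLastBelow y (j + 1) i) = false := by
      intro i hi
      rw [decide_eq_false_iff_not, isLastBelow_succ_of_true hy]
      exact hi.ne
    have w2 : Walking y f j c₂ :=
      ⟨f2, fun i hi => Or.inr (by rw [found2 i hi, hnot i hi])⟩
    have s2 := step_machine e code ans X (c := c₂) j .walk
      (Function.update (Function.update (c₂.cell j) .walker false) .found true)
      (Function.update (c₂.cell (j + 1)) .walker true)
      (by
        have : c₂.cell j .walker = true := by rw [walker2, hc.walker]
        simp only [hc₂] at this ⊢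
        simp only [rule, if_pos this])
      (fun i hi => by
        have : c₂.cell i .walker = false := by rw [walker2, hc.walker_lt i hi]
        simp only [hc₂] at this ⊢
        simp only [rule, this]
        simp)
    refine ⟨_, IterVia.head w1 (by rw [s1]; exact IterVia.single w2 s2), f2.step (by simp) ?_ ?_,
      rfl, ?_, fun i hi => ?_, fun i hi => ?_⟩
    · intro t h1 h2
      simp [h1, h2]
    · intro t h1 h2
      simp [h1]
    · simp
    · by_cases h : i = j
      · subst h
        simp
      · simp only [update₂_of_ne _ _ _ _ h (by omega : i ≠ j + 1)]
        rw [walker2]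
        exact hc.walker_lt i (by omega)
    · by_cases h : i = j
      · subst h
        simp only [update₂_left, Function.update_self]
        symm
        rw [decide_eq_true_iff, isLastBelow_succ_of_true hy]
      · simp only [update₂_of_ne _ _ _ _ h (by omega : i ≠ j + 1)]
        rw [found2 i (by omega), hnot i (by omega)]

end Search

end ITTM

/-! ## The walk from a limit stage -/

/-- Dependent choice of increasing stages: `V` describes the chosen stages, and `W` what happens
between two of them. -/
theorem exists_strictMono_seq {V : ℕ → Ordinal.{0} → Prop}
    {W : ℕ → Ordinal.{0} → Ordinal.{0} → Prop} {a₀ : Ordinal.{0}} (h₀ : V 0 a₀)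
    (h : ∀ n a, V n a → ∃ a', a < a' ∧ V (n + 1) a' ∧ W n a a') :
    ∃ a : ℕ → Ordinal.{0}, a 0 = a₀ ∧ StrictMono a ∧
      ∀ n, V n (a n) ∧ W n (a n) (a (n + 1)) := by
  choose! g hg using h
  let a : ℕ → Ordinal.{0} := fun n => Nat.rec a₀ (fun n b => g n b) n
  have hV : ∀ n, V n (a n) := by
    intro n
    induction n with
    | zero => exact h₀
    | succ n ih => exact (hg n (a n) ih).2.1
  exact ⟨a, rfl, strictMono_nat_of_lt_succ fun n => (hg n (a n) (hV n)).1,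
    fun n => ⟨hV n, (hg n (a n) (hV n)).2.2⟩⟩

namespace ITTM

namespace Search

open Turing Turing.PartrecToTM2 PairMachine

variable {K : ℕ} (e : Track ≃ Fin K) (code : ToPartrec.Code) (ans : Bool) (X : ℕ → Cell)

/-- The machine runs, and the tracks of the string and of the mark at its last `1` are as given. -/
structure Frozen (y : CantorReal) (f : ℕ → Cell) (c : Conf Track State) : Prop where
  running : Running c
  str : ∀ i, c.cell i .str = y i
  last : ∀ i, c.cell i .last = f i .last
  searching : ∀ i, 0 < i → c.cell i .searching = false

theorem WalkFrame.frozen {y : CantorReal} {f : ℕ → Cell} {c : Conf Track State}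
    (h : WalkFrame y f c) : Frozen y f c :=
  ⟨h.running, h.str, h.last, fun i _ => h.searching i⟩

theorem walkAt_one {y : CantorReal} (h0 : y 0 = true) {c : Conf Track State}
    (hs : c.state = .limit) (hy : ∀ i, c.cell i .str = y i)
    (hsearch : ∀ i, c.cell i .searching = decide (i = 0)) :
    WalkAt y c.cell 1 ((machine e code ans).step X c) := by
  classical
  rw [step_machine e code ans X 0 .walk
    (Function.update (Function.update (Function.update (Function.update (c.cell 0)
        .searching false) .walking true) .found true) .walker false)
    (Function.update (c.cell 1) .walker true)
    (by rw [hs, rule, hsearch]; simp) (by simp)]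
  refine ⟨⟨by simp [Running], fun i => ?_, fun i => ?_, fun i => ?_, ?_⟩, rfl, ?_,
    fun i hi => ?_, fun i hi => ?_⟩
  · exact (update₂_apply (by simp) (by simp) i).trans (hy i)
  · exact update₂_apply (by simp) (by simp) i
  · by_cases h : i = 0
    · subst h
      simp
    · by_cases h' : i = 1
      · subst h'
        simp [hsearch]
      · simp only [update₂_of_ne _ _ _ _ h h']
        rw [hsearch, decide_eq_false h]
  · simp
  · simp
  · obtain rfl : i = 0 := by omega
    simp
  · obtain rfl : i = 0 := by omega
    simp only [update₂_left]
    rw [Function.update_of_ne (by simp), Function.update_self]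
    symm
    rw [decide_eq_true_iff]
    exact ⟨by omega, h0, fun i' _ _ => by omega⟩

open Classical in
theorem exists_run_walk {y : CantorReal} (h0 : y 0 = true) {a : Ordinal.{0}}
    (hs : ((machine e code ans).run X a).state = .limit)
    (hy : ∀ i, ((machine e code ans).run X a).cell i .str = y i)
    (hsearch : ∀ i, ((machine e code ans).run X a).cell i .searching = decide (i = 0)) :
    ∃ l, a < l ∧ ((machine e code ans).run X l).state = .limit ∧
      WalkFrame y ((machine e code ans).run X a).cell ((machine e code ans).run X l) ∧
      (∀ i, ((machine e code ans).run X l).cell i .found =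
        decide (y i = true ∧ ∀ j, i < j → y j = false)) ∧
      ∀ d, a ≤ d → d ≤ l →
        Frozen y ((machine e code ans).run X a).cell ((machine e code ans).run X d) := by
  set M := machine e code ans
  set f := (M.run X a).cell
  obtain ⟨w, hw0, hw, hwalk⟩ := exists_strictMono_seq (a₀ := a + 1)
    (V := fun n b => WalkAt y f (n + 1) (M.run X b))
    (W := fun n b b' => ∀ d, b ≤ d → d < b' → Walking y f (n + 1) (M.run X d))
    (by rw [M.run_add_one]; exact walkAt_one e code ans X h0 hs hy hsearch)
    (by
      intro n b hb
      obtain ⟨c', h1, h2⟩ := iterVia_walk e code ans X h0 (by omega) hb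
      rw [← M.run_add_one] at h1
      obtain ⟨m, h3, h4⟩ := M.exists_run_of_iterVia X h1
      refine ⟨b + 1 + m, ?_, by rwa [h3], fun d hd hd' => ?_⟩
      · exact (lt_add_one b).trans_le (le_add_of_nonneg_right zero_le)
      · rcases hd.eq_or_lt with rfl | hlt
        · exact hb.walking
        · exact h4 d (Order.add_one_le_of_lt hlt) hd')
  obtain ⟨l, hl, hwl, hcover⟩ := Ordinal.exists_limit_of_strictMono w hw
  have hframe : ∀ d, w 0 ≤ d → d < l → WalkFrame y f (M.run X d) := by
    intro d h1 h2
    obtain ⟨n, -, h3, h4⟩ := hcover 0 d h1 h2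
    exact ((hwalk n).2 d h3 h4).1
  have hst : (M.run X l).state = .limit := M.run_limit_state X hl
  have hfl : WalkFrame y f (M.run X l) := by
    refine ⟨by simp [Running, hst], fun i => ?_, fun i => ?_, fun i => ?_, ?_⟩
    · exact M.run_limit_cell_of_eventually X hl (hwl 0) fun d h1 h2 => (hframe d h1 h2).str i
    · exact M.run_limit_cell_of_eventually X hl (hwl 0) fun d h1 h2 => (hframe d h1 h2).last i
    · exact M.run_limit_cell_of_eventually X hl (hwl 0) fun d h1 h2 => (hframe d h1 h2).searching i
    · exact M.run_limit_cell_of_eventually X hl (hwl 0) fun d h1 h2 => (hframe d h1 h2).walking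
  have haw : a < w 0 := by
    rw [hw0]
    exact lt_add_one a
  refine ⟨l, haw.trans (hwl 0), hst, hfl, fun i => ?_, fun d hd hd' => ?_⟩
  -- The mark at cell `i` settles: if there is a `1` at some `j` after `i`, it is absent once the
  -- walk has passed `j`; otherwise it no longer changes once the walk has passed `i`.
  · have hev : ∃ N ≥ i, ∀ n ≥ N, decide (IsLastBelow y (n + 1) i) =
        decide (y i = true ∧ ∀ j, i < j → y j = false) := by
      by_cases h : ∃ j, i < j ∧ y j = true
      · obtain ⟨j, hij, hj⟩ := h
        refine ⟨j, hij.le, fun n hn => ?_⟩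
        rw [decide_eq_decide]
        constructor
        · rintro ⟨-, -, h⟩
          rw [h j hij (by omega)] at hj
          simp at hj
        · rintro ⟨-, h⟩
          rw [h j hij] at hj
          simp at hj
      · push Not at h
        refine ⟨i, le_rfl, fun n hn => ?_⟩
        rw [decide_eq_decide]
        constructor
        · rintro ⟨-, h1, -⟩
          exact ⟨h1, fun j hj => by simpa using h j hj⟩
        · rintro ⟨h1, h2⟩
          exact ⟨by omega, h1, fun j hj _ => h2 j hj⟩
    obtain ⟨N, hN, hev⟩ := hev
    refine M.run_limit_cell_of_eventually X hl (hwl N) fun d h1 h2 => ?_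
    obtain ⟨n, hn, h3, h4⟩ := hcover N d h1 h2
    rcases ((hwalk n).2 d h3 h4).2 i (by omega) with h | h
    · rw [h, hev n hn]
    · rw [h, hev (n + 1) (by omega)]
  · rcases hd'.eq_or_lt with rfl | hlt
    · exact hfl.frozen
    · by_cases h : w 0 ≤ d
      · exact (hframe d h hlt).frozen
      · have : d = a := by
          rw [hw0, not_le, Order.lt_add_one_iff] at h
          exact le_antisymm h hd
        subst this
        exact ⟨by simp [Running, hs], hy, fun _ => rfl, fun i hi =>
          (hsearch i).trans (decide_eq_false hi.ne')⟩

/-- The machine resumes the search at the last `1` of the string. -/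
theorem exists_run_resume {y : CantorReal} (h0 : y 0 = true) {a : Ordinal.{0}} {p : ℕ}
    (hs : ((machine e code ans).run X a).state = .limit)
    (hy : ∀ i, ((machine e code ans).run X a).cell i .str = y i)
    (hsearch : ∀ i, ((machine e code ans).run X a).cell i .searching = decide (i = 0))
    (hp : y p = true) (hp' : ∀ j, p < j → y j = false) :
    ∃ b, a < b ∧ ((machine e code ans).run X b).state = .prune ∧
      (∀ i, ((machine e code ans).run X b).cell i .str = y i) ∧
      ((machine e code ans).run X b).cell p .last = true ∧
      (∀ i, ((machine e code ans).run X b).cell i .searching = decide (i = 0)) ∧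
      ∀ d, a ≤ d → d ≤ b → Running ((machine e code ans).run X d) ∧
        (∀ i, ((machine e code ans).run X d).cell i .str = y i) ∧
        (∀ i, i ≠ p → ((machine e code ans).run X d).cell i .last =
          ((machine e code ans).run X a).cell i .last) ∧
        ∀ i, 0 < i → ((machine e code ans).run X d).cell i .searching = false := by
  classical
  obtain ⟨l, hal, hst, hfl, hfound, hfro⟩ := exists_run_walk e code ans X h0 hs hy hsearch
  set M := machine e code ans
  set f := (M.run X a).cell
  -- With `searching` off and `walking` on, this limit is recognized as the end of a walk.
  have s1 := step_machine e code ans X (c := M.run X l) 0 .look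
    (Function.update ((M.run X l).cell 0) .walking false) ((M.run X l).cell 1)
    (by rw [hst, rule, hfl.searching, hfl.walking]; simp) (by simp)
  set c₁ : Conf Track State := ⟨.look, Function.update (Function.update (M.run X l).cell 0
    (Function.update ((M.run X l).cell 0) .walking false)) (0 + 1) ((M.run X l).cell 1)⟩ with hc₁
  have t1 : ∀ t, t ≠ .walking → ∀ i, c₁.cell i t = (M.run X l).cell i t := fun t ht i =>
    update₂_apply (by simp [ht]) rfl i
  have s2 := step_machine e code ans X (c := c₁) p .resume
    (Function.update (c₁.cell p) .last true) (c₁.cell (p + 1))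
    (by
      have : c₁.cell p .found = true := by
        rw [t1 _ (by simp), hfound, decide_eq_true_iff]
        exact ⟨hp, hp'⟩
      have hst₁ : c₁.state = .look := rfl
      rw [hst₁, rule, if_pos this])
    (fun i hi => by
      have : c₁.cell i .found = false := by
        rw [t1 _ (by simp), hfound, decide_eq_false_iff_not]
        rintro ⟨-, h⟩
        simp [h p hi] at hp
      have hst₁ : c₁.state = .look := rfl
      rw [hst₁, rule, this]
      simp)
  set c₂ : Conf Track State := ⟨.resume, Function.update (Function.update c₁.cell p
    (Function.update (c₁.cell p) .last true)) (p + 1) (c₁.cell (p + 1))⟩ with hc₂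
  have t2 : ∀ t, t ≠ .last → ∀ i, c₂.cell i t = c₁.cell i t := fun t ht i =>
    update₂_apply (by simp [ht]) rfl i
  have t2p : c₂.cell p .last = true := by
    simp only [hc₂, update₂_left, Function.update_self]
  have t2n : ∀ i, i ≠ p → c₂.cell i .last = c₁.cell i .last := by
    intro i hi
    by_cases h : i = p + 1
    · subst h
      simp only [hc₂, update₂_right]
    · simp only [hc₂, update₂_of_ne _ _ _ _ hi h]
  have s3 := step_machine e code ans X (c := c₂) 0 .prune
    (Function.update (c₂.cell 0) .searching true) (c₂.cell 1) rfl (by simp)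
  set c₃ : Conf Track State := ⟨.prune, Function.update (Function.update c₂.cell 0
    (Function.update (c₂.cell 0) .searching true)) (0 + 1) (c₂.cell 1)⟩ with hc₃
  have t3 : ∀ t, t ≠ .searching → ∀ i, c₃.cell i t = c₂.cell i t := fun t ht i =>
    update₂_apply (by simp [ht]) rfl i
  have r1 : M.run X (l + 1) = c₁ := by rw [M.run_add_one, s1]
  have r2 : M.run X (l + 1 + 1) = c₂ := by rw [M.run_add_one, r1, s2]
  have r3 : M.run X (l + 1 + 1 + 1) = c₃ := by rw [M.run_add_one, r2, s3]
  have hstr₁ : ∀ i, c₁.cell i .str = y i := fun i => by rw [t1 _ (by simp), hfl.str]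
  have hstr₂ : ∀ i, c₂.cell i .str = y i := fun i => by rw [t2 _ (by simp), hstr₁]
  have hstr₃ : ∀ i, c₃.cell i .str = y i := fun i => by rw [t3 _ (by simp), hstr₂]
  have hlast₁ : ∀ i, i ≠ p → c₁.cell i .last = f i .last := fun i _ => by
    rw [t1 _ (by simp), hfl.last]
  have hlast₂ : ∀ i, i ≠ p → c₂.cell i .last = f i .last := fun i hi => by
    rw [t2n i hi, hlast₁ i hi]
  have hlast₃ : ∀ i, i ≠ p → c₃.cell i .last = f i .last := fun i hi => by
    rw [t3 _ (by simp), hlast₂ i hi]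
  have hsea₁ : ∀ i, c₁.cell i .searching = false := fun i => by
    rw [t1 _ (by simp), hfl.searching]
  have hsea₂ : ∀ i, c₂.cell i .searching = false := fun i => by
    rw [t2 _ (by simp), hsea₁]
  have hsea₃ : ∀ i, c₃.cell i .searching = decide (i = 0) := by
    intro i
    by_cases h : i = 0
    · subst h
      simp [hc₃]
    · by_cases h' : i = 1
      · subst h'
        simp only [hc₃, update₂_right]
        rw [hsea₂]
        rfl
      · simp only [hc₃, update₂_of_ne _ _ _ _ h h']
        rw [hsea₂, decide_eq_false h]
  refine ⟨l + 1 + 1 + 1, hal.trans ((lt_add_one _).trans ((lt_add_one _).trans (lt_add_one _))),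
    by rw [r3], by rwa [r3], by rw [r3, t3 _ (by simp), t2p], by rwa [r3], fun d hd hd' => ?_⟩
  rcases hd'.eq_or_lt with rfl | h3
  · rw [r3]
    exact ⟨by simp [Running, hc₃], hstr₃, hlast₃, fun i hi => by
      rw [hsea₃, decide_eq_false hi.ne']⟩
  rw [Order.lt_add_one_iff] at h3
  rcases h3.eq_or_lt with rfl | h2
  · rw [r2]
    exact ⟨by simp [Running, hc₂], hstr₂, hlast₂, fun i _ => hsea₂ i⟩
  rw [Order.lt_add_one_iff] at h2
  rcases h2.eq_or_lt with rfl | h1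
  · rw [r1]
    exact ⟨by simp [Running, hc₁], hstr₁, hlast₁, fun i _ => hsea₁ i⟩
  rw [Order.lt_add_one_iff] at h1
  have := hfro d hd h1
  exact ⟨this.running, this.str, fun i _ => this.last i, this.searching⟩

/-- The machine accepts when the string has infinitely many `1`s. -/
theorem answers_of_frequently {y : CantorReal} (h0 : y 0 = true) {a : Ordinal.{0}}
    (hs : ((machine e code ans).run X a).state = .limit)
    (hy : ∀ i, ((machine e code ans).run X a).cell i .str = y i)
    (hsearch : ∀ i, ((machine e code ans).run X a).cell i .searching = decide (i = 0))
    (hinf : ∀ n, ∃ m, n < m ∧ y m = true)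
    (hrun : ∀ d < a, Running ((machine e code ans).run X d)) :
    (machine e code ans).Answers X ans := by
  classical
  obtain ⟨l, hal, hst, hfl, hfound, hfro⟩ := exists_run_walk e code ans X h0 hs hy hsearch
  set M := machine e code ans
  have s1 := step_machine e code ans X (c := M.run X l) 0 .look
    (Function.update ((M.run X l).cell 0) .walking false) ((M.run X l).cell 1)
    (by rw [hst, rule, hfl.searching, hfl.walking]; simp) (by simp)
  set c₁ : Conf Track State := ⟨.look, Function.update (Function.update (M.run X l).cell 0
    (Function.update ((M.run X l).cell 0) .walking false)) (0 + 1) ((M.run X l).cell 1)⟩ with hc₁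
  have t1 : ∀ t, t ≠ .walking → ∀ i, c₁.cell i t = (M.run X l).cell i t := fun t ht i =>
    update₂_apply (by simp [ht]) rfl i
  -- There is no last `1`, hence no mark and no applicable rule. The machine falls into the limit
  -- state with both flags off, which is the sign to accept.
  have s2 : M.step X c₁ = ⟨.limit, c₁.cell⟩ := by
    refine M.step_of_forall_none fun i => ?_
    have : c₁.cell i .found = false := by
      rw [t1 _ (by simp), hfound, decide_eq_false_iff_not]
      rintro ⟨-, h⟩
      obtain ⟨m, hm, hm'⟩ := hinf i
      simp [h m hm] at hm'
    change rule e code (X i) (c₁.cell i) (c₁.cell (i + 1)) .look = none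
    rw [rule, this]
    simp
  have s3 := step_machine e code ans X (c := ⟨.limit, c₁.cell⟩) 0 .accept (c₁.cell 0) (c₁.cell 1)
    (by
      have h1 : c₁.cell 0 .searching = false := by rw [t1 _ (by simp), hfl.searching]
      have h2 : c₁.cell 0 .walking = false := by
        simp only [hc₁, update₂_left, Function.update_self]
      simp only [rule, h1, h2]
      simp)
    (by simp)
  have r1 : M.run X (l + 1) = c₁ := by rw [M.run_add_one, s1]
  have r2 : M.run X (l + 1 + 1) = ⟨.limit, c₁.cell⟩ := by rw [M.run_add_one, r1, s2]
  have r3 : (M.run X (l + 1 + 1 + 1)).state = .accept := by rw [M.run_add_one, r2, s3]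
  have hans : ∀ c : Conf Track State, Running c → M.answer c.state = none := by
    rintro ⟨q, f⟩ ⟨h1, h2⟩
    cases q <;> first | rfl | exact absurd rfl h1 | exact absurd rfl h2
  refine ⟨l + 1 + 1 + 1, by rw [r3]; rfl, fun d hd => hans _ ?_⟩
  rw [Order.lt_add_one_iff] at hd
  rcases hd.eq_or_lt with rfl | hd
  · rw [r2]
    simp [Running]
  rw [Order.lt_add_one_iff] at hd
  rcases hd.eq_or_lt with rfl | hd
  · rw [r1]
    simp [Running, hc₁]
  rw [Order.lt_add_one_iff] at hd
  by_cases h : a ≤ d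
  · exact (hfro d h hd).running
  · exact hrun d (not_le.1 h)

end Search

end ITTM

/-! ## The search through finite sequences -/

namespace ITTM

namespace Search

open Turing Turing.PartrecToTM2 PairMachine

/-- The place of the last `1` of the string that represents a finite sequence of natural numbers.
The sequence is listed in reverse order. -/
def pos : List ℕ → ℕ
  | [] => 0
  | k :: s => pos s + k + 1

/-- The string that represents a finite sequence of natural numbers: the numbers are represented by
blocks of zeros, separated by ones. -/
def str : List ℕ → CantorReal
  | [] => fun n => decide (n = 0)
  | k :: s => Function.update (str s) (pos s + k + 1) true

theorem str_pos (s : List ℕ) : str s (pos s) = true := by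
  cases s <;> simp [str, pos]

theorem str_of_pos_lt {s : List ℕ} {j : ℕ} (h : pos s < j) : str s j = false := by
  induction s with
  | nil =>
    simp only [pos] at h
    exact decide_eq_false h.ne'
  | cons k s ih =>
    simp only [pos] at h
    rw [str, Function.update_of_ne (by omega), ih (by omega)]

theorem str_zero (s : List ℕ) : str s 0 = true := by
  induction s with
  | nil => simp [str]
  | cons k s ih => rw [str, Function.update_of_ne (by omega), ih]

theorem str_cons_of_ne {k j : ℕ} {s : List ℕ} (h : j ≠ pos s + k + 1) :
    str (k :: s) j = str s j := by
  rw [str, Function.update_of_ne h]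

theorem length_le_pos (s : List ℕ) : s.length ≤ pos s := by
  induction s with
  | nil => simp
  | cons k s ih =>
    simp only [List.length_cons, pos]
    omega

/-- The string on the tape represents the finite sequence `s`. -/
structure At (s : List ℕ) (c : Conf Track State) : Prop where
  str : ∀ i, c.cell i .str = str s i
  last : c.cell (pos s) .last = true
  -- Cells beyond `pos s` may carry marks as well; only the first one is used.
  last_lt : ∀ i < pos s, c.cell i .last = false
  searching : ∀ i, c.cell i .searching = decide (i = 0)

/-- The string on the tape extends the one that represents the finite sequence `s`. -/
structure Above (s : List ℕ) (c : Conf Track State) : Prop where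
  running : Running c
  str : ∀ i ≤ pos s, c.cell i .str = Search.str s i
  last : ∀ i < pos s, c.cell i .last = false
  searching : ∀ i, 0 < i → c.cell i .searching = false

theorem At.above {s : List ℕ} {c : Conf Track State} (h : At s c) (hr : Running c) : Above s c :=
  ⟨hr, fun i _ => h.str i, h.last_lt, fun i hi => by rw [h.searching, decide_eq_false hi.ne']⟩

/-- Whatever is done in the subtree of an extension leaves the part of the string that represents
`s` intact. -/
theorem Above.of_cons {k : ℕ} {s : List ℕ} {c : Conf Track State} (h : Above (k :: s) c) :
    Above s c := by
  refine ⟨h.running, fun i hi => ?_, fun i hi => h.last i (by rw [pos]; omega), h.searching⟩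
  rw [h.str i (by rw [pos]; omega), str_cons_of_ne (by omega)]

theorem At.keeps {s : List ℕ} {f : ℕ → Cell} {c c' : Conf Track State} (h : At s c)
    (hf : c.cell = f) (hc' : Keeps f c') : At s c' := by
  subst hf
  have key : ∀ t : Track, ¬ t.IsWork → ∀ i, c'.cell i t = c.cell i t := fun t ht i => hc'.2 i t ht
  exact ⟨fun i => by rw [key _ (by simp [Track.IsWork, Track.IsStack]), h.str],
    by rw [key _ (by simp [Track.IsWork, Track.IsStack]), h.last],
    fun i hi => by rw [key _ (by simp [Track.IsWork, Track.IsStack]), h.last_lt i hi],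
    fun i => by rw [key _ (by simp [Track.IsWork, Track.IsStack]), h.searching]⟩

variable {K : ℕ} (e : Track ≃ Fin K) (code : ToPartrec.Code) (ans : Bool) (X : ℕ → Cell)
  (ok : List ℕ → Bool)

/-- The code computes whether a finite sequence passes the test. -/
def Tests : Prop :=
  ∀ s, code.eval [number (digits e X (str s) (pos s + 1))] = pure [(ok s).toNat]

/-- `s'` is an extension by one number of `s`, which passes the test. -/
def Extends (s' s : List ℕ) : Prop :=
  ok s = true ∧ ∃ k, s' = k :: s

/-- The machine is about to test the finite sequence `s`. -/
def Visits (s : List ℕ) (c : Conf Track State) : Prop :=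
  c.state = .check ∧ At s c

/-- The machine has found that the finite sequence `s` can be left. -/
def Leaves (s : List ℕ) (c : Conf Track State) : Prop :=
  c.state = .prune ∧ At s c

theorem step_of_extend {s : List ℕ} {c : Conf Track State} (hs : c.state = .extend)
    (h : At s c) : Visits (0 :: s) ((machine e code ans).step X c) := by
  rw [step_machine e code ans X (pos s) .check (Function.update (c.cell (pos s)) .last false)
    (Function.update (Function.update (c.cell (pos s + 1)) .last true) .str true)
    (by rw [hs, rule, if_pos h.last]) (fun i hi => by rw [hs, rule, h.last_lt i hi]; simp)]
  refine ⟨rfl, fun i => ?_, ?_, fun i hi => ?_, fun i => ?_⟩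
  · by_cases h1 : i = pos s + 1
    · subst h1
      simp [str]
    · rw [str_cons_of_ne (by omega), ← h.str]
      by_cases h2 : i = pos s
      · subst h2
        simp
      · simp only [update₂_of_ne _ _ _ _ h2 h1]
  · simp [pos]
  · simp only [pos] at hi
    by_cases h2 : i = pos s
    · subst h2
      simp
    · simp only [update₂_of_ne _ _ _ _ h2 (by omega : i ≠ pos s + 1)]
      exact h.last_lt i (by omega)
  · exact (update₂_apply (by simp) (by simp) i).trans (h.searching i)

theorem step_of_leaves {k : ℕ} {s : List ℕ} {c : Conf Track State} (h : Leaves (k :: s) c) :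
    Visits ((k + 1) :: s) ((machine e code ans).step X c) := by
  obtain ⟨hs, h⟩ := h
  have hp : c.cell (pos (k :: s)) .searching = false := by
    rw [h.searching, decide_eq_false]
    simp [pos]
  rw [step_machine e code ans X (pos (k :: s)) .check
    (Function.update (Function.update (c.cell (pos (k :: s))) .last false) .str false)
    (Function.update (Function.update (c.cell (pos (k :: s) + 1)) .last true) .str true)
    (by rw [hs, rule, if_pos h.last, hp]; simp)
    (fun i hi => by rw [hs, rule, h.last_lt i hi]; simp)]
  refine ⟨rfl, fun i => ?_, ?_, fun i hi => ?_, fun i => ?_⟩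
  · by_cases h1 : i = pos (k :: s) + 1
    · subst h1
      simp only [Function.update_self]
      exact (str_pos ((k + 1) :: s)).symm
    · by_cases h2 : i = pos (k :: s)
      · subst h2
        simp only [update₂_left, Function.update_self]
        rw [str_cons_of_ne (by rw [pos]; omega), str_of_pos_lt (by rw [pos]; omega)]
      · simp only [update₂_of_ne _ _ _ _ h2 h1]
        rw [pos] at h1 h2
        rw [h.str, str_cons_of_ne (by omega), str_cons_of_ne (by omega)]
  · have : pos ((k + 1) :: s) = pos (k :: s) + 1 := by
      simp only [pos]
      omega
    rw [this]
    simp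
  · have : pos ((k + 1) :: s) = pos (k :: s) + 1 := by
      simp only [pos]
      omega
    rw [this] at hi
    by_cases h2 : i = pos (k :: s)
    · subst h2
      simp
    · simp only [update₂_of_ne _ _ _ _ h2 hi.ne]
      exact h.last_lt i (by omega)
  · exact (update₂_apply (by simp) (by simp) i).trans (h.searching i)

variable {X ok}

theorem exists_run_test (htest : Tests e code X ok) {s : List ℕ} {a : Ordinal.{0}}
    (h : Visits s ((machine e code ans).run X a)) :
    ∃ b, a ≤ b ∧ ((machine e code ans).run X b).state = (if ok s then .extend else .prune) ∧
      At s ((machine e code ans).run X b) ∧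
      ∀ d, a ≤ d → d ≤ b → Above s ((machine e code ans).run X d) := by
  set M := machine e code ans
  obtain ⟨hs, hat⟩ := h
  obtain ⟨c', h1, h2, h3⟩ := iterVia_test e code ans X (f := (M.run X a).cell) (M.run X a)
    ⟨by simp [hs], fun _ _ _ => rfl⟩ hs (p := pos s) hat.last hat.last_lt (v := ok s) (by
      have := htest s
      rwa [digits_congr e X (y := fun i => (M.run X a).cell i .str) fun i _ => hat.str i])
  obtain ⟨n, h4, h5⟩ := M.exists_run_of_iterVia X h1
  refine ⟨a + n, le_add_of_nonneg_right zero_le, by rw [h4, h3], by rw [h4]; exact hat.keeps rfl h2,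
    fun d hd hd' => ?_⟩
  rcases hd'.eq_or_lt with rfl | hlt
  · rw [h4]
    exact (hat.keeps rfl h2).above h2.1
  · exact (hat.keeps rfl (h5 d hd hlt)).above (h5 d hd hlt).1

theorem exists_run_child (htest : Tests e code X ok) {s : List ℕ} (hok : ok s = true)
    {a : Ordinal.{0}} (h : Visits s ((machine e code ans).run X a)) :
    ∃ b, a < b ∧ Visits (0 :: s) ((machine e code ans).run X b) ∧
      ∀ d, a ≤ d → d < b → Above s ((machine e code ans).run X d) := by
  obtain ⟨b, h1, h2, h3, h4⟩ := exists_run_test e code ans htest h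
  rw [hok, if_pos rfl] at h2
  refine ⟨b + 1, h1.trans_lt (lt_add_one b), ?_, fun d hd hd' => h4 d hd (Order.lt_add_one_iff.1 hd')⟩
  rw [PairMachine.run_add_one]
  exact step_of_extend e code ans X h2 h3

/-- Induction on accessibility: the extensions of a passing `s` are visited and left one after
another, and at the limit of these visits the string of `s` reappears, from which the machine
resumes. -/
theorem exists_run_leaves (htest : Tests e code X ok) {s : List ℕ} (hs : Acc (Extends ok) s) :
    ∀ a : Ordinal.{0}, Visits s ((machine e code ans).run X a) →
      ∃ b, a ≤ b ∧ Leaves s ((machine e code ans).run X b) ∧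
        ∀ d, a ≤ d → d ≤ b → Above s ((machine e code ans).run X d) := by
  induction hs with
  | intro s _ ih => ?_
  intro a ha
  cases hok : ok s with
  | false =>
    obtain ⟨b, h1, h2, h3, h4⟩ := exists_run_test e code ans htest ha
    rw [hok] at h2
    exact ⟨b, h1, ⟨by simpa using h2, h3⟩, h4⟩
  | true =>
    obtain ⟨b₀, hab, hb₀, habove⟩ := exists_run_child e code ans htest hok ha
    set M := machine e code ans with hM
    obtain ⟨w, hw0, hw, hvisit⟩ := exists_strictMono_seq (a₀ := b₀)
      (V := fun k b => Visits (k :: s) (M.run X b))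
      (W := fun k b b' => ∀ d, b ≤ d → d < b' → Above (k :: s) (M.run X d)) hb₀
      (by
        intro k b hb
        obtain ⟨b', h1, h2, h3⟩ := ih (k :: s) ⟨hok, k, rfl⟩ b hb
        refine ⟨b' + 1, h1.trans_lt (lt_add_one _), ?_, fun d hd hd' =>
          h3 d hd (Order.lt_add_one_iff.1 hd')⟩
        rw [PairMachine.run_add_one]
        exact step_of_leaves e code ans X h2)
    obtain ⟨l, hl, hwl, hcover⟩ := Ordinal.exists_limit_of_strictMono w hw
    have hall : ∀ d, b₀ ≤ d → d < l → Above s (M.run X d) := by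
      intro d h1 h2
      obtain ⟨k, -, h3, h4⟩ := hcover 0 d (by rwa [hw0]) h2
      exact ((hvisit k).2 d h3 h4).of_cons
    have hst : (M.run X l).state = .limit := M.run_limit_state X hl
    have hstr : ∀ i, (M.run X l).cell i .str = str s i := by
      intro i
      -- From the visit to `i :: s` on, every further `1` lies to the right of cell `i`.
      refine M.run_limit_cell_of_eventually X hl (hwl i) fun d h1 h2 => ?_
      obtain ⟨k, hk, h3, h4⟩ := hcover i d h1 h2
      rw [((hvisit k).2 d h3 h4).str i (by rw [pos]; omega), str_cons_of_ne (by omega)]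
    have hbl : b₀ < l := hw0 ▸ hwl 0
    have hlast : ∀ i < pos s, (M.run X l).cell i .last = false := fun i hi =>
      M.run_limit_cell_of_eventually X hl hbl fun d h1 h2 => (hall d h1 h2).last i hi
    have hsearch : ∀ i, (M.run X l).cell i .searching = decide (i = 0) := by
      intro i
      by_cases hi : i = 0
      · rw [decide_eq_true hi]
        -- The flag is off during walks inside the subtrees, but on at every visit of an extension,
        -- hence at unboundedly many stages.
        refine M.run_limit_cell_of_frequently X hl fun b hb => ?_
        by_cases hbw : w 0 ≤ b
        · obtain ⟨k, -, h1, h2⟩ := hcover 0 b hbw hb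
          refine ⟨w (k + 1), hwl _, h2.le, ?_⟩
          rw [(hvisit (k + 1)).1.2.searching, decide_eq_true hi]
        · refine ⟨w 0, hwl 0, (not_le.1 hbw).le, ?_⟩
          rw [(hvisit 0).1.2.searching, decide_eq_true hi]
      · rw [decide_eq_false hi]
        exact M.run_limit_cell_of_eventually X hl hbl fun d h1 h2 =>
          (hall d h1 h2).searching i (by omega)
    obtain ⟨b, h1, h2, h3, h4, h5, h6⟩ := exists_run_resume e code ans X (str_zero s) hst hstr
      hsearch (str_pos s) (fun j hj => str_of_pos_lt hj)
    have hfinal : ∀ d, l ≤ d → d ≤ b → Above s (M.run X d) := by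
      intro d hd hd'
      obtain ⟨g1, g2, g3, g4⟩ := h6 d hd hd'
      exact ⟨g1, fun i _ => g2 i, fun i hi => (g3 i hi.ne).trans (hlast i hi), g4⟩
    refine ⟨b, hab.le.trans (hbl.le.trans h1.le), ⟨h2, h3, h4, (hfinal b h1.le le_rfl).last, h5⟩,
      fun d hd hd' => ?_⟩
    by_cases hd1 : d < b₀
    · exact habove d hd hd1
    · by_cases hd2 : d < l
      · exact hall d (not_lt.1 hd1) hd2
      · exact hfinal d (not_lt.1 hd2) hd'

/-- The extension taken is the one by the least `k` that yields an inaccessible sequence; the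
smaller ones yield accessible sequences, which the search leaves. -/
theorem exists_run_child_of_not_acc (htest : Tests e code X ok) {s : List ℕ}
    (hs : ¬ Acc (Extends ok) s) {a : Ordinal.{0}} (ha : Visits s ((machine e code ans).run X a)) :
    ∃ k b, a < b ∧ ¬ Acc (Extends ok) (k :: s) ∧
      Visits (k :: s) ((machine e code ans).run X b) ∧
      ∀ d, a ≤ d → d < b → Above s ((machine e code ans).run X d) := by
  classical
  have hok : ok s = true := by
    by_contra h
    exact hs ⟨_, fun s' hs' => absurd hs'.1 h⟩
  have hex : ∃ k, ¬ Acc (Extends ok) (k :: s) := by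
    by_contra! h
    refine hs ⟨_, ?_⟩
    rintro s' ⟨-, k, rfl⟩
    exact h k
  have key : ∀ k ≤ Nat.find hex, ∃ b, a < b ∧ Visits (k :: s) ((machine e code ans).run X b) ∧
      ∀ d, a ≤ d → d < b → Above s ((machine e code ans).run X d) := by
    intro k
    induction k with
    | zero => exact fun _ => exists_run_child e code ans htest hok ha
    | succ k ih =>
      intro hk
      obtain ⟨b, h1, h2, h3⟩ := ih (by omega)
      have hacc : Acc (Extends ok) (k :: s) := not_not.1 (Nat.find_min hex (by omega))
      obtain ⟨b', g1, g2, g3⟩ := exists_run_leaves e code ans htest hacc b h2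
      refine ⟨b' + 1, h1.trans (g1.trans_lt (lt_add_one _)), ?_, fun d hd hd' => ?_⟩
      · rw [PairMachine.run_add_one]
        exact step_of_leaves e code ans X g2
      · by_cases h : d < b
        · exact h3 d hd h
        · exact (g3 d (not_lt.1 h) (Order.lt_add_one_iff.1 hd')).of_cons
  obtain ⟨b, h1, h2, h3⟩ := key _ le_rfl
  exact ⟨_, b, h1, Nat.find_spec hex, h2, h3⟩

theorem visits_one : Visits [] ((machine e code ans).run X 1) := by
  rw [← zero_add 1, PairMachine.run_add_one, PairMachine.run_zero]
  rw [step_machine e code ans X 0 .check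
    (fun t => t = .str ∨ t = .last ∨ t = .searching) (fun _ => false) rfl (by simp)]
  refine ⟨rfl, fun i => ?_, by simp [pos], by simp [pos], fun i => ?_⟩ <;>
  · rcases i with - | - | i <;> simp [str]

theorem running_zero : Running ((machine e code ans).run X 0) := by
  rw [PairMachine.run_zero]
  simp [Running, machine]

theorem answer_of_running {c : Conf Track State} (h : Running c) :
    (machine e code ans).answer c.state = none := by
  obtain ⟨q, f⟩ := c
  obtain ⟨h1, h2⟩ := h
  cases q <;> first | rfl | exact absurd rfl h1 | exact absurd rfl h2

theorem answers_of_acc (htest : Tests e code X ok) (h : Acc (Extends ok) []) :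
    (machine e code ans).Answers X (!ans) := by
  obtain ⟨b, h1, h2, h3⟩ := exists_run_leaves e code ans htest h 1 (visits_one e code ans)
  refine ⟨b + 1, ?_, fun d hd => answer_of_running e code ans ?_⟩
  · have hlast : ((machine e code ans).run X b).cell 0 .last = true := h2.2.last
    rw [PairMachine.run_add_one, step_machine e code ans X 0 .reject _ _
      (by rw [h2.1, rule, if_pos hlast, h2.2.searching]; rfl)
      (by simp)]
    rfl
  · by_cases hd1 : 1 ≤ d
    · exact (h3 d hd1 (Order.lt_add_one_iff.1 hd)).running
    · rw [not_le, Order.lt_one_iff] at hd1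
      rw [hd1]
      exact running_zero e code ans

/-- Along the path of inaccessible sequences the strings agree on ever longer initial segments.
Their limit has a `1` at `pos` of each sequence on the path, hence infinitely many. -/
theorem answers_of_not_acc (htest : Tests e code X ok) (h : ¬ Acc (Extends ok) []) :
    (machine e code ans).Answers X ans := by
  set M := machine e code ans
  let N := {p : List ℕ × Ordinal.{0} // ¬ Acc (Extends ok) p.1 ∧ Visits p.1 (M.run X p.2)}
  have hnext : ∀ p : N, ∃ p' : N, (∃ k, p'.1.1 = k :: p.1.1) ∧ p.1.2 < p'.1.2 ∧
      ∀ d, p.1.2 ≤ d → d < p'.1.2 → Above p.1.1 (M.run X d) := by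
    rintro ⟨⟨s, a⟩, hs, ha⟩
    obtain ⟨k, b, h1, h2, h3, h4⟩ := exists_run_child_of_not_acc e code ans htest hs ha
    exact ⟨⟨⟨k :: s, b⟩, h2, h3⟩, ⟨k, rfl⟩, h1, h4⟩
  choose g hg1 hg2 hg3 using hnext
  let q : ℕ → N := fun n => Nat.rec ⟨([], 1), h, visits_one e code ans⟩ (fun _ p => g p) n
  have hw : StrictMono fun n => (q n).1.2 := strictMono_nat_of_lt_succ fun n => hg2 (q n)
  obtain ⟨l, hl, hwl, hcover⟩ := Ordinal.exists_limit_of_strictMono _ hw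
  have hlen : ∀ n, (q n).1.1.length = n := by
    intro n
    induction n with
    | zero => rfl
    | succ n ih =>
      obtain ⟨k, hk⟩ := hg1 (q n)
      have : (q (n + 1)).1.1 = k :: (q n).1.1 := hk
      rw [this, List.length_cons, ih]
  have hpos : ∀ n, n ≤ pos (q n).1.1 := fun n => by
    have := length_le_pos (q n).1.1
    rwa [hlen] at this
  have hagree : ∀ n m, n ≤ m → ∀ j ≤ pos (q n).1.1, str (q m).1.1 j = str (q n).1.1 j := by
    intro n m hnm
    have hmono : Monotone fun n => pos (q n).1.1 := by
      refine monotone_nat_of_le_succ fun n => ?_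
      obtain ⟨k, hk⟩ := hg1 (q n)
      have : (q (n + 1)).1.1 = k :: (q n).1.1 := hk
      simp only [this, pos]
      omega
    induction m, hnm using Nat.le_induction with
    | base => exact fun _ _ => rfl
    | succ m hm ih =>
      intro j hj
      obtain ⟨k, hk⟩ := hg1 (q m)
      have : (q (m + 1)).1.1 = k :: (q m).1.1 := hk
      have : pos (q n).1.1 ≤ pos (q m).1.1 := hmono hm
      rw [‹(q (m + 1)).1.1 = k :: (q m).1.1›, str_cons_of_ne (by omega), ih j hj]
  have hstage : ∀ n d, (q n).1.2 ≤ d → d < l → ∃ m ≥ n, Above (q m).1.1 (M.run X d) := by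
    intro n d h1 h2
    obtain ⟨m, hm, h3, h4⟩ := hcover n d h1 h2
    exact ⟨m, hm, hg3 (q m) d h3 h4⟩
  have hone : ∀ d, 1 ≤ d → d < l → Running (M.run X d) ∧
      ∀ i, 0 < i → (M.run X d).cell i .searching = false := by
    intro d h1 h2
    obtain ⟨m, -, hm⟩ := hstage 0 d h1 h2
    exact ⟨hm.running, hm.searching⟩
  -- The `j`-th sequence of the path has length `j`, so its string is final at least up to cell `j`.
  refine answers_of_frequently e code ans X (y := fun j => str (q j).1.1 j) (a := l)
    (str_zero _) (M.run_limit_state X hl) (fun i => ?_) (fun i => ?_) (fun n => ?_)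
    (fun d hd => ?_)
  · refine M.run_limit_cell_of_eventually X hl (hwl i) fun d h1 h2 => ?_
    obtain ⟨m, hm, hab⟩ := hstage i d h1 h2
    rw [hab.str i (hm.le.trans (hpos m)), hagree i m hm i (hpos i)]
  · by_cases hi : i = 0
    · rw [decide_eq_true hi]
      refine M.run_limit_cell_of_frequently X hl fun b hb => ?_
      have hv : ∀ n, (M.run X (q n).1.2).cell i .searching = true := fun n => by
        rw [(q n).2.2.2.searching, decide_eq_true hi]
      by_cases hbw : (q 0).1.2 ≤ b
      · obtain ⟨k, -, h1, h2⟩ := hcover 0 b hbw hb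
        exact ⟨(q (k + 1)).1.2, hwl (k + 1), h2.le, hv (k + 1)⟩
      · exact ⟨(q 0).1.2, hwl 0, (not_le.1 hbw).le, hv 0⟩
    · rw [decide_eq_false hi]
      exact M.run_limit_cell_of_eventually X hl (hwl 0) fun d h1 h2 =>
        (hone d h1 h2).2 i (by omega)
  · refine ⟨pos (q (n + 1)).1.1, hpos (n + 1), ?_⟩
    rw [hagree (n + 1) _ (hpos (n + 1)) _ le_rfl, str_pos]
  · by_cases hd1 : 1 ≤ d
    · exact (hone d hd1 hd).1
    · rw [not_le, Order.lt_one_iff] at hd1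
      rw [hd1]
      exact running_zero e code ans

end Search

end ITTM

/-! ## A normal form for `Σ¹₁` sets -/

namespace SecondOrderArith

/-- The first `k + 1` values of a function. -/
def initial {α : Type} (g : ℕ → α) (k : ℕ) : List α := (List.range (k + 1)).map g

theorem length_initial {α : Type} (g : ℕ → α) (k : ℕ) : (initial g k).length = k + 1 := by
  simp [initial]

theorem map_initial {α β : Type} (h : α → β) (g : ℕ → α) (k : ℕ) :
    (initial g k).map h = initial (fun n => h (g n)) k := by
  simp [initial]

theorem getD_initial {α : Type} (g : ℕ → α) {i k : ℕ} (h : i ≤ k) (d : α) :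
    (initial g k).getD i d = g i := by
  rw [initial, List.getD_eq_getElem?_getD, List.getElem?_map,
    List.getElem?_range (Nat.lt_succ_of_le h)]
  rfl

theorem take_initial {α : Type} (g : ℕ → α) {i k : ℕ} (h : i ≤ k) :
    (initial g k).take (i + 1) = initial g i := by
  simp [initial, ← List.map_take, List.take_range, h]

/-- A predicate `P g a` is `Σ¹₁` in normal form if it says that there is a function `f` such that
all pairs of initial segments of `g` and `f` pass a primitive recursive test. -/
def HasNormalForm {α : Type} [Primcodable α] (P : (ℕ → ℕ) → α → Prop) : Prop :=
  ∃ b : List ℕ × List ℕ × α → Bool, Primrec b ∧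
    ∀ g a, P g a ↔ ∃ f : ℕ → ℕ, ∀ k, b (initial g k, initial f k, a) = true

namespace HasNormalForm

variable {α : Type} [Primcodable α]

open Primrec in
theorem of_primrec {p : α → Bool} (hp : Primrec p) :
    HasNormalForm fun (_ : ℕ → ℕ) (a : α) => p a = true :=
  ⟨fun c => p c.2.2, hp.comp (snd.comp snd), fun _ _ => ⟨fun h => ⟨id, fun _ => h⟩,
    fun ⟨_, h⟩ => h 0⟩⟩

open Primrec in
-- The test is vacuous until the segment of `g` is long enough to contain the value in question.
theorem of_value {p : ℕ → Bool} (hp : Primrec p) {t : α → ℕ} (ht : Primrec t) :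
    HasNormalForm fun (g : ℕ → ℕ) (a : α) => p (g (t a)) = true := by
  refine ⟨fun c => !decide (t c.2.2 < c.1.length) || p (c.1.getD (t c.2.2) 0), ?_,
    fun g a => ⟨fun h => ⟨id, fun k => ?_⟩, fun ⟨f, h⟩ => ?_⟩⟩
  · have ht' : Primrec fun c : List ℕ × List ℕ × α => t c.2.2 := ht.comp (snd.comp snd)
    exact Primrec.or.comp
      (Primrec.not.comp ((nat_lt.comp ht' (list_length.comp fst)).decide))
      (hp.comp ((list_getD 0).comp fst ht'))
  · by_cases hk : t a ≤ k
    · simp only [getD_initial g hk]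
      simp [show p (g (t a)) = true from h]
    · simp [length_initial, hk]
  · have := h (t a)
    simp only [getD_initial g le_rfl] at this
    simpa [length_initial] using this

open Primrec in
-- Two witnesses are merged into one by pairing their values.
theorem and {P P' : (ℕ → ℕ) → α → Prop} (h : HasNormalForm P) (h' : HasNormalForm P') :
    HasNormalForm fun g a => P g a ∧ P' g a := by
  obtain ⟨b, hb, h⟩ := h
  obtain ⟨b', hb', h'⟩ := h'
  refine ⟨fun c => b (c.1, c.2.1.map (fun n => n.unpair.1), c.2.2) &&
    b' (c.1, c.2.1.map (fun n => n.unpair.2), c.2.2), ?_, fun g a => ?_⟩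
  · refine Primrec.and.comp (hb.comp (fst.pair (Primrec.pair ?_ (snd.comp snd))))
      (hb'.comp (fst.pair (Primrec.pair ?_ (snd.comp snd))))
    · exact list_map (fst.comp snd) (fst.comp (unpair.comp snd)).to₂
    · exact list_map (fst.comp snd) (snd.comp (unpair.comp snd)).to₂
  · simp only [h, h', map_initial, Bool.and_eq_true]
    constructor
    · rintro ⟨⟨f, hf⟩, f', hf'⟩
      refine ⟨fun n => Nat.pair (f n) (f' n), fun k => ?_⟩
      simpa using ⟨hf k, hf' k⟩
    · rintro ⟨f, hf⟩
      exact ⟨⟨_, fun k => (hf k).1⟩, _, fun k => (hf k).2⟩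

open Primrec in
-- The number is stored in the first component of the witness at `0`, where every segment shows it.
theorem exists_nat {P : (ℕ → ℕ) → α × ℕ → Prop} (h : HasNormalForm P) :
    HasNormalForm fun g a => ∃ m, P g (a, m) := by
  obtain ⟨b, hb, h⟩ := h
  refine ⟨fun c => b (c.1, c.2.1.map (fun n => n.unpair.2), c.2.2, (c.2.1.getD 0 0).unpair.1), ?_,
    fun g a => ?_⟩
  · refine hb.comp (fst.pair (Primrec.pair ?_ ((snd.comp snd).pair ?_)))
    · exact list_map (fst.comp snd) (snd.comp (unpair.comp snd)).to₂
    · exact fst.comp (unpair.comp ((list_getD 0).comp (fst.comp snd) (.const 0)))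
  · simp only [h, map_initial, getD_initial _ (Nat.zero_le _)]
    constructor
    · rintro ⟨m, f, hf⟩
      exact ⟨fun n => Nat.pair m (f n), fun k => by simpa using hf k⟩
    · rintro ⟨f, hf⟩
      exact ⟨_, _, hf⟩

open Primrec in
-- A disjunction is an existential quantifier over a number that selects the side.
theorem or {P P' : (ℕ → ℕ) → α → Prop} (h : HasNormalForm P) (h' : HasNormalForm P') :
    HasNormalForm fun g a => P g a ∨ P' g a := by
  obtain ⟨b, hb, h⟩ := h
  obtain ⟨b', hb', h'⟩ := h'
  have : HasNormalForm fun g (c : α × ℕ) => if c.2 = 0 then P g c.1 else P' g c.1 := by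
    refine ⟨fun c => bif decide (c.2.2.2 = 0) then b (c.1, c.2.1, c.2.2.1) else
      b' (c.1, c.2.1, c.2.2.1), ?_, fun g a => ?_⟩
    · have hc : Primrec fun c : List ℕ × List ℕ × α × ℕ => (c.1, c.2.1, c.2.2.1) :=
        fst.pair ((fst.comp snd).pair (fst.comp (snd.comp snd)))
      exact Primrec.cond
        (Primrec.eq.comp (snd.comp (snd.comp snd)) (.const 0)).decide
        (hb.comp hc) (hb'.comp hc)
    · by_cases ha : a.2 = 0 <;> simp [ha, h, h']
  obtain ⟨b, hb, h⟩ := this.exists_nat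
  refine ⟨b, hb, fun g a => (Iff.trans ⟨?_, ?_⟩ (h g a))⟩
  · rintro (h | h)
    · exact ⟨0, by simpa using h⟩
    · exact ⟨1, by simpa using h⟩
  · rintro ⟨m, hm⟩
    by_cases hm0 : m = 0
    · exact .inl (by simpa [hm0] using hm)
    · exact .inr (by simpa [hm0] using hm)

open Primrec in
-- Witnesses are chosen for all numbers and stored as the rows of a single function. The `k`-th test
-- checks row `k.unpair.1` at level `k.unpair.2`; by monotonicity of pairing all the values that it
-- needs have index at most `k`.
theorem forall_nat {P : (ℕ → ℕ) → α × ℕ → Prop} (h : HasNormalForm P) :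
    HasNormalForm fun g a => ∀ m, P g (a, m) := by
  obtain ⟨b, hb, h⟩ := h
  let p : List ℕ × List ℕ × α → ℕ × ℕ := fun c => (c.1.length - 1).unpair
  have hp : Primrec p := unpair.comp (nat_sub.comp (list_length.comp fst) (.const 1))
  refine ⟨fun c => b (c.1.take ((p c).2 + 1),
    (List.range ((p c).2 + 1)).map (fun i => c.2.1.getD (Nat.pair (p c).1 i) 0), c.2.2, (p c).1),
    ?_, fun g a => ?_⟩
  · have h1 : Primrec fun c => (p c).2 + 1 := succ.comp (snd.comp hp)
    refine hb.comp ((list_take.comp h1 fst).pair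
      (Primrec.pair ?_ ((snd.comp snd).pair (fst.comp hp))))
    exact list_map (list_range.comp h1) ((list_getD 0).comp (fst.comp (snd.comp fst))
      (Primrec₂.natPair.comp (fst.comp (hp.comp fst)) snd)).to₂
  · have key : ∀ (f : ℕ → ℕ) k, b ((initial g k).take ((p (initial g k, initial f k, a)).2 + 1),
        (List.range ((p (initial g k, initial f k, a)).2 + 1)).map (fun i =>
          (initial f k).getD (Nat.pair (p (initial g k, initial f k, a)).1 i) 0), a,
          (p (initial g k, initial f k, a)).1) =
        b (initial g k.unpair.2, initial (fun n => f (Nat.pair k.unpair.1 n)) k.unpair.2, a,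
          k.unpair.1) := by
      intro f k
      have hpk : p (initial g k, initial f k, a) = k.unpair := by
        simp [p, length_initial]
      rw [hpk, take_initial g (Nat.unpair_right_le k)]
      congr 3
      refine List.map_congr_left fun i hi => getD_initial f ?_ 0
      rw [List.mem_range, Nat.lt_succ_iff] at hi
      conv_rhs => rw [← Nat.pair_unpair k]
      rcases hi.eq_or_lt with rfl | hi
      · rfl
      · exact (Nat.pair_lt_pair_right _ hi).le
    simp only [h]
    constructor
    · intro hf
      choose f hf using hf
      refine ⟨fun n => f n.unpair.1 n.unpair.2, fun k => ?_⟩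
      refine (key _ k).trans ?_
      simpa using hf k.unpair.1 k.unpair.2
    · rintro ⟨f, hf⟩ m
      refine ⟨fun n => f (Nat.pair m n), fun k => ?_⟩
      have := (key f (Nat.pair m k)).symm.trans (hf (Nat.pair m k))
      simpa using this

end HasNormalForm

/-- The sets of natural numbers that a function codes. -/
def setsOf (n : ℕ) (g : ℕ → ℕ) (k : Fin n) : CantorReal := fun m => g (Nat.pair k m) != 0

theorem exists_setsOf {n : ℕ} (S : Fin n → CantorReal) : ∃ g, setsOf n g = S := by
  refine ⟨fun p => if h : p.unpair.1 < n then (S ⟨_, h⟩ p.unpair.2).toNat else 0, ?_⟩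
  ext k m
  cases h : S k m <;> simp [setsOf, h]

open Primrec in
theorem Term.primrec_val {α : Type} [Primcodable α] {v : α → ℕ → ℕ} (hv : Primrec₂ v) (t : Term) :
    Primrec fun a => t.val (v a) := by
  induction t with
  | var i => exact hv.comp .id (.const i)
  | zero => exact .const 0
  | one => exact .const 1
  | add s t hs ht => exact nat_add.comp hs ht
  | mul s t hs ht => exact nat_mul.comp hs ht

open Primrec in
-- Normal forms are not closed under negation, so the induction treats each formula together with
-- its negation. The valuation depends on the parameter because a quantifier turns its number into a
-- further parameter.
theorem Formula.hasNormalForm {n : ℕ} (φ : Formula n) : ∀ {α : Type} [Primcodable α]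
    {v : α → ℕ → ℕ}, Primrec₂ v →
      HasNormalForm (fun g a => φ.Holds (setsOf n g) (v a)) ∧
      HasNormalForm (fun g a => ¬ φ.Holds (setsOf n g) (v a)) := by
  induction φ with
  | eq s t =>
    intro α _ v hv
    have := (Primrec.eq.comp (s.primrec_val hv) (t.primrec_val hv)).decide
    constructor
    · simpa [Formula.Holds] using HasNormalForm.of_primrec this
    · simpa [Formula.Holds] using HasNormalForm.of_primrec (Primrec.not.comp this)
  | lt s t =>
    intro α _ v hv
    have := (Primrec.nat_lt.comp (s.primrec_val hv) (t.primrec_val hv)).decide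
    constructor
    · simpa [Formula.Holds] using HasNormalForm.of_primrec this
    · simpa [Formula.Holds] using HasNormalForm.of_primrec (Primrec.not.comp this)
  | mem t k =>
    intro α _ v hv
    have h1 : Primrec fun a => Nat.pair k (t.val (v a)) :=
      Primrec₂.natPair.comp (.const _) (t.primrec_val hv)
    have h2 : Primrec fun m : ℕ => decide (m = 0) := (Primrec.eq.comp .id (.const 0)).decide
    constructor
    · simpa [Formula.Holds, setsOf] using HasNormalForm.of_value (Primrec.not.comp h2) h1
    · simpa [Formula.Holds, setsOf] using HasNormalForm.of_value h2 h1
  | neg φ ih =>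
    intro α _ v hv
    refine ⟨(ih hv).2, ?_⟩
    simpa [Formula.Holds] using (ih hv).1
  | and φ ψ ih ih' =>
    intro α _ v hv
    refine ⟨(ih hv).1.and (ih' hv).1, ?_⟩
    simpa only [Formula.Holds, not_and_or] using (ih hv).2.or (ih' hv).2
  | all i φ ih =>
    intro α _ v hv
    have hv' : Primrec₂ fun (c : α × ℕ) => Function.update (v c.1) i c.2 := by
      unfold Function.update
      simp only [eq_rec_constant, dite_eq_ite]
      exact Primrec.ite (Primrec.eq.comp snd (.const i)) (snd.comp fst)
        (hv.comp (fst.comp fst) snd)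
    refine ⟨(ih hv').1.forall_nat, ?_⟩
    simpa only [Formula.Holds, not_forall] using (ih hv').2.exists_nat

open Primrec in
/-- Membership in a `Σ¹₁` set says that there is a function all of whose initial segments, together
with those of the real in question, pass a primitive recursive test. -/
theorem IsSigma11.exists_primrec {A : Set CantorReal} (hA : IsSigma11 A) :
    ∃ b : List Bool × List ℕ → Bool, Primrec b ∧
      ∀ x, x ∈ A ↔ ∃ f : ℕ → ℕ, ∀ k, b (initial x k, initial f k) = true := by
  obtain ⟨n, φ, hφ⟩ := hA
  obtain ⟨b, hb, h⟩ := (φ.hasNormalForm (α := Unit) (v := fun _ _ => 0) (.const 0)).1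
  replace h : ∀ g, φ.Holds (setsOf (n + 1) g) (fun _ => 0) ↔ _ := fun g => h g ()
  let r : List Bool × List ℕ → ℕ := fun c => c.2.length - 1
  have hr : Primrec r := nat_sub.comp (list_length.comp snd) (.const 1)
  let c₁ : List Bool × List ℕ → Bool := fun c => decide ((r c).unpair.1 = 0)
  let c₂ : List Bool × List ℕ → Bool := fun c => c.1.getD (r c).unpair.2 false
  let c₃ : List Bool × List ℕ → Bool := fun c => decide ((c.2.getD (r c) 0).unpair.1 = 0)
  have hc₁ : Primrec c₁ := (Primrec.eq.comp (fst.comp (unpair.comp hr)) (.const 0)).decide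
  have hc₂ : Primrec c₂ := (list_getD false).comp fst (snd.comp (unpair.comp hr))
  have hc₃ : Primrec c₃ := (Primrec.eq.comp (fst.comp (unpair.comp ((list_getD 0).comp snd hr)))
    (.const 0)).decide
  -- A witness now pairs a function coding all the sets with a witness for the formula. The extra
  -- clause ensures that the first of the coded sets is `x`: if `k` is the pair of `0` and `m`, the
  -- value coded at `k` is compared with `x m`.
  refine ⟨fun c => b (c.2.map (fun n => n.unpair.1), c.2.map (fun n => n.unpair.2), ()) &&
    (!c₁ c || xor (c₂ c) (c₃ c)), ?_, fun x => ?_⟩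
  · refine Primrec.and.comp (hb.comp (Primrec.pair ?_ (Primrec.pair ?_ (.const ())))) ?_
    · exact list_map snd (fst.comp (unpair.comp snd)).to₂
    · exact list_map snd (snd.comp (unpair.comp snd)).to₂
    · exact Primrec.or.comp (Primrec.not.comp hc₁) ((Primrec.dom_bool₂ xor).comp hc₂ hc₃)
  · have hx : ∀ (f : ℕ → ℕ) k, (!c₁ (initial x k, initial f k) ||
        xor (c₂ (initial x k, initial f k)) (c₃ (initial x k, initial f k))) = true ↔
        (k.unpair.1 = 0 → x k.unpair.2 = ((f k).unpair.1 != 0)) := by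
      intro f k
      have hrk : r (initial x k, initial f k) = k := by simp [r, length_initial]
      simp only [c₁, c₂, c₃, hrk, getD_initial _ le_rfl, getD_initial x (Nat.unpair_right_le k)]
      by_cases h1 : k.unpair.1 = 0 <;> by_cases h2 : (f k).unpair.1 = 0 <;>
        cases x k.unpair.2 <;> simp [h1, h2]
    simp only [hφ, map_initial, Bool.and_eq_true, hx]
    constructor
    · rintro ⟨Y, hY⟩
      obtain ⟨g, hg⟩ := exists_setsOf (Fin.cons x Y : Fin (n + 1) → CantorReal)
      rw [← hg, h g] at hY
      obtain ⟨f, hf⟩ := hY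
      refine ⟨fun n => Nat.pair (g n) (f n), fun k => ⟨by simpa using hf k, fun hk => ?_⟩⟩
      have := congrFun (congrFun hg 0) k.unpair.2
      simp only [setsOf, Fin.cons_zero] at this
      rw [← this, Nat.unpair_pair, Fin.val_zero, ← hk, Nat.pair_unpair]
    · rintro ⟨f, hf⟩
      refine ⟨Fin.tail (setsOf (n + 1) fun n => (f n).unpair.1), ?_⟩
      have h0 : setsOf (n + 1) (fun n => (f n).unpair.1) 0 = x := by
        ext m
        have := (hf (Nat.pair 0 m)).2 (by simp)
        rw [Nat.unpair_pair] at this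
        exact this.symm
      have := (h (fun n => (f n).unpair.1)).2 ⟨_, fun k => (hf k).1⟩
      rwa [← Fin.cons_self_tail (setsOf (n + 1) _), h0] at this

end SecondOrderArith

/-! ## Primitive recursive tests -/

namespace ITTM

namespace Search

open Turing Turing.PartrecToTM2

/-- Move the last binary digit of a number to the front of a list, unless the number is `1`. -/
def shift (c : ℕ × List Bool) : ℕ × List Bool :=
  if c.1 ≤ 1 then c else (c.1 / 2, decide (c.1 % 2 = 1) :: c.2)

/-- The binary digits of a number after the leading one. -/
def bits (n : ℕ) : List Bool := (shift^[n] (n, [])).2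

theorem number_concat (w : List Bool) (b : Bool) :
    number (w ++ [b]) = 2 * number w + b.toNat := by
  simp [number]

theorem length_lt_number (w : List Bool) : w.length < number w := by
  induction w using List.reverseRecOn with
  | nil => simp [number]
  | append_singleton w b ih =>
    rw [number_concat, List.length_append, List.length_singleton]
    omega

theorem iterate_shift (w l : List Bool) : shift^[w.length] (number w, l) = (1, w ++ l) := by
  induction w using List.reverseRecOn generalizing l with
  | nil => rfl
  | append_singleton w b ih =>
    have hs : shift (number (w ++ [b]), l) = (number w, b :: l) := by
      have := number_ne_zero w
      rw [number_concat, shift, if_neg (by simp only; omega)]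
      cases b
      · simp
      · simp
        omega
    rw [List.length_append, List.length_singleton, Function.iterate_succ_apply, hs, ih]
    simp

/-- There are fewer digits than iterations, and the superfluous ones do nothing, since `shift` stops
at the leading `1`. -/
theorem bits_number (w : List Bool) : bits (number w) = w := by
  have h : number w = (number w - w.length) + w.length := by
    have := length_lt_number w
    omega
  have h1 : ∀ n, shift^[n] (1, w) = (1, w) := fun n => Function.iterate_fixed (by simp [shift]) n
  rw [bits]
  conv_lhs => rw [h, Function.iterate_add_apply, ← h]
  rw [iterate_shift, List.append_nil, h1]

open Primrec in
theorem primrec_bits : Primrec bits := by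
  have hs : Primrec shift := by
    refine Primrec.ite (nat_le.comp fst (.const 1)) .id
      ((nat_div.comp fst (.const 2)).pair (list_cons.comp ?_ snd))
    exact (Primrec.eq.comp (nat_mod.comp fst (.const 2)) (.const 1)).decide
  exact snd.comp (nat_iterate .id (Primrec.id.pair (.const [])) (hs.comp snd).to₂)

/-- Read one more digit of a string that represents a finite sequence: count the zeros, and store
their number at each one. -/
def countGap (c : ℕ × List ℕ) (b : Bool) : ℕ × List ℕ :=
  bif b then (0, c.1 :: c.2) else (c.1 + 1, c.2)

/-- The finite sequence that a string represents. -/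
def gaps (u : List Bool) : List ℕ := (u.foldl countGap (0, [])).2.reverse.tail

/-- The additional entry `0` comes from the `1` at cell `0`; `gaps` drops it after reversing the
list. -/
theorem foldl_countGap_str (s : List ℕ) :
    ((List.range (pos s + 1)).map (str s)).foldl countGap (0, []) = (0, s ++ [0]) := by
  induction s with
  | nil => rfl
  | cons k s ih =>
    have h : ∀ j ≤ k, ((List.range (pos s + 1 + j)).map (str (k :: s))).foldl countGap (0, []) =
        (j, s ++ [0]) := by
      intro j hj
      induction j with
      | zero =>
        rw [add_zero, ← ih]
        refine congrArg _ (List.map_congr_left fun i hi => str_cons_of_ne ?_)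
        rw [List.mem_range] at hi
        omega
      | succ j ihj =>
        rw [← add_assoc, List.range_succ, List.map_append, List.foldl_append, ihj (by omega),
          List.map_singleton, str_cons_of_ne (by omega), str_of_pos_lt (by omega)]
        rfl
    have hp : pos s + 1 + k = pos (k :: s) := by
      rw [pos]
      omega
    rw [List.range_succ, List.map_append, List.foldl_append, ← hp, h k le_rfl, List.map_singleton,
      hp, str_pos]
    rfl

theorem gaps_str (s : List ℕ) : gaps ((List.range (pos s + 1)).map (str s)) = s.reverse := by
  simp [gaps, foldl_countGap_str]

open Primrec in
theorem primrec_gaps : Primrec gaps := by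
  have hc : Primrec₂ countGap :=
    Primrec.cond snd ((Primrec.const 0).pair (list_cons.comp (fst.comp fst) (snd.comp fst)))
      ((succ.comp (fst.comp fst)).pair (snd.comp fst))
  refine list_tail.comp (list_reverse.comp (snd.comp ?_))
  exact list_foldl .id (.const (0, [])) (hc.comp (fst.comp snd) (snd.comp snd)).to₂

section digits

variable {K : ℕ} (e : Track ≃ Fin K) (X : ℕ → Cell) (y : CantorReal)

theorem length_digits (n : ℕ) : (digits e X y n).length = n * (K + 1) := by
  induction n with
  | zero => simp [digits]
  | succ n ih => simp [digits_succ, ih, blockDigits, add_mul]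

theorem getD_digits {n i t : ℕ} (hi : i < n) (ht : t < K + 1) :
    (digits e X y n).getD (i * (K + 1) + t) false = (blockDigits e (X i) (y i)).getD t false := by
  induction n with
  | zero => omega
  | succ n ih =>
    rw [digits_succ]
    rcases (Nat.lt_succ_iff.1 hi).eq_or_lt with rfl | hi
    · rw [List.getD_append_right _ _ _ _ (by rw [length_digits]; omega), length_digits,
        Nat.add_sub_cancel_left]
    · rw [List.getD_append _ _ _ _ ?_, ih hi]
      rw [length_digits]
      calc i * (K + 1) + t < (i + 1) * (K + 1) := by rw [add_mul]; omega
        _ ≤ n * (K + 1) := Nat.mul_le_mul_right _ hi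

/-- Each block of `K` input bits is followed by one bit of the string, whence the period `K + 1`. -/
theorem getD_digits_inputBlocks (x : CantorReal) {n m : ℕ} (hm : m < n * K) :
    (digits e (PairMachine.inputBlocks e x) y n).getD (m / K * (K + 1) + m % K) false = x m := by
  have hK : 0 < K := Nat.pos_of_ne_zero fun h => by simp [h] at hm
  have ht : m % K < K := Nat.mod_lt _ hK
  rw [getD_digits e _ y ((Nat.div_lt_iff_lt_mul hK).2 hm) (by omega), blockDigits,
    List.getD_append _ _ _ _ (by simpa using ht), List.getD_eq_getElem _ _ (by simpa using ht)]
  simp [PairMachine.inputBlocks, Nat.div_add_mod']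

theorem getD_digits_last {n i : ℕ} (hi : i < n) :
    (digits e X y n).getD (i * (K + 1) + K) false = y i := by
  rw [getD_digits e _ y hi (by omega), blockDigits, List.getD_append_right _ _ _ _ (by simp)]
  simp

end digits

/-- A finite sequence, in reverse order, passes the test `b` along with a string of the same
length. -/
def passes (b : List Bool × List ℕ → Bool) (x : CantorReal) (s : List ℕ) : Bool :=
  -- The empty sequence always passes, since the segments `initial f k` start with length `1`.
  decide (s.length = 0) || b ((List.range s.length).map x, s.reverse)

open Primrec in
/-- A primitive recursive test of finite sequences is computed by some code. -/
theorem exists_code_tests {K : ℕ} [NeZero K] (e : Track ≃ Fin K) {b : List Bool × List ℕ → Bool}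
    (hb : Primrec b) :
    ∃ code, ∀ x, Tests e code (PairMachine.inputBlocks e x) (passes b x) := by
  let r : ℕ → List ℕ := fun N => gaps ((List.range ((bits N).length / (K + 1))).map fun i =>
    (bits N).getD (i * (K + 1) + K) false)
  let f : ℕ → ℕ := fun N => bif decide ((r N).length = 0) || b ((List.range (r N).length).map
    (fun n => (bits N).getD (n / K * (K + 1) + n % K) false), r N) then 1 else 0
  have hr : Primrec r := by
    refine primrec_gaps.comp (list_map (list_range.comp
      (nat_div.comp (list_length.comp primrec_bits) (.const _))) ?_)
    exact ((list_getD false).comp (primrec_bits.comp fst)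
      (nat_add.comp (nat_mul.comp snd (.const _)) (.const _))).to₂
  have hf : Primrec f := by
    have hl : Primrec fun N => (r N).length := list_length.comp hr
    refine Primrec.cond (Primrec.or.comp (Primrec.eq.comp hl (.const 0)).decide
      (hb.comp (Primrec.pair (list_map (list_range.comp hl) ?_) hr))) (.const 1) (.const 0)
    exact ((list_getD false).comp (primrec_bits.comp fst) (nat_add.comp
      (nat_mul.comp (nat_div.comp snd (.const K)) (.const _)) (nat_mod.comp snd (.const K)))).to₂
  obtain ⟨code, hcode⟩ := ToPartrec.Code.exists_code
    (Nat.Partrec'.part_iff₁.2 (hf.to_comp.partrec : Partrec fun N => (f N : Part ℕ)))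
  refine ⟨code, fun x s => ?_⟩
  have h := hcode ⟨[number (digits e (PairMachine.inputBlocks e x) (str s) (pos s + 1))], rfl⟩
  refine h.trans ?_
  have hrs : r (number (digits e (PairMachine.inputBlocks e x) (str s) (pos s + 1))) =
      s.reverse := by
    simp only [r, bits_number, length_digits]
    rw [Nat.mul_div_cancel _ (Nat.succ_pos K), ← gaps_str]
    refine congrArg _ (List.map_congr_left fun i hi => getD_digits_last _ _ _ ?_)
    exact List.mem_range.1 hi
  -- A sequence takes up more cells than its length, and each cell comes with at least one input
  -- bit, so enough of `x` has been read.
  have hx : (List.range s.length).map (fun n =>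
      (digits e (PairMachine.inputBlocks e x) (str s) (pos s + 1)).getD
        (n / K * (K + 1) + n % K) false) = (List.range s.length).map x := by
    refine List.map_congr_left fun n hn => getD_digits_inputBlocks _ _ _ ?_
    have h1 := length_le_pos s
    have h2 : pos s + 1 ≤ (pos s + 1) * K := Nat.le_mul_of_pos_right _ (NeZero.pos K)
    have h3 := List.mem_range.1 hn
    omega
  have hfs : f (number (digits e (PairMachine.inputBlocks e x) (str s) (pos s + 1))) =
      (passes b x s).toNat := by
    simp only [f, hrs, List.length_reverse, bits_number, hx, passes]
    rfl
  change pure <$> Part.some (f (number _)) = _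
  rw [hfs]
  rfl

/-- An inaccessible sequence passes and has an inaccessible extension, which yields a branch by
choice. Conversely, by induction on accessibility no accessible sequence lies on a branch. -/
theorem not_acc_extends_iff {ok : List ℕ → Bool} :
    ¬ Acc (Extends ok) [] ↔ ∃ f : ℕ → ℕ, ∀ n, ok ((List.range n).map f).reverse = true := by
  constructor
  · intro h
    have hnext : ∀ s, ¬ Acc (Extends ok) s → ok s = true ∧ ∃ k, ¬ Acc (Extends ok) (k :: s) := by
      intro s hs
      by_contra! hne
      refine hs ⟨s, ?_⟩
      rintro _ ⟨h1, k, rfl⟩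
      exact hne h1 k
    choose g hg using fun s : {s // ¬ Acc (Extends ok) s} => (hnext s.1 s.2).2
    let q : ℕ → {s // ¬ Acc (Extends ok) s} := fun n =>
      Nat.rec ⟨[], h⟩ (fun _ s => ⟨g s :: s.1, hg s⟩) n
    have hq : ∀ n, ((List.range n).map fun n => g (q n)).reverse = (q n).1 := by
      intro n
      induction n with
      | zero => rfl
      | succ n ih =>
        rw [List.range_succ, List.map_append, List.reverse_append, ih]
        rfl
    exact ⟨fun n => g (q n), fun n => by rw [hq]; exact (hnext _ (q n).2).1⟩
  · rintro ⟨f, hf⟩ h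
    have key : ∀ s, Acc (Extends ok) s → ∀ n, s ≠ ((List.range n).map f).reverse := by
      intro s hs
      induction hs with
      | intro s _ ih =>
        rintro n rfl
        exact ih (f n :: ((List.range n).map f).reverse) ⟨hf n, f n, rfl⟩ (n + 1)
          (by simp [List.range_succ])
    exact key [] h 0 rfl

end Search

open Search SecondOrderArith in
/-- `Σ¹₁` sets and their complements are decided by a search through the finite sequences. -/
theorem infiniteTimeDecidable_of_isSigma11 {A : Set CantorReal} (hA : IsSigma11 A) :
    InfiniteTimeDecidable A ∧ InfiniteTimeDecidable Aᶜ := by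
  classical
  obtain ⟨b, hb, hA⟩ := hA.exists_primrec
  let e : Track ≃ Fin (Nat.card Track) := Finite.equivFin Track
  have : NeZero (Nat.card Track) := ⟨Nat.card_pos.ne'⟩
  obtain ⟨code, hcode⟩ := exists_code_tests e hb
  have hAcc : ∀ x, x ∈ A ↔ ¬ Acc (Extends (passes b x)) [] := by
    intro x
    rw [hA, not_acc_extends_iff]
    refine exists_congr fun f => ⟨fun h n => ?_, fun h k => ?_⟩
    · cases n with
      | zero => rfl
      | succ k =>
        have := h k
        simp only [SecondOrderArith.initial] at this
        simp [passes, this]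
    · simpa [passes, SecondOrderArith.initial] using h (k + 1)
  have : Finite (states (Nat.card Track) code) := finite_states _ code
  -- The answer given when there is a branch is left open: `true` serves for the set and `false` for
  -- its complement.
  have key : ∀ ans, ∃ p : Program, ∀ x,
      p.Outputs x (natToReal (cond (decide (x ∈ A) == ans) 1 0)) := by
    intro ans
    refine ⟨((machine e code ans).restrict (states _ code) trivial trivial
      (rule_mem e code ans)).compile e, fun x => ?_⟩
    refine PairMachine.outputs_of_answers _ _ _ (PairMachine.answers_restrict _ _ _ _ ?_)
    by_cases hx : x ∈ A
    · have := answers_of_not_acc e code ans (hcode x) ((hAcc x).1 hx)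
      simpa [hx] using this
    · have := answers_of_acc e code ans (hcode x) (not_not.1 (mt (hAcc x).2 hx))
      simpa [hx] using this
  constructor
  · obtain ⟨p, hp⟩ := key true
    refine infiniteTimeDecidable_of_outputs p fun x => ?_
    have := hp x
    by_cases hx : x ∈ A <;> simpa [charFun, hx] using this
  · obtain ⟨p, hp⟩ := key false
    refine infiniteTimeDecidable_of_outputs p fun x => ?_
    have := hp x
    by_cases hx : x ∈ A <;> simpa [charFun, hx] using this

end ITTM

/-! ## Well-orders -/

namespace SecondOrderArith

theorem IsPi11.compl {A : Set CantorReal} (hA : IsPi11 A) : IsSigma11 Aᶜ := by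
  obtain ⟨n, φ, h⟩ := hA
  exact ⟨n, φ.neg, fun x => by simp [h, Formula.Holds]⟩

namespace Formula

variable {n : ℕ}

/-- Disjunction. -/
def or (φ ψ : Formula n) : Formula n := neg (and (neg φ) (neg ψ))

/-- The existential quantifier. -/
def ex (i : ℕ) (φ : Formula n) : Formula n := neg (all i (neg φ))

@[simp]
theorem holds_or (S : Fin n → CantorReal) (φ ψ : Formula n) (v : ℕ → ℕ) :
    (φ.or ψ).Holds S v ↔ φ.Holds S v ∨ ψ.Holds S v := by
  simp only [or, Holds]
  tauto

@[simp]
theorem holds_ex (S : Fin n → CantorReal) (i : ℕ) (φ : Formula n) (v : ℕ → ℕ) :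
    (φ.ex i).Holds S v ↔ ∃ m, φ.Holds S (Function.update v i m) := by
  simp [ex, Holds]

/-- The first set variable codes a relation that holds between the variables `i` and `j`. -/
def rel (i j : ℕ) : Formula (n + 1) :=
  -- The two cases are those in the definition of `Nat.pair`: `j * j + i` if `i < j`, and `i * i + i
  -- + j` otherwise.
  or (and (lt (.var i) (.var j)) (mem (.add (.mul (.var j) (.var j)) (.var i)) 0))
    (and (neg (lt (.var i) (.var j)))
      (mem (.add (.add (.mul (.var i) (.var i)) (.var i)) (.var j)) 0))

@[simp]
theorem holds_rel (S : Fin (n + 1) → CantorReal) (i j : ℕ) (v : ℕ → ℕ) :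
    (rel i j).Holds S v ↔ codedRel (S 0) (v i) (v j) := by
  simp only [rel, holds_or, Holds, Term.val, codedRel, Nat.pair]
  split_ifs with h <;> simp [h]

/-- The variable `i` is in the field of the relation, where `k` is an auxiliary variable. -/
def field (i k : ℕ) : Formula (n + 1) := ex k (or (rel i k) (rel k i))

theorem holds_field (S : Fin (n + 1) → CantorReal) {i k : ℕ} (h : i ≠ k) (v : ℕ → ℕ) :
    (field i k).Holds S v ↔ v i ∈ codedField (S 0) := by
  simp [field, codedField, h]

/-- Elements of the field of the relation are comparable. -/
def trichotomy : Formula (n + 1) :=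
  all 0 (all 1 (or (neg (and (field 0 2) (field 1 2)))
    (or (rel 0 1) (or (rel 1 0) (eq (.var 0) (.var 1))))))

/-- If the second set variable is nonempty then it has a minimal element. -/
def minimal : Formula (n + 2) :=
  or (all 0 (neg (mem (.var 0) 1)))
    (ex 0 (and (mem (.var 0) 1) (all 1 (neg (and (mem (.var 1) 1) (rel 1 0))))))

theorem holds_trichotomy (S : Fin (n + 1) → CantorReal) (v : ℕ → ℕ) :
    trichotomy.Holds S v ↔ ∀ i ∈ codedField (S 0), ∀ j ∈ codedField (S 0),
      codedRel (S 0) i j ∨ codedRel (S 0) j i ∨ i = j := by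
  simp only [trichotomy, Holds, holds_or, holds_field S (show (0 : ℕ) ≠ 2 by decide),
    holds_field S (show (1 : ℕ) ≠ 2 by decide), holds_rel, Term.val]
  simp [or_iff_not_imp_left]
  tauto

theorem holds_minimal (S : Fin (n + 2) → CantorReal) (v : ℕ → ℕ) :
    minimal.Holds S v ↔ (∀ i, S 1 i ≠ true) ∨
      ∃ i, S 1 i = true ∧ ∀ j, ¬ (S 1 j = true ∧ codedRel (S 0) j i) := by
  simp [minimal, Holds, Term.val]

end Formula

/-- A predecessor always belongs to the field, so well-foundedness can be stated on all of `ℕ`.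
Transitivity need not be mentioned, as it follows from trichotomy and well-foundedness. -/
theorem mem_WO_iff {x : CantorReal} :
    x ∈ WO ↔ (∀ i ∈ codedField x, ∀ j ∈ codedField x,
      codedRel x i j ∨ codedRel x j i ∨ i = j) ∧ WellFounded (codedRel x) := by
  constructor
  · intro h
    have h : IsWellOrder (codedField x) (fun i j => codedRel x i j) := h
    refine ⟨fun i hi j hj => ?_, ?_⟩
    · by_contra! hne
      exact hne.2.2 (congrArg Subtype.val (h.toTrichotomous.trichotomous ⟨i, hi⟩ ⟨j, hj⟩
        hne.1 hne.2.1))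
    · have key : ∀ i : codedField x, Acc (codedRel x) i := fun i =>
        h.toIsWellFounded.wf.induction (C := fun i => Acc (codedRel x) i) i fun i ih =>
          ⟨_, fun j hj => ih ⟨j, i, .inl hj⟩ hj⟩
      exact ⟨fun i => ⟨_, fun j hj => key ⟨j, i, .inl hj⟩⟩⟩
  · rintro ⟨h1, h2⟩
    have : Std.Trichotomous fun i j : codedField x => codedRel x i j :=
      ⟨fun i j hij hji => Subtype.ext (((h1 i i.2 j j.2).resolve_left hij).resolve_left hji)⟩
    have : IsWellFounded (codedField x) fun i j => codedRel x i j :=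
      ⟨InvImage.wf Subtype.val h2⟩
    exact ⟨⟩

/-- Trichotomy is arithmetical. Well-foundedness says that every nonempty set has a minimal element,
which takes a single universal set quantifier. -/
theorem isPi11_WO : IsPi11 WO := by
  refine ⟨1, .and .trichotomy .minimal, fun x => ?_⟩
  simp only [Formula.Holds, Formula.holds_trichotomy, Formula.holds_minimal, mem_WO_iff,
    Fin.cons_zero, Fin.cons_one, forall_and, forall_const, WellFounded.wellFounded_iff_has_min]
  refine and_congr_right fun _ => ⟨fun h Y => ?_, fun h s hs => ?_⟩
  · refine or_iff_not_imp_left.2 fun hY => ?_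
    push Not at hY
    obtain ⟨i, hi, hmin⟩ := h {i | Y 0 i = true} hY
    exact ⟨i, hi, fun j hj => hmin j hj.1 hj.2⟩
  · classical
    obtain ⟨i, hi⟩ := hs
    rcases h fun _ j => decide (j ∈ s) with h | ⟨j, hj, hmin⟩
    · exact absurd (decide_eq_true hi) (h i)
    · exact ⟨j, of_decide_eq_true hj, fun k hk hkj => hmin k ⟨decide_eq_true hk, hkj⟩⟩

end SecondOrderArith

theorem ITTM.infiniteTimeDecidable_of_isPi11 {A : Set CantorReal}
    (hA : SecondOrderArith.IsPi11 A) : ITTM.InfiniteTimeDecidable A := by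
  simpa using (infiniteTimeDecidable_of_isSigma11 hA.compl).2

/-- The set of reals coding well-orders is infinite time decidable, and so are all `Π¹₁` and all
`Σ¹₁` sets of reals. -/
theorem mainTheorem1 :
    ITTM.InfiniteTimeDecidable WO ∧
      (∀ A : Set CantorReal, SecondOrderArith.IsPi11 A → ITTM.InfiniteTimeDecidable A) ∧
      (∀ A : Set CantorReal, SecondOrderArith.IsSigma11 A → ITTM.InfiniteTimeDecidable A) :=
  ⟨ITTM.infiniteTimeDecidable_of_isPi11 SecondOrderArith.isPi11_WO,
    fun _ => ITTM.infiniteTimeDecidable_of_isPi11,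
    fun _ hA => (ITTM.infiniteTimeDecidable_of_isSigma11 hA).1⟩
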